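/- **Setting.** Let $d\ge 2$. For $a:\mathbb R^d\to\mathbb R^{d\times d}$ write $\mathbf s=\tfrac12(a+a^t)$ and $\mathbf k=\tfrac12(a-a^t)$. Let $\Omega$ be the set of all (measurable) $a$ such that $\mathbf s$ is positive definite almost everywhere, $\mathbf s,\mathbf s^{-1}\in L^1_{\rm loc}(\mathbb R^d)$, and either $\mathbf s^{-1/2}\mathbf k\,\mathbf s^{-1/2}\in L^\infty_{\rm loc}(\mathbb R^d)$, or both $\mathbf s^{-1/2}\mathbf k\in L^2_{\rm loc}(\mathbb R^d)$ and $\mathbf s^{-1/2}\nabla\cdot\mathbf k\in L^2_{\rm loc}(\mathbb R^d)$ (weak divergence). Equip $\Omega$ with the $\sigma$-field $\mathcal F$ generated by the maps $a\mapsto\int_{\mathbb R^d} e'\cdot a(x)e\,\varphi(x)\,dx$, $e,e'\in\mathbb R^d$, $\varphi\in C_c^\infty(\mathbb R^d)$, and let $T_za=a(\cdot+z)$. Write $\square_n=(-3^n/2,3^n/2)^d$, so that $|\square_0|=1$; inequalities between symmetric matrices are in the Loewner order, and matrix expectations and averages are entrywise. Let $\mathbb P$ be a probability measure on $(\Omega,\mathcal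 F)$ which is * stationary: $\mathbb P\circ T_z=\mathbb P$ for all $z\in\mathbb Z^d$; * ergodic: if $A\in\mathcal F$ and $A=\bigcap_{z\in\mathbb Z^d}T_zA$, then $\mathbb P[A]\in\{0,1\}$; * of finite first moments: $\mathbb E\big[\int_{\square_0}\mathbf s^{-1}\big]<\infty$ and $\mathbb E\big[\int_{\square_0}(\mathbf s+\mathbf k^t\mathbf s^{-1}\mathbf k)\big]<\infty$. **Coarse-grained matrices.** For $a\in\Omega$, a bounded Lipschitz domain $U$ (open and connected) and $p,q\in\mathbb R^d$, let $\mathcal A(U)$ be the set of weakly differentiable $u\in L^1(U)$ with $\int_U\nabla u\cdot\mathbf s\nabla u<\infty$, $\int_U u=0$, and $\int_U\nabla\varphi\cdot a\nabla u=0$ for all $\varphi\in C_c^\infty(U)$, and set $$J(U,p,q)=\sup_{u\in\mathcal A(U)}\frac1{|U|}\int_U\Big(-\tfrac12\nabla u\cdot\mathbf s\nabla u-p\cdot a\nabla u+q\cdot\nabla u\Big).$$ The coarse-grained matrices $\mathbf s(U),\mathbf s_*^{-1}(U)$ (symmetric) and $\mathbf k(U)$ are those given by $$J(U,p,q)=\tfrac12p\cdot\mathbf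 s(U)p+\tfrac12(q+\mathbf k(U)p)\cdot\mathbf s_*^{-1}(U)(q+\mathbf k(U)p)-p\cdot q\qquad\text{for all }p,q\in\mathbb R^d.$$ For matrices $\sigma,\sigma_*,\kappa\in\mathbb R^{d\times d}$ with $\sigma_*$ invertible put $$\mathcal B(\sigma,\sigma_*,\kappa)=\begin{pmatrix}\sigma+\kappa^t\sigma_*^{-1}\kappa&-\kappa^t\sigma_*^{-1}\\-\sigma_*^{-1}\kappa&\sigma_*^{-1}\end{pmatrix},\qquad \mathbf A(U)=\mathcal B(\mathbf s(U),\mathbf s_*(U),\mathbf k(U)).$$ Finally let $$\bar{\mathbf s}_*(U)=\mathbb E[\mathbf s_*^{-1}(U)]^{-1},\qquad \bar{\mathbf k}(U)=\bar{\mathbf s}_*(U)\,\mathbb E[\mathbf s_*^{-1}(U)\mathbf k(U)],$$ $$\bar{\mathbf s}(U)=\mathbb E[\mathbf s(U)+\mathbf k^t(U)\mathbf s_*^{-1}(U)\mathbf k(U)]-\bar{\mathbf k}^t(U)\bar{\mathbf s}_*^{-1}(U)\bar{\mathbf k}(U),\qquad \overline{\mathbf A}(U)=\mathcal B(\bar{\mathbf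 s}(U),\bar{\mathbf s}_*(U),\bar{\mathbf k}(U)).$$ **Proposition 3.2.** There exist a deterministic matrix $\overline{\mathbf A}\in\mathbb R^{2d\times2d}$, deterministic symmetric positive definite matrices $\bar{\mathbf s},\bar{\mathbf s}_*\in\mathbb R^{d\times d}$ and a deterministic matrix $\bar{\mathbf k}\in\mathbb R^{d\times d}$ such that the following hold. 1. For every bounded Lipschitz domain $U$, $\ \lim_{t\to\infty}\mathbf A(tU)=\overline{\mathbf A}$ almost surely ($t$ real). 2. $\overline{\mathbf A}=\mathcal B(\bar{\mathbf s},\bar{\mathbf s}_*,\bar{\mathbf k})$. 3. For every integer $n\ge0$ the entries of $\mathbf A(\square_n)$ are integrable and $\overline{\mathbf A}(\square_n)=\mathbb E[\mathbf A(\square_n)]$. As $n\to\infty$, $\overline{\mathbf A}(\square_n)$ converges to $\overline{\mathbf A}$ and is non-increasing, $\bar{\mathbf s}(\square_n)$ converges to $\bar{\mathbf s}$ and is non-increasing, and $\bar{\mathbf s}_*(\square_n)$ converges to $\bar{\mathbf s}_*$ and is non-decreasing. 4. $\displaystyle \mathbb E\Big[\int_{\square_0}\mathbf s^{-1}\Big]^{-1}\le\bar{\mathbf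 s}_*\le\bar{\mathbf s}\le\bar{\mathbf s}+\bar{\mathbf k}^t\bar{\mathbf s}_*^{-1}\bar{\mathbf k}\le\mathbb E\Big[\int_{\square_0}\big(\mathbf s+\mathbf k^t\mathbf s^{-1}\mathbf k\big)\Big].$ 5. $\displaystyle -(\bar{\mathbf s}-\bar{\mathbf s}_*)\le\tfrac12(\bar{\mathbf k}+\bar{\mathbf k}^t)\le\bar{\mathbf s}-\bar{\mathbf s}_*.$ -/

import Mathlib

open MeasureTheory Filter Topology Matrix
open scoped ContDiff Pointwise MatrixOrder

noncomputable section

namespace CoarseGraining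

/-- Euclidean space `ℝ^d`. -/
abbrev Space (d : ℕ) : Type := EuclideanSpace ℝ (Fin d)

/-- Real `d × d` matrices.  With `MatrixOrder` open, `≤` on them is the Loewner order. -/
abbrev Mat (d : ℕ) : Type := Matrix (Fin d) (Fin d) ℝ

/-- Real `2d × 2d` matrices, written in `d × d` blocks. -/
abbrev Mat2 (d : ℕ) : Type := Matrix (Fin d ⊕ Fin d) (Fin d ⊕ Fin d) ℝ

variable {d : ℕ}

/-! ### Pointwise linear algebra -/

/-- Symmetric part of a matrix. -/
def symPart (M : Mat d) : Mat d := (1 / 2 : ℝ) • (M + Mᵀ)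

/-- Skew-symmetric part of a matrix. -/
def skewPart (M : Mat d) : Mat d := (1 / 2 : ℝ) • (M - Mᵀ)

/-- `S^{-1/2}`, for a positive definite matrix `S`, by functional calculus. -/
def invSqrt (S : Mat d) : Mat d := cfc (fun t : ℝ => (Real.sqrt t)⁻¹) S

/-- `b = s + kᵗ s⁻¹ k`, where `s` and `k` are the symmetric and skew-symmetric parts of `M`. -/
def bMat (M : Mat d) : Mat d :=
  symPart M + (skewPart M)ᵀ * (symPart M)⁻¹ * skewPart M

/-! ### Test functions and weak derivatives -/

/-- `φ ∈ C_c^∞(U)`. -/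
def IsTestFunction (U : Set (Space d)) (φ : Space d → ℝ) : Prop :=
  ContDiff ℝ ∞ φ ∧ HasCompactSupport φ ∧ tsupport φ ⊆ U

/-- The classical gradient, as the vector of partial derivatives. -/
def grad (φ : Space d → ℝ) (x : Space d) : Fin d → ℝ :=
  fun i => fderiv ℝ φ x (EuclideanSpace.single i (1 : ℝ))

/-- `f ∈ L^p_loc(ℝ^d)`. -/
def MemLpLoc (p : ENNReal) (f : Space d → ℝ) : Prop :=
  ∀ K : Set (Space d), IsCompact K → MemLp f p (volume.restrict K)

/-- `D` is the weak divergence of the matrix field `k` on `ℝ^d`, `D_i = ∑_j ∂_j k_{ij}`. -/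
def IsWeakDiv (k : Space d → Mat d) (D : Space d → Fin d → ℝ) : Prop :=
  (∀ i, MemLpLoc 1 (fun x => D x i)) ∧
  ∀ φ : Space d → ℝ, IsTestFunction Set.univ φ → ∀ i,
    ∫ x, D x i * φ x = -∫ x, (k x *ᵥ grad φ x) i

/-- `G` is the weak gradient of `u` in the open set `U`. -/
def HasWeakGrad (U : Set (Space d)) (u : Space d → ℝ) (G : Space d → Fin d → ℝ) : Prop :=
  LocallyIntegrableOn u U ∧ (∀ i, LocallyIntegrableOn (fun x => G x i) U) ∧
  ∀ φ : Space d → ℝ, IsTestFunction U φ → ∀ i,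
    ∫ x in U, u x * grad φ x i = -∫ x in U, G x i * φ x

/-! ### The space of coefficient fields -/

/-- Admissible coefficient fields: `s` is positive definite almost everywhere,
`s, s⁻¹ ∈ L¹_loc`, and either `s^{-1/2} k s^{-1/2} ∈ L^∞_loc`, or
`s^{-1/2} k ∈ L²_loc` and `s^{-1/2} (∇ · k) ∈ L²_loc`. -/
def IsAdmissible (a : Space d → Mat d) : Prop :=
  (∀ᵐ x, (symPart (a x)).PosDef) ∧
  (∀ i j, MemLpLoc 1 (fun x => symPart (a x) i j)) ∧
  (∀ i j, MemLpLoc 1 (fun x => (symPart (a x))⁻¹ i j)) ∧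
  ((∀ i j, MemLpLoc ⊤
      (fun x => (invSqrt (symPart (a x)) * skewPart (a x) * invSqrt (symPart (a x))) i j)) ∨
   ((∀ i j, MemLpLoc 2 (fun x => (invSqrt (symPart (a x)) * skewPart (a x)) i j)) ∧
    ∃ D : Space d → Fin d → ℝ, IsWeakDiv (fun x => skewPart (a x)) D ∧
      ∀ i, MemLpLoc 2 (fun x => (invSqrt (symPart (a x)) *ᵥ D x) i)))

/-- The probability space `Ω` of admissible coefficient fields. -/
structure Coeff (d : ℕ) : Type where
  /-- The coefficient field `a(·)`. -/
  field : Space d → Mat d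
  admissible : IsAdmissible field

/-- The `σ`-field on `Ω` generated by the random variables `a ↦ ∫ e' · a(x) e φ(x) dx`,
`e, e' ∈ ℝ^d`, `φ ∈ C_c^∞(ℝ^d)`. -/
instance : MeasurableSpace (Coeff d) :=
  ⨆ (e : Fin d → ℝ) (e' : Fin d → ℝ) (φ : Space d → ℝ) (_ : IsTestFunction Set.univ φ),
    MeasurableSpace.comap (fun a : Coeff d => ∫ x, (e' ⬝ᵥ (a.field x *ᵥ e)) * φ x) (borel ℝ)

theorem MemLpLoc.shift {p : ENNReal} {f : Space d → ℝ} (hf : MemLpLoc p f) (v : Space d) :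
    MemLpLoc p (fun x => f (x + v)) := by
  intro K hK
  have hK' : IsCompact ((fun x => x + v) '' K) := hK.image (by fun_prop)
  have h := hf _ hK'
  have hmp := (measurePreserving_add_right (volume : Measure (Space d)) v).restrict_image_emb
    (measurableEmbedding_addRight v) K
  exact h.comp_measurePreserving hmp

theorem IsTestFunction.shift {φ : Space d → ℝ} (h : IsTestFunction Set.univ φ) (v : Space d) :
    IsTestFunction Set.univ (fun x => φ (x + v)) :=
  ⟨h.1.comp (by fun_prop), h.2.1.comp_homeomorph (Homeomorph.addRight v), Set.subset_univ _⟩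

theorem IsWeakDiv.shift {k : Space d → Mat d} {D : Space d → Fin d → ℝ}
    (h : IsWeakDiv k D) (v : Space d) :
    IsWeakDiv (fun x => k (x + v)) (fun x => D (x + v)) := by
  refine ⟨fun i => (h.1 i).shift v, fun φ hφ i => ?_⟩
  have h2 := h.2 _ (hφ.shift (-v)) i
  rw [← integral_add_right_eq_self _ v, ← integral_add_right_eq_self
    (fun x => (k x *ᵥ grad (fun x => φ (x + -v)) x) i) v] at h2
  have hg : ∀ x, grad (fun y => φ (y + -v)) (x + v) = grad φ x := by
    intro x
    ext j
    simp only [grad]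
    rw [fderiv_comp_add_right]
    simp
  simpa only [hg, add_neg_cancel_right] using h2

theorem IsAdmissible.shift {a : Space d → Mat d} (h : IsAdmissible a) (v : Space d) :
    IsAdmissible (fun x => a (x + v)) := by
  obtain ⟨h1, h2, h3, h4⟩ := h
  refine ⟨(measurePreserving_add_right (volume : Measure (Space d)) v).quasiMeasurePreserving.ae h1,
    fun i j => (h2 i j).shift v, fun i j => (h3 i j).shift v, ?_⟩
  rcases h4 with h4 | ⟨h4, D, hD, hD2⟩
  · exact Or.inl fun i j => (h4 i j).shift v
  · exact Or.inr ⟨fun i j => (h4 i j).shift v, fun x => D (x + v), hD.shift v,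
      fun i => (hD2 i).shift v⟩

/-- The translation `T_z : a(·) ↦ a(· + z)` of `Ω`, for `z ∈ ℤ^d`. -/
def translate (z : Fin d → ℤ) (a : Coeff d) : Coeff d where
  field x := a.field (x + WithLp.toLp 2 (fun i => (z i : ℝ)))
  admissible := a.admissible.shift _

/-! ### Domains -/

/-- The triadic cube `(-3^n/2, 3^n/2)^d`. -/
def cube (d n : ℕ) : Set (Space d) := {x | ∀ i, |x i| < (3 : ℝ) ^ n / 2}

/-- Bounded Lipschitz domains: bounded, open, connected, non-empty sets which near each boundary
point are, in suitable orthonormal coordinates, the region above the graph of a Lipschitz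
function `γ`. Here `ν` is the vertical direction, and `y - ⟪ν, y⟫ ν` the horizontal component
of `y`. -/
def IsBoundedLipschitzDomain (U : Set (Space d)) : Prop :=
  IsOpen U ∧ IsConnected U ∧ Bornology.IsBounded U ∧
  ∀ x ∈ frontier U, ∃ r > 0, ∃ ν : Space d, ‖ν‖ = 1 ∧
    ∃ (γ : Space d → ℝ) (K : NNReal), LipschitzWith K γ ∧
      ∀ y ∈ Metric.ball x r, y ∈ U ↔ γ (y - inner ℝ ν y • ν) < inner ℝ ν y

/-! ### Coarse-grained matrices -/

/-- `u`, with weak gradient `G`, belongs to the space `𝒜(U)` of mean-zero functions of finite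
energy solving `∇ · a∇u = 0` in `U` in the sense of distributions. -/
structure IsSolution (a : Space d → Mat d) (U : Set (Space d))
    (u : Space d → ℝ) (G : Space d → Fin d → ℝ) : Prop where
  integrable : IntegrableOn u U
  weakGrad : HasWeakGrad U u G
  energy : IntegrableOn (fun x => G x ⬝ᵥ (symPart (a x) *ᵥ G x)) U
  equation : ∀ φ : Space d → ℝ, IsTestFunction U φ →
    ∫ x in U, grad φ x ⬝ᵥ (a x *ᵥ G x) = 0
  mean_zero : ⨍ x in U, u x = 0

/-- `J(U,p,q) = sup_{u ∈ 𝒜(U)} ⨍_U (-½ ∇u · s∇u - p · a∇u + q · ∇u)`. -/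
def J (a : Space d → Mat d) (U : Set (Space d)) (p q : Fin d → ℝ) : ℝ :=
  sSup {r : ℝ | ∃ (u : Space d → ℝ) (G : Space d → Fin d → ℝ), IsSolution a U u G ∧
    r = ⨍ x in U, (-(1 / 2) * (G x ⬝ᵥ (symPart (a x) *ᵥ G x))
      - p ⬝ᵥ (a x *ᵥ G x) + q ⬝ᵥ G x)}

/-- The `i`-th standard basis vector. -/
def basisVec (i : Fin d) : Fin d → ℝ := Pi.single i 1

/-
The coarse-grained matrices `s(U)`, `s_*⁻¹(U)`, `k(U)` are those for which
`J(U,p,q) = ½ p · s(U) p + ½ (q + k(U) p) · s_*⁻¹(U) (q + k(U) p) - p · q` for all `p, q`,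
with `s(U)`, `s_*⁻¹(U)` symmetric. Below they are read off from `J` by polarization;
`coarse_eq_of_J_eq` records that this recovers the matrices of that formula.
-/

/-- `b(U)`: the matrix of the quadratic form `p ↦ 2 J(U,p,0)`. -/
def cgB (a : Space d → Mat d) (U : Set (Space d)) : Mat d :=
  Matrix.of fun i j => J a U (basisVec i + basisVec j) 0
    - J a U (basisVec i) 0 - J a U (basisVec j) 0

/-- `s_*⁻¹(U)`: the matrix of the quadratic form `q ↦ 2 J(U,0,q)`. -/
def cgSstarInv (a : Space d → Mat d) (U : Set (Space d)) : Mat d :=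
  Matrix.of fun i j => J a U 0 (basisVec i + basisVec j)
    - J a U 0 (basisVec i) - J a U 0 (basisVec j)

/-- `s_*⁻¹(U) k(U)`: the matrix of the bilinear form
`(q, p) ↦ J(U,p,q) - J(U,p,0) - J(U,0,q) + p · q`. -/
def cgCross (a : Space d → Mat d) (U : Set (Space d)) : Mat d :=
  Matrix.of fun i j => J a U (basisVec j) (basisVec i)
    - J a U (basisVec j) 0 - J a U 0 (basisVec i) + basisVec j ⬝ᵥ basisVec i

/-- `k(U)`. -/
def cgK (a : Space d → Mat d) (U : Set (Space d)) : Mat d :=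
  (cgSstarInv a U)⁻¹ * cgCross a U

/-- `s(U)`. -/
def cgS (a : Space d → Mat d) (U : Set (Space d)) : Mat d :=
  cgB a U - (cgK a U)ᵀ * cgSstarInv a U * cgK a U

theorem coarse_eq_of_J_eq (a : Space d → Mat d) (U : Set (Space d)) (S T K : Mat d)
    (hS : S.IsSymm) (hT : T.IsSymm) (hT' : IsUnit T.det)
    (hJ : ∀ p q : Fin d → ℝ, J a U p q = 1 / 2 * (p ⬝ᵥ (S *ᵥ p))
      + 1 / 2 * ((q + K *ᵥ p) ⬝ᵥ (T *ᵥ (q + K *ᵥ p))) - p ⬝ᵥ q) :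
    cgS a U = S ∧ cgSstarInv a U = T ∧ cgK a U = K := by
  have bil : ∀ (M : Mat d) (i j : Fin d), basisVec i ⬝ᵥ (M *ᵥ basisVec j) = M i j := by
    intro M i j; simp [basisVec]
  have symm : ∀ (M : Mat d), M.IsSymm → ∀ v w : Fin d → ℝ,
      v ⬝ᵥ (M *ᵥ w) = w ⬝ᵥ (M *ᵥ v) := by
    intro M hM v w
    rw [dotProduct_mulVec, ← mulVec_transpose, hM.eq, dotProduct_comm]
  have hTe : cgSstarInv a U = T := by
    ext i j
    simp only [cgSstarInv, of_apply, hJ, mulVec_zero, zero_dotProduct, dotProduct_zero, add_zero,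
      mulVec_add, add_dotProduct, dotProduct_add, bil, hT.apply i j]
    ring
  have quad : ∀ p q : Fin d → ℝ, (q + K *ᵥ p) ⬝ᵥ (T *ᵥ (q + K *ᵥ p))
      = q ⬝ᵥ (T *ᵥ q) + 2 * (q ⬝ᵥ ((T * K) *ᵥ p)) + p ⬝ᵥ ((Kᵀ * T * K) *ᵥ p) := by
    intro p q
    have h1 := symm T hT q (K *ᵥ p)
    have h2 : p ⬝ᵥ ((Kᵀ * T * K) *ᵥ p) = (K *ᵥ p) ⬝ᵥ (T *ᵥ (K *ᵥ p)) := by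
      rw [← mulVec_mulVec, ← mulVec_mulVec, dotProduct_mulVec, vecMul_transpose]
    rw [h2, ← mulVec_mulVec]
    simp only [mulVec_add, add_dotProduct, dotProduct_add, ← h1]
    ring
  have hC : cgCross a U = T * K := by
    ext i j
    simp only [cgCross, of_apply, hJ, quad]
    simp only [mulVec_zero, zero_dotProduct, dotProduct_zero, bil]
    ring
  have hK : cgK a U = K := by
    rw [cgK, hTe, hC, Matrix.nonsing_inv_mul_cancel_left _ _ hT']
  have hQ : (Kᵀ * T * K).IsSymm := by
    simp only [IsSymm, transpose_mul, transpose_transpose, hT.eq, Matrix.mul_assoc]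
  have hB : cgB a U = S + Kᵀ * T * K := by
    ext i j
    simp only [cgB, of_apply, hJ, quad]
    simp only [mulVec_zero, zero_dotProduct, dotProduct_zero,
      mulVec_add, add_dotProduct, dotProduct_add, bil, Matrix.add_apply, hS.apply i j, hQ.apply i j]
    ring
  exact ⟨by rw [cgS, hK, hB, hTe, add_sub_cancel_right], hTe, hK⟩

/-- The `2d × 2d` block matrix built from `s`, `s_*⁻¹` and `k`. -/
def blockForm (s sstarInv k : Mat d) : Mat2 d :=
  Matrix.fromBlocks (s + kᵀ * sstarInv * k) (-(kᵀ * sstarInv)) (-(sstarInv * k)) sstarInv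

/-- The double-variable coarse-grained matrix `A(U)`. -/
def cgA (a : Space d → Mat d) (U : Set (Space d)) : Mat2 d :=
  blockForm (cgS a U) (cgSstarInv a U) (cgK a U)

/-! ### Averages, expectations and the assumptions on the law -/

/-- Entrywise spatial average of a matrix field. -/
def avgMat (U : Set (Space d)) (M : Space d → Mat d) : Mat d :=
  Matrix.of fun i j => ⨍ x in U, M x i j

/-- Entrywise expectation of a random matrix. -/
def expMat {ι : Type} (P : Measure (Coeff d)) (F : Coeff d → Matrix ι ι ℝ) : Matrix ι ι ℝ :=
  Matrix.of fun i j => ∫ a, F a i j ∂P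

/-- Every entry of the random matrix `F` is integrable. -/
def IntegrableMat {ι : Type} (P : Measure (Coeff d)) (F : Coeff d → Matrix ι ι ℝ) : Prop :=
  ∀ i j, Integrable (fun a => F a i j) P

/-- Stationarity with respect to `ℤ^d` translations. -/
def IsZdStationary (P : Measure (Coeff d)) : Prop :=
  ∀ (z : Fin d → ℤ) (A : Set (Coeff d)), MeasurableSet A → P (translate z ⁻¹' A) = P A

/-- Ergodicity with respect to `ℤ^d` translations. -/
def IsZdErgodic (P : Measure (Coeff d)) : Prop :=
  ∀ A : Set (Coeff d), MeasurableSet A → A = ⋂ z : Fin d → ℤ, translate z '' A →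
    P A = 0 ∨ P A = 1

/-- Finite first moments of `⨍ s⁻¹` and `⨍ (s + kᵗ s⁻¹ k)` over the unit cube. -/
def HasFiniteMoments (P : Measure (Coeff d)) : Prop :=
  IntegrableMat P (fun a => avgMat (cube d 0) (fun x => (symPart (a.field x))⁻¹)) ∧
  IntegrableMat P (fun a => avgMat (cube d 0) (fun x => bMat (a.field x)))

/-! ### Deterministic matrices at finite scale -/

/-- `s̄_*(U) = E[s_*⁻¹(U)]⁻¹`. -/
def homSstar (P : Measure (Coeff d)) (U : Set (Space d)) : Mat d :=
  (expMat P fun a => cgSstarInv a.field U)⁻¹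

/-- `k̄(U) = s̄_*(U) E[s_*⁻¹(U) k(U)]`. -/
def homK (P : Measure (Coeff d)) (U : Set (Space d)) : Mat d :=
  homSstar P U * expMat P fun a => cgSstarInv a.field U * cgK a.field U

/-- `s̄(U) = E[s(U) + kᵗ(U) s_*⁻¹(U) k(U)] - k̄ᵗ(U) s̄_*⁻¹(U) k̄(U)`. -/
def homS (P : Measure (Coeff d)) (U : Set (Space d)) : Mat d :=
  (expMat P fun a => cgS a.field U + (cgK a.field U)ᵀ * cgSstarInv a.field U * cgK a.field U)
    - (homK P U)ᵀ * (homSstar P U)⁻¹ * homK P U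

/-- `Ā(U)`, the block matrix built from `s̄(U)`, `s̄_*⁻¹(U)` and `k̄(U)`. -/
def homA (P : Measure (Coeff d)) (U : Set (Space d)) : Mat2 d :=
  blockForm (homS P U) (homSstar P U)⁻¹ (homK P U)

end CoarseGraining

end

open CoarseGraining

/-! The extensive quantity `energySup`, that is |U| J(U,p,q), is nonnegative. It is subadditive,
because a solution restricted to a smaller open set is, up to a constant, a solution there. It is
bounded by the integral of the explicit density `bulk`, whose mean over the unit cube is finite. By
stationarity the mean of J over triadic cubes therefore decreases, to a limit `limEnergy`.

Structure on cubes. With h = s^{1/2}∇u and ζ = s^{-1/2}(q - aᵗp), the integrand of J is -½|h|² +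
ζ·h. The fields h coming from solutions form exactly the orthogonal complement in L² of the fields
s^{-1/2}(Y - aᵗX), where X is the gradient and Y the curl of test functions. One inclusion is
integration by parts; the other needs that an integrable curl-free field on a cube is a weak
gradient (`exists_weakGrad_of_curlFree`). Hence |U| J is half the squared norm of a projection of ζ
(`energySup_box_eq`). This gives three things: J is a quadratic form in (p,q); J is an infimum of
explicit functionals over a separable set, so it is measurable in the coefficient field; and J ≥
-2p·q, because (p+X)·(q+Y) has the same integral as p·q. Together with J ≥ 0 this says that the form
2J + 2p·q dominates both 2p·q and -2p·q, which is `IsCoarse`. Positivity, s_* ≤ s and the bound on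
the symmetric part of k all follow from `IsCoarse` by completing the square, and monotonicity of the
matrices follows from that of the form.

Almost sure convergence on tU is a subadditive ergodic theorem (`ae_tendsto_energySup_smul`). The
additive part is an ergodic theorem for weighted lattice averages (`ae_tendsto_latticeAvg`), proved
by density of constants plus coboundaries and a Vitali-type maximal inequality. The set tU is
compared with cubes of size 3^m, averaged over all shifts of the triadic grid, so that every integer
point is a centre once and ergodicity is needed only for the full group ℤ^d. The upper bound is
subadditivity. For the lower bound, `gap` measures the failure of additivity from scale 3^m to
3^{m+k}; it is a superadditive process whose mean density is at most the distance of the m-th mean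
from its limit, so the maximal inequality makes it small uniformly in k, for infinitely many m.
Boundary layers are negligible because the boundary of a Lipschitz domain is a null set.

The matrices are polarizations of finitely many values of J, and the limiting s_*⁻¹ is positive
definite, so every algebraic operation passes to the limit. -/

noncomputable section

namespace CoarseGraining

variable {d : ℕ}

/-! ### Linear algebra of block matrices -/

section LinearAlgebra

variable {ι : Type*} [Fintype ι]

theorem dotProduct_mulVec_comm_of_isSymm {M : Matrix ι ι ℝ} (hM : M.IsSymm) (x y : ι → ℝ) :
    x ⬝ᵥ (M *ᵥ y) = y ⬝ᵥ (M *ᵥ x) := by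
  rw [dotProduct_mulVec, ← mulVec_transpose, hM.eq, dotProduct_comm]

theorem posSemidef_of_quad {M : Matrix ι ι ℝ} (hM : M.IsSymm) (h : ∀ x, 0 ≤ x ⬝ᵥ (M *ᵥ x)) :
    M.PosSemidef :=
  PosSemidef.of_dotProduct_mulVec_nonneg (by rwa [IsHermitian, conjTranspose_eq_transpose_of_trivial])
    (fun x => by simpa using h x)

theorem posDef_of_quad {M : Matrix ι ι ℝ} (hM : M.IsSymm) (h : ∀ x, x ≠ 0 → 0 < x ⬝ᵥ (M *ᵥ x)) :
    M.PosDef :=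
  PosDef.of_dotProduct_mulVec_pos (by rwa [IsHermitian, conjTranspose_eq_transpose_of_trivial])
    (fun x hx => by simpa using h x hx)

omit [Fintype ι] in
theorem _root_.Matrix.PosDef.isSymm' {M : Matrix ι ι ℝ} (h : M.PosDef) : M.IsSymm := by
  have := h.isHermitian; rwa [IsHermitian, conjTranspose_eq_transpose_of_trivial] at this

theorem _root_.Matrix.PosDef.quad_pos {M : Matrix ι ι ℝ} (h : M.PosDef) {x : ι → ℝ} (hx : x ≠ 0) :
    0 < x ⬝ᵥ (M *ᵥ x) := by
  simpa using h.dotProduct_mulVec_pos hx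

theorem _root_.Matrix.PosDef.quad_nonneg {M : Matrix ι ι ℝ} (h : M.PosDef) (x : ι → ℝ) :
    0 ≤ x ⬝ᵥ (M *ᵥ x) := by
  simpa using h.posSemidef.dotProduct_mulVec_nonneg x

theorem le_of_quad {M N : Matrix ι ι ℝ} (hM : M.IsSymm) (hN : N.IsSymm)
    (h : ∀ x, x ⬝ᵥ (M *ᵥ x) ≤ x ⬝ᵥ (N *ᵥ x)) : M ≤ N := by
  rw [Matrix.le_iff]
  refine posSemidef_of_quad (hN.sub hM) fun x => ?_
  rw [sub_mulVec, dotProduct_sub]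
  linarith [h x]

variable [DecidableEq ι]

theorem _root_.Matrix.PosDef.mul_inv' {M : Matrix ι ι ℝ} (h : M.PosDef) : M * M⁻¹ = 1 :=
  M.mul_nonsing_inv ((isUnit_iff_isUnit_det _).1 h.isUnit)

theorem _root_.Matrix.PosDef.inv_mul' {M : Matrix ι ι ℝ} (h : M.PosDef) : M⁻¹ * M = 1 :=
  M.nonsing_inv_mul ((isUnit_iff_isUnit_det _).1 h.isUnit)

/-- Young's inequality for a positive definite matrix. -/
theorem _root_.Matrix.PosDef.two_mul_dotProduct_le {M : Matrix ι ι ℝ} (h : M.PosDef) (x y : ι → ℝ) :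
    2 * (x ⬝ᵥ y) ≤ x ⬝ᵥ (M⁻¹ *ᵥ x) + y ⬝ᵥ (M *ᵥ y) := by
  have key := h.inv.quad_nonneg (x - M *ᵥ y)
  have e1 : M⁻¹ *ᵥ (M *ᵥ y) = y := by rw [mulVec_mulVec, h.inv_mul', one_mulVec]
  have e2 : (M *ᵥ y) ⬝ᵥ (M⁻¹ *ᵥ x) = x ⬝ᵥ y := by
    rw [dotProduct_mulVec_comm_of_isSymm h.inv.isSymm', e1]
  rw [mulVec_sub, dotProduct_sub, sub_dotProduct, sub_dotProduct, e1, e2,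
    dotProduct_comm (M *ᵥ y) y] at key
  linarith

/-- The form of the inverse is a Legendre transform, x·M⁻¹x = sup over y of 2x·y - y·My, hence order
reversing; testing with y = N⁻¹x is enough. -/
theorem _root_.Matrix.PosDef.inv_anti {M N : Matrix ι ι ℝ} (hM : M.PosDef) (hN : N.PosDef)
    (h : ∀ x, x ⬝ᵥ (M *ᵥ x) ≤ x ⬝ᵥ (N *ᵥ x)) : N⁻¹ ≤ M⁻¹ := by
  refine le_of_quad hN.inv.isSymm' hM.inv.isSymm' fun x => ?_
  have h1 := hM.two_mul_dotProduct_le x (N⁻¹ *ᵥ x)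
  have h2 := h (N⁻¹ *ᵥ x)
  rw [mulVec_mulVec x N, hN.mul_inv', one_mulVec, dotProduct_comm (N⁻¹ *ᵥ x) x] at h2
  linarith

end LinearAlgebra

/-- The quadratic form `(p, q) ↦ p · B p + 2 q · C p + q · T q`. -/
def blockQuad (B C T : Mat d) (p q : Fin d → ℝ) : ℝ :=
  p ⬝ᵥ (B *ᵥ p) + 2 * (q ⬝ᵥ (C *ᵥ p)) + q ⬝ᵥ (T *ᵥ q)

/-- The block matrix of the quadratic form `(p, -q) ↦ blockQuad B C T p q`. -/
def blockMat (B C T : Mat d) : Mat2 d := fromBlocks B (-Cᵀ) (-C) T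

/-- Symmetric block data whose quadratic form dominates `± 2 p · q`. -/
structure IsCoarse (B C T : Mat d) : Prop where
  symmB : B.IsSymm
  symmT : T.IsSymm
  le_quad : ∀ p q, 2 * (p ⬝ᵥ q) ≤ blockQuad B C T p q
  neg_le_quad : ∀ p q, -(2 * (p ⬝ᵥ q)) ≤ blockQuad B C T p q

/-- The Schur complement of `T`. -/
def schur (B C T : Mat d) : Mat d := B - (T⁻¹ * C)ᵀ * T * (T⁻¹ * C)

theorem blockMat_isSymm {B C T : Mat d} (hB : B.IsSymm) (hT : T.IsSymm) :
    (blockMat B C T).IsSymm := by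
  simp [blockMat, IsSymm, fromBlocks_transpose, hB.eq, hT.eq]

theorem blockMat_quad (B C T : Mat d) (v : Fin d ⊕ Fin d → ℝ) :
    v ⬝ᵥ (blockMat B C T *ᵥ v) = blockQuad B C T (v ∘ Sum.inl) (-(v ∘ Sum.inr)) := by
  conv_lhs => rw [← Sum.elim_comp_inl_inr v]
  rw [blockMat, fromBlocks_mulVec, blockQuad]
  simp only [Sum.elim_comp_inl, Sum.elim_comp_inr, sumElim_dotProduct_sumElim, dotProduct_add,
    neg_mulVec, dotProduct_neg, neg_dotProduct, mulVec_neg]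
  have : (v ∘ Sum.inl) ⬝ᵥ (Cᵀ *ᵥ (v ∘ Sum.inr)) = (v ∘ Sum.inr) ⬝ᵥ (C *ᵥ (v ∘ Sum.inl)) := by
    rw [mulVec_transpose, dotProduct_comm, ← dotProduct_mulVec]
  rw [this]; ring

namespace IsCoarse

variable {B C T : Mat d}

/-- Adding the two bounds at (p, q) and (p, -q) cancels the cross term in `C`. -/
theorem decoupled (h : IsCoarse B C T) (p q : Fin d → ℝ) :
    -(2 * (p ⬝ᵥ q)) ≤ p ⬝ᵥ (B *ᵥ p) + q ⬝ᵥ (T *ᵥ q) := by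
  have h1 := h.neg_le_quad p q
  have h2 := h.le_quad p (-q)
  simp only [blockQuad, mulVec_neg, dotProduct_neg, neg_dotProduct] at h1 h2
  linarith

/-- Taking p = -εq in `decoupled` gives 2ε|q|² ≤ ε² q·Bq + q·Tq. If q·Tq ≤ 0 this fails for small ε.
-/
theorem posDef (h : IsCoarse B C T) : T.PosDef := by
  refine posDef_of_quad h.symmT fun q hq => ?_
  have hq2 : 0 < q ⬝ᵥ q := by
    simpa using (dotProduct_star_self_pos_iff (v := q)).2 hq
  set b := q ⬝ᵥ (B *ᵥ q)
  by_contra! hle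
  have key := fun ε : ℝ => h.decoupled (-ε • q) q
  simp only [mulVec_smul, dotProduct_smul, smul_dotProduct, smul_eq_mul] at key
  -- This ε makes ε(|b| + 1) = |q|², so that εb ≤ |q|² < 2|q|².
  have h1 := key ((q ⬝ᵥ q) / (|b| + 1))
  have hb := abs_nonneg b
  have hb2 := le_abs_self b
  set n := q ⬝ᵥ q
  have hε : 0 < n / (|b| + 1) := by positivity
  set ε := n / (|b| + 1)
  have hε2 : ε * (|b| + 1) = n := by simp only [ε]; field_simp
  have h3 : 2 * ε * n ≤ ε * ε * b := by
    change -(2 * (-ε * n)) ≤ -ε * (-ε * b) + _ at h1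
    nlinarith
  have h4 : 2 * n ≤ ε * b := by
    by_contra! h5
    nlinarith
  nlinarith

theorem mul_cross (h : IsCoarse B C T) : T * (T⁻¹ * C) = C := by
  rw [← Matrix.mul_assoc, h.posDef.mul_inv', Matrix.one_mul]

theorem schur_isSymm (h : IsCoarse B C T) : (schur B C T).IsSymm := by
  unfold schur
  refine h.symmB.sub ?_
  simp only [IsSymm, transpose_mul, transpose_transpose, h.symmT.eq, Matrix.mul_assoc]

theorem blockForm_eq (h : IsCoarse B C T) : blockForm (schur B C T) T (T⁻¹ * C) = blockMat B C T := by
  rw [blockForm, blockMat, schur, sub_add_cancel, h.mul_cross]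
  congr 2
  rw [transpose_mul, h.posDef.inv.isSymm'.eq, Matrix.mul_assoc, h.posDef.inv_mul', Matrix.mul_one]

/-- Completion of the square in `q`. Thus the form of `schur` is the minimum over `q` of the block
form, attained at q = -T⁻¹Cp. -/
theorem quad_eq (h : IsCoarse B C T) (p q : Fin d → ℝ) :
    blockQuad B C T p q = p ⬝ᵥ (schur B C T *ᵥ p)
      + (q + (T⁻¹ * C) *ᵥ p) ⬝ᵥ (T *ᵥ (q + (T⁻¹ * C) *ᵥ p)) := by
  set K := T⁻¹ * C with hK
  have hC : C = T * K := h.mul_cross.symm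
  have h1 := dotProduct_mulVec_comm_of_isSymm h.symmT q (K *ᵥ p)
  have h2 : p ⬝ᵥ ((Kᵀ * T * K) *ᵥ p) = (K *ᵥ p) ⬝ᵥ (T *ᵥ (K *ᵥ p)) := by
    rw [← mulVec_mulVec, ← mulVec_mulVec, dotProduct_mulVec, vecMul_transpose]
  rw [schur, ← hK, sub_mulVec, dotProduct_sub, h2, blockQuad]
  conv_lhs => rw [hC, ← mulVec_mulVec]
  simp only [mulVec_add, add_dotProduct, dotProduct_add, ← h1]
  ring

theorem schur_quad_le (h : IsCoarse B C T) (p q : Fin d → ℝ) :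
    p ⬝ᵥ (schur B C T *ᵥ p) ≤ blockQuad B C T p q := by
  rw [h.quad_eq]
  linarith [h.posDef.quad_nonneg (q + (T⁻¹ * C) *ᵥ p)]

theorem schur_quad_eq (h : IsCoarse B C T) (p : Fin d → ℝ) :
    p ⬝ᵥ (schur B C T *ᵥ p) = blockQuad B C T p (-((T⁻¹ * C) *ᵥ p)) := by
  rw [h.quad_eq]
  simp

/-- With K = T⁻¹C, the choices q = -Kp ± T⁻¹p reduce the completed square to p·T⁻¹p, while p·q
becomes -p·Kp ± p·T⁻¹p. The two bounds of `IsCoarse` then control both signs of p·Kp. -/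
theorem cross_bounds (h : IsCoarse B C T) (p : Fin d → ℝ) :
    2 * |p ⬝ᵥ ((T⁻¹ * C) *ᵥ p)| ≤ p ⬝ᵥ (schur B C T *ᵥ p) - p ⬝ᵥ (T⁻¹ *ᵥ p) := by
  have e : ∀ r : Fin d → ℝ, T *ᵥ (T⁻¹ *ᵥ r) = r := fun r => by
    rw [mulVec_mulVec, h.posDef.mul_inv', one_mulVec]
  have h1 := h.le_quad p (-((T⁻¹ * C) *ᵥ p) + T⁻¹ *ᵥ p)
  have h2 := h.neg_le_quad p (-((T⁻¹ * C) *ᵥ p) - T⁻¹ *ᵥ p)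
  rw [h.quad_eq] at h1 h2
  rw [show -((T⁻¹ * C) *ᵥ p) + T⁻¹ *ᵥ p + (T⁻¹ * C) *ᵥ p = T⁻¹ *ᵥ p by abel, e,
    dotProduct_comm (T⁻¹ *ᵥ p) p] at h1
  rw [show -((T⁻¹ * C) *ᵥ p) - T⁻¹ *ᵥ p + (T⁻¹ * C) *ᵥ p = -(T⁻¹ *ᵥ p) by abel, mulVec_neg, e,
    neg_dotProduct_neg, dotProduct_comm (T⁻¹ *ᵥ p) p] at h2
  simp only [dotProduct_add, dotProduct_sub, dotProduct_neg] at h1 h2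
  rcases abs_cases (p ⬝ᵥ ((T⁻¹ * C) *ᵥ p)) with ⟨h3, _⟩ | ⟨h3, _⟩ <;> rw [h3] <;> linarith

theorem inv_le_schur (h : IsCoarse B C T) : T⁻¹ ≤ schur B C T :=
  le_of_quad h.posDef.inv.isSymm' h.schur_isSymm fun p => by
    linarith [h.cross_bounds p, abs_nonneg (p ⬝ᵥ ((T⁻¹ * C) *ᵥ p))]

theorem schur_posDef (h : IsCoarse B C T) : (schur B C T).PosDef :=
  posDef_of_quad h.schur_isSymm fun p hp => by
    linarith [h.cross_bounds p, abs_nonneg (p ⬝ᵥ ((T⁻¹ * C) *ᵥ p)), h.posDef.inv.quad_pos hp]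

theorem quad_half_add_transpose (K : Mat d) (p : Fin d → ℝ) :
    p ⬝ᵥ (((1 / 2 : ℝ) • (K + Kᵀ)) *ᵥ p) = p ⬝ᵥ (K *ᵥ p) := by
  rw [smul_mulVec, dotProduct_smul, add_mulVec, dotProduct_add, mulVec_transpose,
    dotProduct_comm p (p ᵥ* K), ← dotProduct_mulVec, smul_eq_mul]
  ring

theorem isSymm_half_add_transpose (K : Mat d) : ((1 / 2 : ℝ) • (K + Kᵀ)).IsSymm := by
  simp [IsSymm, add_comm]

theorem symm_cross_le (h : IsCoarse B C T) :
    (1 / 2 : ℝ) • (T⁻¹ * C + (T⁻¹ * C)ᵀ) ≤ schur B C T - T⁻¹ := by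
  refine le_of_quad (isSymm_half_add_transpose _) (h.schur_isSymm.sub h.posDef.inv.isSymm')
    fun p => ?_
  rw [quad_half_add_transpose, sub_mulVec, dotProduct_sub]
  linarith [h.cross_bounds p, abs_nonneg (p ⬝ᵥ ((T⁻¹ * C) *ᵥ p)),
    le_abs_self (p ⬝ᵥ ((T⁻¹ * C) *ᵥ p))]

theorem neg_le_symm_cross (h : IsCoarse B C T) :
    -(schur B C T - T⁻¹) ≤ (1 / 2 : ℝ) • (T⁻¹ * C + (T⁻¹ * C)ᵀ) := by
  refine le_of_quad (h.schur_isSymm.sub h.posDef.inv.isSymm').neg (isSymm_half_add_transpose _)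
    fun p => ?_
  rw [quad_half_add_transpose, neg_mulVec, dotProduct_neg, sub_mulVec, dotProduct_sub]
  linarith [h.cross_bounds p, abs_nonneg (p ⬝ᵥ ((T⁻¹ * C) *ᵥ p)),
    neg_abs_le (p ⬝ᵥ ((T⁻¹ * C) *ᵥ p))]

theorem le_schur_add (h : IsCoarse B C T) :
    schur B C T ≤ schur B C T + (T⁻¹ * C)ᵀ * T * (T⁻¹ * C) := by
  have hs : ((T⁻¹ * C)ᵀ * T * (T⁻¹ * C)).IsSymm := by
    simp only [IsSymm, transpose_mul, transpose_transpose, h.symmT.eq, Matrix.mul_assoc]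
  refine le_of_quad h.schur_isSymm (h.schur_isSymm.add hs) fun p => ?_
  have h2 : p ⬝ᵥ (((T⁻¹ * C)ᵀ * T * (T⁻¹ * C)) *ᵥ p)
      = ((T⁻¹ * C) *ᵥ p) ⬝ᵥ (T *ᵥ ((T⁻¹ * C) *ᵥ p)) := by
    rw [← mulVec_mulVec, ← mulVec_mulVec, dotProduct_mulVec, vecMul_transpose]
  rw [add_mulVec, dotProduct_add, h2]
  linarith [h.posDef.quad_nonneg ((T⁻¹ * C) *ᵥ p)]

/-- A minimum over `q` is monotone in the form that is minimized. -/
theorem schur_mono {B' C' T' : Mat d} (h : IsCoarse B C T) (h' : IsCoarse B' C' T')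
    (hle : ∀ p q, blockQuad B C T p q ≤ blockQuad B' C' T' p q) :
    schur B C T ≤ schur B' C' T' := by
  refine le_of_quad h.schur_isSymm h'.schur_isSymm fun p => ?_
  rw [h'.schur_quad_eq]
  exact (h.schur_quad_le p _).trans (hle p _)

theorem inv_anti {B' C' T' : Mat d} (h : IsCoarse B C T) (h' : IsCoarse B' C' T')
    (hle : ∀ p q, blockQuad B C T p q ≤ blockQuad B' C' T' p q) : T'⁻¹ ≤ T⁻¹ :=
  h.posDef.inv_anti h'.posDef fun q => by simpa [blockQuad] using hle 0 q

theorem blockMat_mono {B' C' T' : Mat d} (h : IsCoarse B C T) (h' : IsCoarse B' C' T')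
    (hle : ∀ p q, blockQuad B C T p q ≤ blockQuad B' C' T' p q) :
    blockMat B C T ≤ blockMat B' C' T' :=
  le_of_quad (blockMat_isSymm h.symmB h.symmT) (blockMat_isSymm h'.symmB h'.symmT) fun v => by
    rw [blockMat_quad, blockMat_quad]; exact hle _ _

end IsCoarse

/-! ### Pointwise facts about the matrix square root -/

theorem symPart_isSymm (M : Mat d) : (symPart M).IsSymm := by
  simp [symPart, IsSymm, add_comm]

theorem skewPart_transpose (M : Mat d) : (skewPart M)ᵀ = -skewPart M := by
  simp only [skewPart, transpose_smul, transpose_sub, transpose_transpose, ← smul_neg, neg_sub]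

theorem symPart_add_skewPart (M : Mat d) : symPart M + skewPart M = M := by
  ext i j
  simp only [symPart, skewPart, Matrix.add_apply, Matrix.smul_apply, Matrix.sub_apply, smul_eq_mul]
  ring

theorem symPart_sub_skewPart (M : Mat d) : symPart M - skewPart M = Mᵀ := by
  ext i j
  simp only [symPart, skewPart, Matrix.add_apply, Matrix.smul_apply, Matrix.sub_apply, smul_eq_mul]
  ring

section InvSqrt

variable {S : Mat d}

theorem continuousOn_spectrum (S : Mat d) (f : ℝ → ℝ) : ContinuousOn f (spectrum ℝ S) :=
  S.finite_real_spectrum.continuousOn f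

theorem pos_of_mem_spectrum (hS : S.PosDef) {t : ℝ} (ht : t ∈ spectrum ℝ S) : 0 < t := by
  rw [hS.isHermitian.spectrum_real_eq_range_eigenvalues] at ht
  obtain ⟨i, rfl⟩ := ht
  exact hS.eigenvalues_pos i

theorem invSqrt_isSymm (S : Mat d) : (invSqrt S).IsSymm := by
  have h : IsSelfAdjoint (invSqrt S) := cfc_predicate _ S
  rwa [IsSelfAdjoint, star_eq_conjTranspose, conjTranspose_eq_transpose_of_trivial] at h

theorem mul_invSqrt_mul_invSqrt (hS : S.PosDef) : S * (invSqrt S * invSqrt S) = 1 := by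
  have hsa : IsSelfAdjoint S := hS.isHermitian
  rw [invSqrt, ← cfc_mul _ _ S (continuousOn_spectrum S _) (continuousOn_spectrum S _)]
  conv_lhs => enter [1]; rw [← cfc_id' ℝ S]
  rw [← cfc_mul _ _ S (continuousOn_spectrum S _) (continuousOn_spectrum S _),
    ← cfc_const_one ℝ S]
  refine cfc_congr fun t ht => ?_
  have h0 := pos_of_mem_spectrum hS ht
  have h1 : Real.sqrt t ≠ 0 := (Real.sqrt_pos.2 h0).ne'
  have h2 := Real.mul_self_sqrt h0.le
  change t * ((Real.sqrt t)⁻¹ * (Real.sqrt t)⁻¹) = 1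
  field_simp
  nlinarith

theorem invSqrt_mul_self (hS : S.PosDef) : invSqrt S * invSqrt S = S⁻¹ :=
  (inv_eq_right_inv (mul_invSqrt_mul_invSqrt hS)).symm

theorem sqrt_mul_invSqrt (hS : S.PosDef) : (S * invSqrt S) * invSqrt S = 1 := by
  rw [Matrix.mul_assoc, mul_invSqrt_mul_invSqrt hS]

theorem invSqrt_mul_sqrt (hS : S.PosDef) : invSqrt S * (S * invSqrt S) = 1 :=
  mul_eq_one_comm.1 (sqrt_mul_invSqrt hS)

theorem sqrt_isSymm (hS : S.PosDef) : (S * invSqrt S)ᵀ = S * invSqrt S := by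
  have h1 := congrArg transpose (sqrt_mul_invSqrt hS)
  rw [transpose_mul, (invSqrt_isSymm S).eq, transpose_one] at h1
  have h2 := invSqrt_mul_sqrt hS
  calc (S * invSqrt S)ᵀ = (S * invSqrt S) * invSqrt S * (S * invSqrt S)ᵀ := by
        rw [sqrt_mul_invSqrt hS, Matrix.one_mul]
    _ = S * invSqrt S := by rw [Matrix.mul_assoc, h1, Matrix.mul_one]

theorem sqrt_mul_sqrt (hS : S.PosDef) : (S * invSqrt S) * (S * invSqrt S) = S := by
  rw [Matrix.mul_assoc, invSqrt_mul_sqrt hS, Matrix.mul_one]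

/-- Weierstrass approximation on [1/(n+1), n+1]. The polynomials do not depend on the matrix, so
`invSqrt` of a measurable positive definite field is a pointwise limit of polynomials in its entries
and is therefore measurable. -/
theorem exists_polynomial_tendsto_inv_sqrt : ∃ p : ℕ → Polynomial ℝ, ∀ t : ℝ, 0 < t →
    Tendsto (fun n => (p n).eval t) atTop (𝓝 (Real.sqrt t)⁻¹) := by
  have h : ∀ n : ℕ, ∃ p : Polynomial ℝ, ∀ x ∈ Set.Icc (1 / ((n : ℝ) + 1)) ((n : ℝ) + 1),
      |p.eval x - (Real.sqrt x)⁻¹| < 1 / ((n : ℝ) + 1) := fun n => by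
    refine exists_polynomial_near_of_continuousOn _ _ (fun x => (Real.sqrt x)⁻¹) ?_ _
      (by positivity)
    refine ContinuousOn.inv₀ (by fun_prop) fun x hx => ?_
    exact (Real.sqrt_pos.2 (lt_of_lt_of_le (by positivity) hx.1)).ne'
  choose p hp using h
  refine ⟨p, fun t ht => ?_⟩
  rw [tendsto_iff_dist_tendsto_zero]
  have h1 : Tendsto (fun n : ℕ => 1 / ((n : ℝ) + 1)) atTop (𝓝 0) :=
    tendsto_one_div_add_atTop_nhds_zero_nat
  have h2 : Tendsto (fun n : ℕ => (n : ℝ) + 1) atTop atTop :=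
    tendsto_atTop_add_const_right _ _ tendsto_natCast_atTop_atTop
  refine squeeze_zero' (Eventually.of_forall fun _ => dist_nonneg) ?_ h1
  filter_upwards [h1.eventually_le_const ht, h2.eventually_ge_atTop t] with n hn1 hn2
  rw [Real.dist_eq]
  exact (hp n t ⟨hn1, hn2⟩).le

theorem tendsto_aeval_invSqrt {p : ℕ → Polynomial ℝ}
    (hp : ∀ t : ℝ, 0 < t → Tendsto (fun n => (p n).eval t) atTop (𝓝 (Real.sqrt t)⁻¹))
    (hS : S.PosDef) :
    Tendsto (fun n => Polynomial.aeval S (p n)) atTop (𝓝 (invSqrt S)) := by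
  have hsa : IsSelfAdjoint S := hS.isHermitian
  have e : ∀ n, Polynomial.aeval S (p n) = hS.isHermitian.cfc (p n).eval := fun n => by
    rw [← Matrix.IsHermitian.cfc_eq, cfc_polynomial _ S hsa]
  simp only [e]
  rw [invSqrt, Matrix.IsHermitian.cfc_eq hS.isHermitian]
  simp only [IsHermitian.cfc, Unitary.conjStarAlgAut_apply]
  refine (Tendsto.const_mul _ ?_).mul_const _
  refine (continuous_id.matrix_diagonal.tendsto _).comp (tendsto_pi_nhds.2 fun i => ?_)
  exact hp _ (hS.eigenvalues_pos i)

end InvSqrt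

/-! ### Measurability of matrix operations -/

theorem measurable_inv_entry (i j : Fin d) :
    Measurable fun M : Fin d → Fin d → ℝ => (Matrix.of M)⁻¹ i j := by
  have h1 : Continuous fun M : Fin d → Fin d → ℝ => Matrix.of M := continuous_id
  -- Cramer's formula; it also holds at singular matrices, where both sides vanish by the convention
  -- 0⁻¹ = 0.
  have : (fun M : Fin d → Fin d → ℝ => (Matrix.of M)⁻¹ i j)
      = fun M => (Matrix.of M).det⁻¹ * (Matrix.of M).adjugate i j := by
    ext M
    rw [Matrix.inv_def, Ring.inverse_eq_inv', Matrix.smul_apply, smul_eq_mul]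
  rw [this]
  exact h1.matrix_det.measurable.inv.mul (h1.matrix_adjugate.matrix_elem i j).measurable

variable {α : Type*} [MeasurableSpace α] {μ : Measure α}

theorem aemeasurable_mul_entry {M N : α → Mat d}
    (hM : ∀ i j, AEMeasurable (fun x => M x i j) μ) (hN : ∀ i j, AEMeasurable (fun x => N x i j) μ)
    (i j : Fin d) : AEMeasurable (fun x => (M x * N x) i j) μ := by
  simp only [Matrix.mul_apply]
  exact Finset.aemeasurable_fun_sum _ fun l _ => (hM i l).mul (hN l j)

theorem aemeasurable_invSqrt {S : α → Mat d} (hS : ∀ i j, AEMeasurable (fun x => S x i j) μ)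
    (hpos : ∀ᵐ x ∂μ, (S x).PosDef) (i j : Fin d) :
    AEMeasurable (fun x => invSqrt (S x) i j) μ := by
  obtain ⟨p, hp⟩ := exists_polynomial_tendsto_inv_sqrt
  refine aemeasurable_of_tendsto_metrizable_ae' (f := fun n x => Polynomial.aeval (S x) (p n) i j)
    (fun n => ?_) ?_
  · have h1 : Continuous fun M : Fin d → Fin d → ℝ => Polynomial.aeval (Matrix.of M) (p n) i j :=
      Continuous.matrix_elem ((Polynomial.continuous_aeval (p n)).comp continuous_id) i j
    have h2 : AEMeasurable (fun x => fun i j => S x i j) μ :=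
      aemeasurable_pi_iff.2 fun i => aemeasurable_pi_iff.2 fun j => hS i j
    exact h1.measurable.comp_aemeasurable h2
  · filter_upwards [hpos] with x hx
    exact ((continuous_apply_apply i j).tendsto _).comp (tendsto_aeval_invSqrt hp hx)

/-! ### Admissible coefficient fields -/

/-- The field `s^{-1/2}`. -/
def rho (a : Space d → Mat d) (x : Space d) : Mat d := invSqrt (symPart (a x))

/-- The field `s^{-1/2} aᵗ`. -/
def fluxMat (a : Space d → Mat d) (x : Space d) : Mat d := rho a x * (a x)ᵀ

theorem MemLpLoc.aemeasurable {p : ENNReal} {f : Space d → ℝ} (hf : MemLpLoc p f) :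
    AEMeasurable f := by
  refine AEStronglyMeasurable.aemeasurable ?_
  have h : ∀ n : ℕ, AEStronglyMeasurable f (volume.restrict (Metric.closedBall 0 (n : ℝ))) :=
    fun n => (hf _ (isCompact_closedBall _ _)).1
  have h2 := aestronglyMeasurable_iUnion_iff.2 h
  rwa [Metric.iUnion_closedBall_nat, Measure.restrict_univ] at h2

theorem MemLpLoc.locallyIntegrable {f : Space d → ℝ} (hf : MemLpLoc 1 f) :
    LocallyIntegrable f :=
  locallyIntegrable_iff.2 fun K hK => memLp_one_iff_integrable.1 (hf K hK)

theorem MemLpLoc.add {p : ENNReal} {f g : Space d → ℝ} (hf : MemLpLoc p f) (hg : MemLpLoc p g) :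
    MemLpLoc p (fun x => f x + g x) := fun K hK => (hf K hK).add (hg K hK)

theorem MemLpLoc.sum {p : ENNReal} {κ : Type*} (s : Finset κ) {f : κ → Space d → ℝ}
    (hf : ∀ i ∈ s, MemLpLoc p (f i)) : MemLpLoc p (fun x => ∑ i ∈ s, f i x) :=
  fun K hK => memLp_finsetSum s fun i hi => hf i hi K hK

theorem MemLpLoc.mul_two {f g : Space d → ℝ} (hf : MemLpLoc 2 f) (hg : MemLpLoc 2 g) :
    MemLpLoc 1 (fun x => f x * g x) := fun K hK =>
  memLp_one_iff_integrable.2 ((hf K hK).integrable_mul (hg K hK))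

theorem MemLpLoc.congr {p : ENNReal} {f g : Space d → ℝ} (hf : MemLpLoc p f)
    (h : ∀ᵐ x, f x = g x) : MemLpLoc p g :=
  fun K hK => (memLp_congr_ae (ae_restrict_of_ae h)).1 (hf K hK)

theorem memLpLoc_two_of_sq_le {f g : Space d → ℝ} (hf : AEMeasurable f) (hg : MemLpLoc 1 g)
    (h : ∀ᵐ x, f x ^ 2 ≤ g x) : MemLpLoc 2 f := fun K hK => by
  rw [memLp_two_iff_integrable_sq hf.aestronglyMeasurable.restrict]
  refine Integrable.mono' (memLp_one_iff_integrable.1 (hg K hK))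
    (hf.aestronglyMeasurable.restrict.pow 2) ?_
  filter_upwards [ae_restrict_of_ae h] with x hx
  rwa [Real.norm_of_nonneg (sq_nonneg _)]

namespace IsAdmissible

variable {a : Space d → Mat d}

/-- A diagonal entry of M Mᵗ is the squared norm of a row of M. Square roots of locally integrable
matrix fields are therefore locally square integrable. -/
theorem sq_entry_le {M N : Mat d} (h : M * Mᵀ = N) (i j : Fin d) : M i j ^ 2 ≤ N i i := by
  rw [← h, Matrix.mul_apply]
  simp only [transpose_apply, ← sq]
  exact Finset.single_le_sum (f := fun l => M i l ^ 2) (fun l _ => sq_nonneg _) (Finset.mem_univ j)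

theorem aemeasurable_rho (h : IsAdmissible a) (i j : Fin d) :
    AEMeasurable (fun x => rho a x i j) :=
  aemeasurable_invSqrt (fun i j => (h.2.1 i j).aemeasurable) h.1 i j

theorem memLpLoc_rho (h : IsAdmissible a) (i j : Fin d) : MemLpLoc 2 (fun x => rho a x i j) := by
  refine memLpLoc_two_of_sq_le (h.aemeasurable_rho i j) (h.2.2.1 i i) ?_
  filter_upwards [h.1] with x hx
  refine sq_entry_le ?_ i j
  rw [rho, (invSqrt_isSymm _).eq, invSqrt_mul_self hx]

theorem memLpLoc_sqrt (h : IsAdmissible a) (i j : Fin d) :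
    MemLpLoc 2 (fun x => (symPart (a x) * rho a x) i j) := by
  refine memLpLoc_two_of_sq_le (aemeasurable_mul_entry (fun i j => (h.2.1 i j).aemeasurable)
    h.aemeasurable_rho i j) (h.2.1 i i) ?_
  filter_upwards [h.1] with x hx
  refine sq_entry_le ?_ i j
  rw [rho, sqrt_isSymm hx, sqrt_mul_sqrt hx]

/-- Under the first alternative of admissibility, s^{-1/2}k is the locally bounded field s^{-1/2} k
s^{-1/2} times s^{1/2}, which is locally in L². The second alternative contains the claim. -/
theorem memLpLoc_rho_mul_skew (h : IsAdmissible a) (i j : Fin d) :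
    MemLpLoc 2 (fun x => (rho a x * skewPart (a x)) i j) := by
  rcases h.2.2.2 with h4 | h4
  · have e : ∀ᵐ x, rho a x * skewPart (a x)
        = (rho a x * skewPart (a x) * rho a x) * (symPart (a x) * rho a x) := by
      filter_upwards [h.1] with x hx
      rw [Matrix.mul_assoc (rho a x * skewPart (a x)), rho, invSqrt_mul_sqrt hx, Matrix.mul_one]
    have h5 : MemLpLoc 2 (fun x => ((rho a x * skewPart (a x) * rho a x)
        * (symPart (a x) * rho a x)) i j) := by
      simp only [Matrix.mul_apply (M := rho a _ * skewPart (a _) * rho a _)]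
      refine MemLpLoc.sum _ fun l _ K hK => ?_
      exact (h.memLpLoc_sqrt l j K hK).mul (h4 i l K hK)
    exact h5.congr (e.mono fun x hx => by rw [← hx])
  · exact h4.1 i j

theorem memLpLoc_skew (h : IsAdmissible a) (i j : Fin d) :
    MemLpLoc 1 (fun x => skewPart (a x) i j) := by
  have h5 : MemLpLoc 1 (fun x => ((symPart (a x) * rho a x) * (rho a x * skewPart (a x))) i j) := by
    simp only [Matrix.mul_apply (M := symPart (a _) * rho a _)]
    exact MemLpLoc.sum _ fun l _ => (h.memLpLoc_sqrt i l).mul_two (h.memLpLoc_rho_mul_skew l j)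
  refine h5.congr (h.1.mono fun x hx => ?_)
  rw [← Matrix.mul_assoc, rho, sqrt_mul_invSqrt hx, Matrix.one_mul]

theorem memLpLoc_entry (h : IsAdmissible a) (i j : Fin d) : MemLpLoc 1 (fun x => a x i j) :=
  ((h.2.1 i j).add (h.memLpLoc_skew i j)).congr <| Eventually.of_forall fun x => by
    rw [← Matrix.add_apply, symPart_add_skewPart]

theorem memLpLoc_fluxMat (h : IsAdmissible a) (i j : Fin d) :
    MemLpLoc 2 (fun x => fluxMat a x i j) := by
  have h1 : MemLpLoc 2 (fun x => -(rho a x * skewPart (a x)) i j) :=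
    fun K hK => (h.memLpLoc_rho_mul_skew i j K hK).neg
  refine ((h.memLpLoc_sqrt i j).add h1).congr (h.1.mono fun x hx => ?_)
  have e : symPart (a x) * rho a x = rho a x * symPart (a x) := by
    conv_lhs => rw [rho, ← sqrt_isSymm hx, transpose_mul, (symPart_isSymm _).eq,
      (invSqrt_isSymm _).eq]
    rfl
  rw [fluxMat, ← symPart_sub_skewPart, Matrix.mul_sub, Matrix.sub_apply, e, sub_eq_add_neg]

/-- Since a s⁻¹ aᵗ = (s+k) s⁻¹ (s-k) = s - k s⁻¹ k, the matrix b is the Gram matrix of s^{-1/2}aᵗ.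
-/
theorem bMat_eq {M : Mat d} (hM : (symPart M).PosDef) :
    bMat M = (invSqrt (symPart M) * Mᵀ)ᵀ * (invSqrt (symPart M) * Mᵀ) := by
  rw [transpose_mul, transpose_transpose, (invSqrt_isSymm _).eq, Matrix.mul_assoc,
    ← Matrix.mul_assoc (invSqrt _) (invSqrt _), invSqrt_mul_self hM, bMat, skewPart_transpose]
  set S := symPart M
  set K := skewPart M
  have e : M * (S⁻¹ * Mᵀ) = (S + K) * (S⁻¹ * (S - K)) := by
    rw [symPart_add_skewPart, symPart_sub_skewPart]
  rw [e]
  have h1 := hM.inv_mul'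
  have h2 := hM.mul_inv'
  change S⁻¹ * S = 1 at h1
  change S * S⁻¹ = 1 at h2
  rw [Matrix.mul_sub, h1, Matrix.mul_sub, Matrix.add_mul, ← Matrix.mul_assoc, Matrix.add_mul, h2,
    Matrix.mul_one, Matrix.mul_one, Matrix.add_mul, Matrix.one_mul]
  simp only [Matrix.neg_mul]
  abel

theorem memLpLoc_bMat (h : IsAdmissible a) (i j : Fin d) :
    MemLpLoc 1 (fun x => bMat (a x) i j) := by
  have h5 : MemLpLoc 1 (fun x => ((fluxMat a x)ᵀ * fluxMat a x) i j) := by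
    simp only [Matrix.mul_apply, transpose_apply]
    exact MemLpLoc.sum _ fun l _ => (h.memLpLoc_fluxMat l i).mul_two (h.memLpLoc_fluxMat l j)
  refine h5.congr (h.1.mono fun x hx => ?_)
  rw [bMat_eq hx]
  rfl

end IsAdmissible

/-! ### Test functions -/

namespace IsTestFunction

variable {U V : Set (Space d)} {φ ψ : Space d → ℝ}

theorem mono (h : IsTestFunction U φ) (hUV : U ⊆ V) : IsTestFunction V φ :=
  ⟨h.1, h.2.1, h.2.2.trans hUV⟩

theorem zero (U : Set (Space d)) : IsTestFunction U (fun _ => 0) :=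
  ⟨contDiff_const, HasCompactSupport.zero, by
    rw [show tsupport (fun _ : Space d => (0 : ℝ)) = ∅ from
      tsupport_eq_empty_iff.2 rfl]; exact Set.empty_subset _⟩

theorem add (h : IsTestFunction U φ) (h' : IsTestFunction U ψ) :
    IsTestFunction U (fun x => φ x + ψ x) :=
  ⟨h.1.add h'.1, h.2.1.add h'.2.1, (tsupport_add φ ψ).trans (Set.union_subset h.2.2 h'.2.2)⟩

theorem const_mul (h : IsTestFunction U φ) (c : ℝ) : IsTestFunction U (fun x => c * φ x) :=
  ⟨contDiff_const.mul h.1, h.2.1.mul_left (f := fun _ => c),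
    (tsupport_mul_subset_right (f := fun _ => c)).trans h.2.2⟩

theorem continuous (h : IsTestFunction U φ) : Continuous φ := h.1.continuous

theorem differentiable (h : IsTestFunction U φ) : Differentiable ℝ φ :=
  h.1.differentiable (by simp)

theorem grad (h : IsTestFunction U φ) (i : Fin d) : IsTestFunction U (fun x => grad φ x i) := by
  have e : (fun x => CoarseGraining.grad φ x i)
      = fun x => fderiv ℝ φ x (EuclideanSpace.single i (1 : ℝ)) := rfl
  rw [e]
  refine ⟨(h.1.fderiv_right (m := ∞) (by simp)).clm_apply contDiff_const,
    h.2.1.fderiv_apply (𝕜 := ℝ) _, (tsupport_fderiv_apply_subset ℝ _).trans h.2.2⟩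

theorem integrable (h : IsTestFunction U φ) : Integrable φ :=
  h.continuous.integrable_of_hasCompactSupport h.2.1

theorem eq_zero_of_notMem (h : IsTestFunction U φ) {x : Space d} (hx : x ∉ U) : φ x = 0 :=
  image_eq_zero_of_notMem_tsupport fun hx' => hx (h.2.2 hx')

theorem grad_eq_zero_of_notMem (h : IsTestFunction U φ) {x : Space d} (hx : x ∉ U) :
    CoarseGraining.grad φ x = 0 := by
  ext i; exact (h.grad i).eq_zero_of_notMem hx

theorem exists_bound (h : IsTestFunction U φ) : ∃ C, ∀ x, ‖φ x‖ ≤ C :=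
  h.2.1.exists_bound_of_continuous h.continuous

theorem memLp_top (h : IsTestFunction U φ) (μ : Measure (Space d)) : MemLp φ ⊤ μ := by
  obtain ⟨C, hC⟩ := h.exists_bound
  exact memLp_top_of_bound h.continuous.aestronglyMeasurable C (Eventually.of_forall hC)

theorem grad_add (h : IsTestFunction U φ) (h' : IsTestFunction U ψ) (x : Space d) :
    CoarseGraining.grad (fun x => φ x + ψ x) x = CoarseGraining.grad φ x + CoarseGraining.grad ψ x := by
  ext i
  simp only [CoarseGraining.grad, Pi.add_apply]
  rw [fderiv_fun_add (h.differentiable x) (h'.differentiable x)]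
  rfl

theorem grad_const_mul (h : IsTestFunction U φ) (c : ℝ) (x : Space d) :
    CoarseGraining.grad (fun x => c * φ x) x = c • CoarseGraining.grad φ x := by
  ext i
  simp only [CoarseGraining.grad, Pi.smul_apply]
  rw [fderiv_const_mul (h.differentiable x)]
  rfl

theorem integral_grad_eq_zero (h : IsTestFunction U φ) (i : Fin d) :
    ∫ x, CoarseGraining.grad φ x i = 0 := by
  have key := integral_mul_fderiv_eq_neg_fderiv_mul_of_integrable (𝕜 := ℝ)
    (μ := (volume : Measure (Space d)))
    (f := fun _ : Space d => (1 : ℝ)) (g := φ) (v := EuclideanSpace.single i (1 : ℝ))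
    (by simp) (by simpa using! (h.grad i).integrable) (by simpa using h.integrable)
    (by fun_prop) (fun x _ => h.differentiable x)
  simpa using! key

theorem setIntegral_grad_eq_zero (h : IsTestFunction U φ) (i : Fin d) :
    ∫ x in U, CoarseGraining.grad φ x i = 0 := by
  rw [setIntegral_eq_integral_of_forall_compl_eq_zero, h.integral_grad_eq_zero]
  exact fun x hx => (h.grad i).eq_zero_of_notMem hx

end IsTestFunction

/-! ### Finite energy fields -/

/-- The density `ζ = s^{-1/2} (q - aᵗ p)`. -/
def zeta (a : Space d → Mat d) (p q : Fin d → ℝ) (x : Space d) : Fin d → ℝ :=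
  rho a x *ᵥ q - fluxMat a x *ᵥ p

/-- The pointwise upper bound `½ (q - aᵗ p) · s⁻¹ (q - aᵗ p)`. -/
def bulk (a : Space d → Mat d) (p q : Fin d → ℝ) (x : Space d) : ℝ :=
  1 / 2 * (zeta a p q x ⬝ᵥ zeta a p q x)

/-- The integrand of `J`. -/
def integrand (a : Space d → Mat d) (p q : Fin d → ℝ) (G : Space d → Fin d → ℝ) (x : Space d) : ℝ :=
  -(1 / 2) * (G x ⬝ᵥ (symPart (a x) *ᵥ G x)) - p ⬝ᵥ (a x *ᵥ G x) + q ⬝ᵥ G x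

/-- The field `s^{1/2} G`. -/
def rootField (a : Space d → Mat d) (G : Space d → Fin d → ℝ) (x : Space d) : Fin d → ℝ :=
  (symPart (a x) * rho a x) *ᵥ G x

section Pointwise

variable {M : Mat d}

theorem sqrt_dotProduct_self (hM : (symPart M).PosDef) (v : Fin d → ℝ) :
    ((symPart M * invSqrt (symPart M)) *ᵥ v) ⬝ᵥ ((symPart M * invSqrt (symPart M)) *ᵥ v)
      = v ⬝ᵥ (symPart M *ᵥ v) := by
  conv_lhs => enter [1]; rw [← sqrt_isSymm hM, mulVec_transpose]
  rw [← dotProduct_mulVec, mulVec_mulVec, sqrt_mul_sqrt hM]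

theorem invSqrt_dotProduct_sqrt (hM : (symPart M).PosDef) (v w : Fin d → ℝ) :
    (invSqrt (symPart M) *ᵥ w) ⬝ᵥ ((symPart M * invSqrt (symPart M)) *ᵥ v) = w ⬝ᵥ v := by
  conv_lhs => enter [1]; rw [← (invSqrt_isSymm (symPart M)).eq, mulVec_transpose]
  rw [← dotProduct_mulVec, mulVec_mulVec, invSqrt_mul_sqrt hM, one_mulVec]

end Pointwise

/-- In the variable h = s^{1/2}G the integrand is -½|h|² + ζ·h. This turns the problem into
maximizing a concave quadratic functional in L², with pointwise maximum ½|ζ|² = `bulk`. -/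
theorem integrand_eq {a : Space d → Mat d} {x : Space d} (hx : (symPart (a x)).PosDef)
    (p q : Fin d → ℝ) (G : Space d → Fin d → ℝ) :
    integrand a p q G x = -(1 / 2) * (rootField a G x ⬝ᵥ rootField a G x)
      + zeta a p q x ⬝ᵥ rootField a G x := by
  rw [integrand, rootField, rho, sqrt_dotProduct_self hx, zeta, fluxMat, rho, sub_dotProduct,
    invSqrt_dotProduct_sqrt hx, ← mulVec_mulVec, invSqrt_dotProduct_sqrt hx, mulVec_transpose,
    ← dotProduct_mulVec]
  ring

theorem integrand_le_bulk {a : Space d → Mat d} {x : Space d} (hx : (symPart (a x)).PosDef)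
    (p q : Fin d → ℝ) (G : Space d → Fin d → ℝ) : integrand a p q G x ≤ bulk a p q x := by
  rw [integrand_eq hx, bulk]
  have h : 0 ≤ (zeta a p q x - rootField a G x) ⬝ᵥ (zeta a p q x - rootField a G x) :=
    Finset.sum_nonneg fun i _ => mul_self_nonneg _
  simp only [sub_dotProduct, dotProduct_sub] at h
  rw [dotProduct_comm (rootField a G x) (zeta a p q x)] at h
  linarith

theorem bulk_nonneg (a : Space d → Mat d) (p q : Fin d → ℝ) (x : Space d) : 0 ≤ bulk a p q x :=
  mul_nonneg (by norm_num) (Finset.sum_nonneg fun i _ => mul_self_nonneg _)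

theorem restrict_le_restrict_closure (U : Set (Space d)) :
    volume.restrict U ≤ volume.restrict (closure U) :=
  Measure.restrict_mono subset_closure le_rfl

theorem MemLpLoc.restrict {p : ENNReal} {f : Space d → ℝ} (hf : MemLpLoc p f) {U : Set (Space d)}
    (hU : Bornology.IsBounded U) : MemLp f p (volume.restrict U) :=
  (hf _ hU.isCompact_closure).mono_measure (restrict_le_restrict_closure U)

namespace IsAdmissible

variable {a : Space d → Mat d}

theorem memLpLoc_zeta (h : IsAdmissible a) (p q : Fin d → ℝ) (i : Fin d) :
    MemLpLoc 2 (fun x => zeta a p q x i) := by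
  intro K hK
  simp only [zeta, Pi.sub_apply, mulVec, dotProduct]
  exact (memLp_finsetSum _ fun j _ => (h.memLpLoc_rho i j K hK).mul_const _).sub
    (memLp_finsetSum _ fun j _ => (h.memLpLoc_fluxMat i j K hK).mul_const _)

theorem memLpLoc_bulk (h : IsAdmissible a) (p q : Fin d → ℝ) : MemLpLoc 1 (bulk a p q) := by
  have h1 : MemLpLoc 1 (fun x => ∑ i, zeta a p q x i * zeta a p q x i) :=
    MemLpLoc.sum _ fun i _ => (h.memLpLoc_zeta p q i).mul_two (h.memLpLoc_zeta p q i)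
  intro K hK
  exact (h1 K hK).const_mul (1 / 2)

theorem integrableOn_bulk (h : IsAdmissible a) (p q : Fin d → ℝ) {U : Set (Space d)}
    (hU : Bornology.IsBounded U) : IntegrableOn (bulk a p q) U :=
  memLp_one_iff_integrable.1 ((h.memLpLoc_bulk p q).restrict hU)

variable {U : Set (Space d)} {G : Space d → Fin d → ℝ}

theorem memLp_rootField (h : IsAdmissible a)
    (hG : ∀ i, AEMeasurable (fun x => G x i) (volume.restrict U))
    (hE : IntegrableOn (fun x => G x ⬝ᵥ (symPart (a x) *ᵥ G x)) U) (i : Fin d) :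
    MemLp (fun x => rootField a G x i) 2 (volume.restrict U) := by
  have hm : AEMeasurable (fun x => rootField a G x i) (volume.restrict U) := by
    simp only [rootField, mulVec, dotProduct]
    exact Finset.aemeasurable_fun_sum _ fun j _ =>
      ((h.memLpLoc_sqrt i j).aemeasurable.restrict).mul (hG j)
  rw [memLp_two_iff_integrable_sq hm.aestronglyMeasurable]
  refine Integrable.mono' hE (hm.aestronglyMeasurable.pow 2) ?_
  filter_upwards [ae_restrict_of_ae h.1] with x hx
  rw [Real.norm_of_nonneg (sq_nonneg _), ← sqrt_dotProduct_self hx, sq]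
  exact Finset.single_le_sum (f := fun l => rootField a G x l * rootField a G x l)
    (fun l _ => mul_self_nonneg _) (Finset.mem_univ i)

/-- The integrand is ζ·s^{1/2}G, a product of two L² fields. Integrability of gradient and flux are
the special cases of a unit vector for `q` or for `p`. -/
theorem integrableOn_zeta_dotProduct (h : IsAdmissible a) (hU : Bornology.IsBounded U)
    (hG : ∀ i, AEMeasurable (fun x => G x i) (volume.restrict U))
    (hE : IntegrableOn (fun x => G x ⬝ᵥ (symPart (a x) *ᵥ G x)) U) (p q : Fin d → ℝ) :
    IntegrableOn (fun x => q ⬝ᵥ G x - p ⬝ᵥ (a x *ᵥ G x)) U := by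
  have h1 : IntegrableOn (fun x => zeta a p q x ⬝ᵥ rootField a G x) U :=
    integrable_finsetSum _ fun i _ =>
      ((h.memLpLoc_zeta p q i).restrict hU).integrable_mul (h.memLp_rootField hG hE i)
  refine h1.congr ?_
  filter_upwards [ae_restrict_of_ae h.1] with x hx
  have := integrand_eq hx p q G
  rw [integrand, rootField, rho, sqrt_dotProduct_self hx] at this
  rw [rootField, rho]
  linarith

theorem integrableOn_grad (h : IsAdmissible a) (hU : Bornology.IsBounded U)
    (hG : ∀ i, AEMeasurable (fun x => G x i) (volume.restrict U))
    (hE : IntegrableOn (fun x => G x ⬝ᵥ (symPart (a x) *ᵥ G x)) U) (i : Fin d) :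
    IntegrableOn (fun x => G x i) U := by
  simpa using h.integrableOn_zeta_dotProduct hU hG hE 0 (Pi.single i 1)

theorem integrableOn_flux (h : IsAdmissible a) (hU : Bornology.IsBounded U)
    (hG : ∀ i, AEMeasurable (fun x => G x i) (volume.restrict U))
    (hE : IntegrableOn (fun x => G x ⬝ᵥ (symPart (a x) *ᵥ G x)) U) (i : Fin d) :
    IntegrableOn (fun x => (a x *ᵥ G x) i) U := by
  have := (h.integrableOn_zeta_dotProduct hU hG hE (Pi.single i 1) 0).neg
  refine this.congr (Eventually.of_forall fun x => ?_)
  simp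

theorem integrableOn_integrand (h : IsAdmissible a) (hU : Bornology.IsBounded U)
    (hG : ∀ i, AEMeasurable (fun x => G x i) (volume.restrict U))
    (hE : IntegrableOn (fun x => G x ⬝ᵥ (symPart (a x) *ᵥ G x)) U) (p q : Fin d → ℝ) :
    IntegrableOn (integrand a p q G) U := by
  refine ((hE.const_mul (-(1 / 2))).add (h.integrableOn_zeta_dotProduct hU hG hE p q)).congr
    (Eventually.of_forall fun x => ?_)
  simp only [integrand, Pi.add_apply]
  ring

end IsAdmissible

/-! ### Solutions -/

namespace IsSolution

variable {a : Space d → Mat d} {U V : Set (Space d)} {u : Space d → ℝ} {G : Space d → Fin d → ℝ}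

theorem aemeasurable (h : IsSolution a U u G) (i : Fin d) :
    AEMeasurable (fun x => G x i) (volume.restrict U) :=
  (h.weakGrad.2.1 i).aestronglyMeasurable.aemeasurable

theorem zero (a : Space d → Mat d) (U : Set (Space d)) : IsSolution a U (fun _ => 0) (fun _ => 0) where
  integrable := integrableOn_zero
  weakGrad := ⟨locallyIntegrableOn_const 0, fun _ => locallyIntegrableOn_const 0,
    fun φ _ i => by simp⟩
  energy := by simp
  equation := by simp
  mean_zero := by simp

/-- A finite energy weak solution, normalized to have mean zero. -/
theorem of_weakGrad (hUb : Bornology.IsBounded U) (hu : IntegrableOn u U)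
    (hw : HasWeakGrad U u G) (hE : IntegrableOn (fun x => G x ⬝ᵥ (symPart (a x) *ᵥ G x)) U)
    (heq : ∀ φ : Space d → ℝ, IsTestFunction U φ → ∫ x in U, grad φ x ⬝ᵥ (a x *ᵥ G x) = 0) :
    IsSolution a U (fun x => u x - ⨍ y in U, u y) G := by
  have hfin : volume U ≠ ⊤ := hUb.measure_lt_top.ne
  have : IsFiniteMeasure (volume.restrict U) := ⟨by simpa using hUb.measure_lt_top⟩
  have hi : IntegrableOn (fun x => u x - ⨍ y in U, u y) U := hu.sub (integrable_const _)
  refine ⟨hi, ⟨hi.locallyIntegrableOn, hw.2.1, fun φ hφ i => ?_⟩, hE, heq, ?_⟩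
  · rw [← hw.2.2 φ hφ i]
    simp only [sub_mul]
    rw [integral_sub, integral_const_mul, hφ.setIntegral_grad_eq_zero, mul_zero, sub_zero]
    · exact (hu.mul_of_top_left ((hφ.grad i).memLp_top _))
    · exact (hφ.grad i).integrable.integrableOn.const_mul _
  · rw [average_eq, integral_sub_average, smul_zero]

/-- Test functions supported in V are test functions in U, and integrands vanishing off V have equal
integrals over V and U. Only the normalization of the mean changes. This is the source of
subadditivity. -/
theorem restrict (hU : IsOpen U) (hUb : Bornology.IsBounded U) (hVU : V ⊆ U)
    (h : IsSolution a U u G) : IsSolution a V (fun x => u x - ⨍ y in V, u y) G := by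
  have key : ∀ f : Space d → ℝ, (∀ x, x ∉ V → f x = 0) → ∫ x in V, f x = ∫ x in U, f x :=
    fun f hf => (setIntegral_eq_of_subset_of_forall_sdiff_eq_zero hU.measurableSet hVU
      fun x hx => hf x hx.2).symm
  refine of_weakGrad (hUb.subset hVU) (h.integrable.mono_set hVU)
    ⟨h.weakGrad.1.mono_set hVU, fun i => (h.weakGrad.2.1 i).mono_set hVU, fun φ hφ i => ?_⟩
    (h.energy.mono_set hVU) fun φ hφ => ?_
  · rw [key, key, h.weakGrad.2.2 φ (hφ.mono hVU) i]
    · intro x hx; rw [hφ.eq_zero_of_notMem hx, mul_zero]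
    · intro x hx; rw [hφ.grad_eq_zero_of_notMem hx, Pi.zero_apply, mul_zero]
  · rw [key, h.equation φ (hφ.mono hVU)]
    intro x hx; rw [hφ.grad_eq_zero_of_notMem hx, zero_dotProduct]

end IsSolution

/-! ### The extensive quantity `|U| J(U, p, q)` -/

/-- `|U| J(U,p,q)`. -/
def energySup (a : Space d → Mat d) (p q : Fin d → ℝ) (U : Set (Space d)) : ℝ :=
  volume.real U * J a U p q

theorem J_nonneg (a : Space d → Mat d) (U : Set (Space d)) (p q : Fin d → ℝ) : 0 ≤ J a U p q :=
  Real.sSup_nonneg' ⟨0, ⟨_, _, IsSolution.zero a U, by simp⟩, le_rfl⟩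

theorem energySup_nonneg (a : Space d → Mat d) (p q : Fin d → ℝ) (U : Set (Space d)) :
    0 ≤ energySup a p q U := mul_nonneg measureReal_nonneg (J_nonneg a U p q)

/-! ### Competitors, the bulk bound and subadditivity -/

section EnergySup

variable {a : Space d → Mat d} {U V : Set (Space d)} {u : Space d → ℝ} {G : Space d → Fin d → ℝ}

theorem integral_integrand_le_bulk (h : IsAdmissible a) (hU : Bornology.IsBounded U)
    (hG : ∀ i, AEMeasurable (fun x => G x i) (volume.restrict U))
    (hE : IntegrableOn (fun x => G x ⬝ᵥ (symPart (a x) *ᵥ G x)) U) (p q : Fin d → ℝ) :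
    ∫ x in U, integrand a p q G x ≤ ∫ x in U, bulk a p q x := by
  refine integral_mono_ae (h.integrableOn_integrand hU hG hE p q) (h.integrableOn_bulk p q hU) ?_
  filter_upwards [ae_restrict_of_ae h.1] with x hx using integrand_le_bulk hx p q G

theorem energySup_le {p q : Fin d → ℝ} {c : ℝ}
    (hc : ∀ u G, IsSolution a U u G → ∫ x in U, integrand a p q G x ≤ c) :
    energySup a p q U ≤ c := by
  -- The zero solution is a competitor; this also settles the case of a null set U, where
  -- `energySup` is 0.
  have hc0 : 0 ≤ c := by simpa [integrand] using hc _ _ (IsSolution.zero a U)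
  rcases eq_or_lt_of_le (measureReal_nonneg : 0 ≤ volume.real U) with h0 | h0
  · rw [energySup, ← h0, zero_mul]; exact hc0
  · rw [energySup, ← le_div_iff₀' h0]
    refine csSup_le ⟨0, ⟨_, _, IsSolution.zero a U, by simp⟩⟩ ?_
    rintro r ⟨u, G, hs, rfl⟩
    rw [setAverage_eq, smul_eq_mul]
    exact (mul_le_mul_of_nonneg_left (hc u G hs) (inv_nonneg.2 h0.le)).trans_eq
      (div_eq_inv_mul _ _).symm

theorem integral_le_energySup (h : IsAdmissible a) (hU : Bornology.IsBounded U)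
    (hs : IsSolution a U u G) (p q : Fin d → ℝ) :
    ∫ x in U, integrand a p q G x ≤ energySup a p q U := by
  rcases eq_or_lt_of_le (measureReal_nonneg : 0 ≤ volume.real U) with h0 | h0
  · have : volume U = 0 := by
      rcases (ENNReal.toReal_eq_zero_iff _).1 h0.symm with h1 | h1
      · exact h1
      · exact absurd h1 hU.measure_lt_top.ne
    rw [energySup, ← h0, zero_mul, Measure.restrict_eq_zero.2 this, integral_zero_measure]
  · rw [energySup, ← div_le_iff₀' h0]
    refine le_csSup ⟨(∫ x in U, bulk a p q x) / volume.real U, ?_⟩ ⟨u, G, hs, ?_⟩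
    · rintro r ⟨u', G', hs', rfl⟩
      rw [setAverage_eq, smul_eq_mul]
      exact (mul_le_mul_of_nonneg_left
        (integral_integrand_le_bulk h hU hs'.aemeasurable hs'.energy p q)
        (inv_nonneg.2 h0.le)).trans_eq (div_eq_inv_mul _ _).symm
    · rw [setAverage_eq, smul_eq_mul, div_eq_inv_mul]
      rfl

theorem energySup_le_bulk (h : IsAdmissible a) (hU : Bornology.IsBounded U) (p q : Fin d → ℝ) :
    energySup a p q U ≤ ∫ x in U, bulk a p q x :=
  energySup_le fun _ _ hs => integral_integrand_le_bulk h hU hs.aemeasurable hs.energy p q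

/-- Subadditivity of `|U| J(U, p, q)`. -/
theorem energySup_le_sum (h : IsAdmissible a) (hU : IsOpen U) (hUb : Bornology.IsBounded U)
    {κ : Type*} (s : Finset κ) (W : κ → Set (Space d)) (hW : ∀ i ∈ s, IsOpen (W i))
    (hWU : ∀ i ∈ s, W i ⊆ U) (hd : (s : Set κ).PairwiseDisjoint W) (p q : Fin d → ℝ) :
    energySup a p q U ≤ ∑ i ∈ s, energySup a p q (W i)
      + ∫ x in U \ ⋃ i ∈ s, W i, bulk a p q x := by
  refine energySup_le fun u G hs => ?_
  have hi := h.integrableOn_integrand hUb hs.aemeasurable hs.energy p q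
  have hsub : (⋃ i ∈ s, W i) ⊆ U := Set.iUnion₂_subset hWU
  have hm : MeasurableSet (⋃ i ∈ s, W i) :=
    s.measurableSet_biUnion fun i hi => (hW i hi).measurableSet
  rw [← integral_inter_add_sdiff hm hi, Set.inter_eq_self_of_subset_right hsub,
    integral_biUnion_finset s (fun i hi => (hW i hi).measurableSet) hd
      fun i his => hi.mono_set (hWU i his)]
  -- On each piece the restricted solution competes in the supremum; on the remainder only the
  -- pointwise bound by `bulk` is used.
  refine add_le_add (Finset.sum_le_sum fun i his => ?_) ?_
  · exact integral_le_energySup h (hUb.subset (hWU i his))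
      (hs.restrict hU hUb (hWU i his)) p q
  · refine integral_integrand_le_bulk h (hUb.subset Set.sdiff_subset) (fun i => ?_)
      (hs.energy.mono_set Set.sdiff_subset) p q
    exact (hs.aemeasurable i).mono_measure (Measure.restrict_mono Set.sdiff_subset le_rfl)

end EnergySup

/-! ### Translations -/

theorem grad_comp_add (φ : Space d → ℝ) (v x : Space d) :
    grad (fun y => φ (y + v)) x = grad φ (x + v) := by
  ext j
  simp only [grad]
  rw [fderiv_comp_add_right]

theorem setIntegral_comp_add (f : Space d → ℝ) (U : Set (Space d)) (v : Space d) :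
    ∫ x in (fun x => x + v) ⁻¹' U, f (x + v) = ∫ x in U, f x :=
  (measurePreserving_add_right (volume : Measure (Space d)) v).setIntegral_preimage_emb
    (measurableEmbedding_addRight v) f U

theorem integrableOn_comp_add {f : Space d → ℝ} {U : Set (Space d)} (v : Space d)
    (hf : IntegrableOn f U) : IntegrableOn (fun x => f (x + v)) ((fun x => x + v) ⁻¹' U) :=
  ((measurePreserving_add_right (volume : Measure (Space d)) v).integrableOn_comp_preimage
    (measurableEmbedding_addRight v)).2 hf

theorem IsTestFunction.comp_add {U : Set (Space d)} {φ : Space d → ℝ} (h : IsTestFunction U φ)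
    (v : Space d) : IsTestFunction ((fun x => x + v) ⁻¹' U) (fun x => φ (x + v)) := by
  refine ⟨h.1.comp (by fun_prop), h.2.1.comp_homeomorph (Homeomorph.addRight v), ?_⟩
  have := tsupport_comp_eq_preimage φ (Homeomorph.addRight v)
  change tsupport (φ ∘ (Homeomorph.addRight v)) ⊆ _
  rw [this]
  exact Set.preimage_mono h.2.2

theorem IsSolution.comp_add {a : Space d → Mat d} {U : Set (Space d)} {u : Space d → ℝ}
    {G : Space d → Fin d → ℝ} (ha : IsAdmissible a) (hU : Bornology.IsBounded U)
    (h : IsSolution a U u G) (v : Space d) :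
    IsSolution (fun x => a (x + v)) ((fun x => x + v) ⁻¹' U) (fun x => u (x + v))
      (fun x => G (x + v)) := by
  have hinv : ∀ φ : Space d → ℝ, IsTestFunction ((fun x => x + v) ⁻¹' U) φ →
      IsTestFunction U (fun x => φ (x + -v)) ∧
      ∀ x, φ x = φ (x + v + -v) ∧ grad φ x = grad (fun x => φ (x + -v)) (x + v) := by
    intro φ hφ
    refine ⟨?_, fun x => ⟨by simp, ?_⟩⟩
    · have := hφ.comp_add (-v)
      simpa [Set.preimage_preimage] using this
    · rw [grad_comp_add]; simp
  refine ⟨integrableOn_comp_add v h.integrable,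
    ⟨(integrableOn_comp_add v h.integrable).locallyIntegrableOn, fun i =>
      (integrableOn_comp_add v (ha.integrableOn_grad hU h.aemeasurable h.energy i)
        ).locallyIntegrableOn, fun φ hφ i => ?_⟩, integrableOn_comp_add v h.energy,
    fun φ hφ => ?_, ?_⟩
  · obtain ⟨h1, h2⟩ := hinv φ hφ
    have key := h.weakGrad.2.2 _ h1 i
    rw [← setIntegral_comp_add _ U v, ← setIntegral_comp_add (fun x => G x i * _) U v] at key
    convert key using 4 with x x
    · rw [(h2 x).2]
    · simp
  · obtain ⟨h1, h2⟩ := hinv φ hφ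
    have key := h.equation _ h1
    rw [← setIntegral_comp_add _ U v] at key
    convert key using 4 with x
    rw [(h2 x).2]
  · have key := h.mean_zero
    have hvol : volume.real ((fun x => x + v) ⁻¹' U) = volume.real U := by
      simp [Measure.real, measure_preimage_add_right]
    rw [setAverage_eq, hvol, setIntegral_comp_add, ← setAverage_eq, key]

theorem J_comp_add {a : Space d → Mat d} (ha : IsAdmissible a) {U : Set (Space d)}
    (hU : Bornology.IsBounded U) (v : Space d) (p q : Fin d → ℝ) :
    J (fun x => a (x + v)) ((fun x => x + v) ⁻¹' U) p q = J a U p q := by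
  have hb : Bornology.IsBounded ((fun x => x + v) ⁻¹' U) := by
    have : (fun x => x + v) ⁻¹' U = (fun x => x + -v) '' U := by
      ext x
      exact ⟨fun hx => ⟨x + v, hx, by simp⟩, by rintro ⟨y, hy, rfl⟩; simpa using hy⟩
    rw [this]
    exact (IsometryEquiv.addRight (-v)).isometry.lipschitz.isBounded_image hU
  have key : ∀ (a : Space d → Mat d) (U : Set (Space d)) (v : Space d), IsAdmissible a →
      Bornology.IsBounded U → ∀ r, (∃ u G, IsSolution a U u G ∧
        r = ⨍ x in U, integrand a p q G x) → ∃ u G, IsSolution (fun x => a (x + v))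
          ((fun x => x + v) ⁻¹' U) u G ∧
        r = ⨍ x in (fun x => x + v) ⁻¹' U, integrand (fun x => a (x + v)) p q G x := by
    rintro a U v ha hU r ⟨u, G, hs, rfl⟩
    refine ⟨_, _, hs.comp_add ha hU v, ?_⟩
    have hvol : volume.real ((fun x => x + v) ⁻¹' U) = volume.real U := by
      simp [Measure.real, measure_preimage_add_right]
    rw [setAverage_eq, setAverage_eq, hvol, ← setIntegral_comp_add _ U v]
    rfl
  unfold J
  congr 1
  ext r
  refine ⟨fun hr => ?_, fun hr => key a U v ha hU r hr⟩
  -- The reverse inclusion is the same statement for the shift by -v.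
  have := key _ _ (-v) (ha.shift v) hb r hr
  simpa [Set.preimage_preimage, integrand] using this

theorem energySup_comp_add {a : Space d → Mat d} (ha : IsAdmissible a) {U : Set (Space d)}
    (hU : Bornology.IsBounded U) (v : Space d) (p q : Fin d → ℝ) :
    energySup (fun x => a (x + v)) p q ((fun x => x + v) ⁻¹' U) = energySup a p q U := by
  have hvol : volume.real ((fun x => x + v) ⁻¹' U) = volume.real U := by
    simp [Measure.real, measure_preimage_add_right]
  rw [energySup, energySup, J_comp_add ha hU, hvol]

/-! ### Averages along segments -/

/-- The point of the segment from `y` to `x` with parameter `t`, for `z = (x, y, t)`. -/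
def segPoint (z : Space d × (Space d × ℝ)) : Space d := z.2.1 + z.2.2 • (z.1 - z.2.1)

theorem continuous_segPoint : Continuous (segPoint : Space d × (Space d × ℝ) → Space d) := by
  unfold segPoint; fun_prop

theorem lintegral_affine_le {f : Space d → ENNReal} (hf : Measurable f) (c : Space d) {r : ℝ}
    (hr : 1 / 2 ≤ r) : ∫⁻ x, f (c + r • x) ≤ 2 ^ d * ∫⁻ x, f x := by
  have hr0 : r ≠ 0 := by linarith
  have h1 : ∫⁻ x, f (c + r • x) = ∫⁻ z, f (c + z) ∂(Measure.map (r • ·) volume) := by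
    rw [lintegral_map (by fun_prop) (by fun_prop)]
  rw [h1, Measure.map_addHaar_smul _ hr0, lintegral_smul_measure, lintegral_add_left_eq_self,
    smul_eq_mul, finrank_euclideanSpace_fin]
  gcongr
  have h2 : |(r ^ d)⁻¹| ≤ 2 ^ d := by
    rw [abs_of_nonneg (by positivity), ← inv_pow]
    refine pow_le_pow_left₀ (by positivity) ?_ d
    rw [inv_le_comm₀ (by linarith) (by norm_num)]
    linarith
  calc ENNReal.ofReal |(r ^ d)⁻¹| ≤ ENNReal.ofReal (2 ^ d) := ENNReal.ofReal_le_ofReal h2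
    _ = 2 ^ d := by rw [ENNReal.ofReal_pow (by norm_num)]; simp

/-- The measure on triples `(x, y, t)` with `x ∈ Q`, `y ∈ B`, `t ∈ (0, 1]`. -/
def tripleMeasure (Q B : Set (Space d)) : Measure (Space d × (Space d × ℝ)) :=
  (volume.restrict Q).prod ((volume.restrict B).prod (volume.restrict (Set.Ioc 0 1)))

/-- For t ≥ 1/2 the segment point is, as a function of x, an affine dilation by t; for t < 1/2 it
is, as a function of y, a dilation by 1 - t > 1/2. Either way the Jacobian costs at most 2^d, so the
law of a random segment point has bounded density. Line integrals of an L¹ field thus make sense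
after averaging over the segments. -/
theorem map_segPoint_le {Q B : Set (Space d)} (hQ : Convex ℝ Q) (hQm : MeasurableSet Q)
    (hBm : MeasurableSet B) (hBQ : B ⊆ Q) (hQf : volume Q ≠ ⊤) :
    ∃ C : ENNReal, C ≠ ⊤ ∧ Measure.map segPoint (tripleMeasure Q B) ≤ C • volume.restrict Q := by
  have hBf : volume B ≠ ⊤ := measure_ne_top_of_subset hBQ hQf
  have : IsFiniteMeasure (volume.restrict Q) := ⟨by simpa using hQf.lt_top⟩
  have : IsFiniteMeasure (volume.restrict B) := ⟨by simpa using hBf.lt_top⟩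
  refine ⟨2 ^ d * volume B + 2 ^ d * volume Q, by finiteness, ?_⟩
  refine Measure.le_iff.2 fun S hS => ?_
  set f : Space d → ENNReal := (S ∩ Q).indicator 1 with hf
  have hfm : Measurable f := measurable_one.indicator (hS.inter hQm)
  have hI : ∫⁻ x, f x = volume.restrict Q S := by
    rw [hf, lintegral_indicator_one (hS.inter hQm), Measure.restrict_apply hS]
  have hm : Measurable (segPoint : Space d × (Space d × ℝ) → Space d) :=
    continuous_segPoint.measurable
  have hae : ∀ᵐ z ∂(tripleMeasure Q B), z.1 ∈ Q ∧ z.2.1 ∈ B ∧ z.2.2 ∈ Set.Ioc (0 : ℝ) 1 := by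
    rw [tripleMeasure, Measure.prod_restrict, Measure.prod_restrict]
    filter_upwards [ae_restrict_mem (hQm.prod (hBm.prod measurableSet_Ioc))] with z hz
    exact ⟨hz.1, hz.2.1, hz.2.2⟩
  set g1 : Space d × (Space d × ℝ) → ENNReal :=
    fun z => {t : ℝ | 1 / 2 ≤ t}.indicator (fun _ => f (segPoint z)) z.2.2
  set g2 : Space d × (Space d × ℝ) → ENNReal :=
    fun z => {t : ℝ | t < 1 / 2}.indicator (fun _ => f (segPoint z)) z.2.2
  have hg1 : Measurable g1 := by
    have : g1 = {z : Space d × (Space d × ℝ) | 1 / 2 ≤ z.2.2}.indicator (fun z => f (segPoint z)) := rfl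
    rw [this]
    exact (hfm.comp hm).indicator (measurableSet_le measurable_const (by fun_prop))
  have hg2 : Measurable g2 := by
    have : g2 = {z : Space d × (Space d × ℝ) | z.2.2 < 1 / 2}.indicator (fun z => f (segPoint z)) := rfl
    rw [this]
    exact (hfm.comp hm).indicator (measurableSet_lt (by fun_prop) measurable_const)
  have h1 : ∫⁻ z, g1 z ∂(tripleMeasure Q B) ≤ 2 ^ d * volume B * volume.restrict Q S := by
    rw [tripleMeasure, lintegral_prod_symm _ hg1.aemeasurable]
    calc _ ≤ ∫⁻ yt, 2 ^ d * volume.restrict Q S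
          ∂((volume.restrict B).prod (volume.restrict (Set.Ioc (0 : ℝ) 1))) := by
          refine lintegral_mono fun yt => ?_
          by_cases ht : 1 / 2 ≤ yt.2
          · calc ∫⁻ x in Q, g1 (x, yt) ≤ ∫⁻ x, f (segPoint (x, yt)) := by
                  refine (lintegral_mono fun x => ?_).trans (setLIntegral_le_lintegral Q _)
                  exact Set.indicator_le_self' (by simp) _
              _ = ∫⁻ x, f ((yt.1 - yt.2 • yt.1) + yt.2 • x) := by
                  refine lintegral_congr fun x => ?_
                  rw [segPoint, smul_sub]; congr 1; simp only; abel
              _ ≤ _ := by rw [← hI]; exact lintegral_affine_le hfm _ ht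
          · have : ∀ x, g1 (x, yt) = 0 := fun x => Set.indicator_of_notMem (by simpa using ht) _
            simp [this]
      _ = _ := by
          rw [lintegral_const, ← Set.univ_prod_univ, Measure.prod_prod]
          simp
          ring
  have h2 : ∫⁻ z, g2 z ∂(tripleMeasure Q B) ≤ 2 ^ d * volume Q * volume.restrict Q S := by
    rw [tripleMeasure, lintegral_prod _ hg2.aemeasurable]
    calc _ ≤ ∫⁻ x in Q, 2 ^ d * volume.restrict Q S := by
          refine lintegral_mono fun x => ?_
          have hgx : Measurable fun yt => g2 (x, yt) := hg2.comp measurable_prodMk_left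
          change ∫⁻ yt, g2 (x, yt) ∂_ ≤ _
          rw [lintegral_prod_symm _ hgx.aemeasurable]
          calc _ ≤ ∫⁻ t in Set.Ioc (0 : ℝ) 1, 2 ^ d * volume.restrict Q S := by
                refine lintegral_mono fun t => ?_
                by_cases ht : t < 1 / 2
                · calc ∫⁻ y in B, g2 (x, (y, t)) ≤ ∫⁻ y, f (segPoint (x, (y, t))) := by
                        refine (lintegral_mono fun x => ?_).trans (setLIntegral_le_lintegral B _)
                        exact Set.indicator_le_self' (by simp) _
                    _ = ∫⁻ y, f (t • x + (1 - t) • y) := by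
                        refine lintegral_congr fun y => ?_
                        rw [segPoint, smul_sub, sub_smul, one_smul]; congr 1; simp only; abel
                    _ ≤ _ := by rw [← hI]; exact lintegral_affine_le hfm _ (by linarith)
                · have : ∀ y, g2 (x, (y, t)) = 0 := fun y =>
                    Set.indicator_of_notMem (by simpa using ht) _
                  simp [this]
            _ = _ := by rw [lintegral_const]; simp
      _ = _ := by
          rw [lintegral_const]
          simp
          ring
  rw [Measure.map_apply hm hS]
  calc tripleMeasure Q B (segPoint ⁻¹' S)
      = ∫⁻ z, (segPoint ⁻¹' S).indicator 1 z ∂(tripleMeasure Q B) :=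
        (lintegral_indicator_one (hm hS)).symm
    _ ≤ ∫⁻ z, g1 z + g2 z ∂(tripleMeasure Q B) := by
        refine lintegral_mono_ae ?_
        filter_upwards [hae] with z ⟨hz1, hz2, hz3⟩
        by_cases hzS : segPoint z ∈ S
        · have hzQ : segPoint z ∈ Q := by
            exact hQ.add_smul_sub_mem (hBQ hz2) hz1
              (show z.2.2 ∈ Set.Icc (0 : ℝ) 1 from ⟨hz3.1.le, hz3.2⟩)
          have hf1 : f (segPoint z) = 1 := by
            rw [hf, Set.indicator_of_mem (show segPoint z ∈ S ∩ Q from ⟨hzS, hzQ⟩)]; rfl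
          rw [Set.indicator_of_mem (by exact hzS), Pi.one_apply]
          by_cases ht : 1 / 2 ≤ z.2.2
          · simp only [g1, Set.indicator_of_mem (show z.2.2 ∈ {t : ℝ | 1 / 2 ≤ t} from ht), hf1]
            exact le_self_add
          · simp only [g2, Set.indicator_of_mem (show z.2.2 ∈ {t : ℝ | t < 1 / 2} from not_le.1 ht),
              hf1]
            exact le_add_self
        · rw [Set.indicator_of_notMem (by exact hzS)]
          exact bot_le
    _ ≤ _ := by
        rw [lintegral_add_left hg1]
        refine (add_le_add h1 h2).trans_eq ?_
        rw [Measure.smul_apply, smul_eq_mul]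
        ring

/-! ### Mollification in `L¹` -/

/-- `L¹` convergence from almost everywhere convergence and a bound on the norms. -/
theorem tendsto_integral_norm_sub {α : Type*} [MeasurableSpace α] {μ : Measure α}
    {f : ℕ → α → ℝ} {g : α → ℝ} (hf : ∀ n, Integrable (f n) μ) (hg : Integrable g μ)
    (hlim : ∀ᵐ x ∂μ, Tendsto (fun n => f n x) atTop (𝓝 (g x)))
    (hle : ∀ n, ∫ x, ‖f n x‖ ∂μ ≤ ∫ x, ‖g x‖ ∂μ) :
    Tendsto (fun n => ∫ x, ‖f n x - g x‖ ∂μ) atTop (𝓝 0) := by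
  -- Scheffé's argument: |g| + |f_n| - |f_n - g| is nonnegative and at most 2|g|, so dominated
  -- convergence applies to it without any common majorant of the f_n.
  have h1 : Tendsto (fun n => ∫ x, (‖g x‖ + ‖f n x‖ - ‖f n x - g x‖) ∂μ) atTop
      (𝓝 (∫ x, (‖g x‖ + ‖g x‖ - ‖g x - g x‖) ∂μ)) := by
    refine tendsto_integral_of_dominated_convergence (fun x => 2 * ‖g x‖)
      (fun n => ((hg.norm.add (hf n).norm).sub ((hf n).sub hg).norm).aestronglyMeasurable)
      (hg.norm.const_mul 2) (fun n => Eventually.of_forall fun x => ?_) ?_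
    · have a1 := norm_sub_norm_le (f n x) (g x)
      have a2 := norm_sub_le (f n x) (g x)
      rw [Real.norm_of_nonneg (by linarith)]
      linarith
    · filter_upwards [hlim] with x hx
      exact (tendsto_const_nhds.add hx.norm).sub (hx.sub tendsto_const_nhds).norm
  simp only [sub_self, norm_zero, sub_zero] at h1
  rw [integral_add hg.norm hg.norm] at h1
  have h2 : Tendsto (fun n => (∫ x, ‖g x‖ ∂μ + ∫ x, ‖g x‖ ∂μ)
      - ∫ x, (‖g x‖ + ‖f n x‖ - ‖f n x - g x‖) ∂μ) atTop (𝓝 0) := by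
    have := (tendsto_const_nhds (x := ∫ x, ‖g x‖ ∂μ + ∫ x, ‖g x‖ ∂μ)).sub h1
    rwa [sub_self] at this
  refine squeeze_zero (fun n => integral_nonneg fun x => norm_nonneg _) (fun n => ?_) h2
  have e := integral_sub (f := fun x => ‖g x‖ + ‖f n x‖) (g := fun x => ‖f n x - g x‖)
    (hg.norm.add (hf n).norm) ((hf n).sub hg).norm
  rw [e, integral_add hg.norm (hf n).norm]
  linarith [hle n]

/-- A sequence of smooth bumps shrinking to the origin. -/
def bumpSeq (d : ℕ) (n : ℕ) : ContDiffBump (0 : Space d) where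
  rIn := 1 / (2 * ((n : ℝ) + 1))
  rOut := 1 / ((n : ℝ) + 1)
  rIn_pos := by positivity
  rIn_lt_rOut := by
    have : (0 : ℝ) < (n : ℝ) + 1 := by positivity
    exact one_div_lt_one_div_of_lt this (by linarith)

/-- Mollification at scale `1 / (n + 1)`. -/
def mollify (n : ℕ) (f : Space d → ℝ) : Space d → ℝ :=
  convolution ((bumpSeq d n).normed volume) f (ContinuousLinearMap.lsmul ℝ ℝ) volume

theorem mollify_apply (n : ℕ) (f : Space d → ℝ) (x : Space d) :
    mollify n f x = ∫ y, (bumpSeq d n).normed volume (x - y) * f y := by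
  rw [mollify, convolution_eq_swap]
  rfl

theorem tendsto_mollify {f : Space d → ℝ} (hf : LocallyIntegrable f) :
    ∀ᵐ x, Tendsto (fun n => mollify n f x) atTop (𝓝 (f x)) := by
  refine ContDiffBump.ae_convolution_tendsto_right_of_locallyIntegrable (φ := bumpSeq d) (K := 2)
    tendsto_one_div_add_atTop_nhds_zero_nat (Eventually.of_forall fun n => ?_) hf
  simp only [bumpSeq]
  have : (0 : ℝ) < (n : ℝ) + 1 := by positivity
  apply le_of_eq
  field_simp

theorem integrable_mollify (n : ℕ) {f : Space d → ℝ} (hf : Integrable f) :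
    Integrable (mollify n f) :=
  (ContDiffBump.integrable_normed _).integrable_convolution _ hf

theorem integral_norm_mollify_le (n : ℕ) {f : Space d → ℝ} (hf : Integrable f) :
    ∫ x, ‖mollify n f x‖ ≤ ∫ x, ‖f x‖ := by
  have h1 : ∫ x, mollify n (fun x => ‖f x‖) x = ∫ x, ‖f x‖ := by
    unfold mollify
    rw [integral_convolution _ (ContDiffBump.integrable_normed _) hf.norm,
      ContDiffBump.integral_normed]
    simp
  rw [← h1]
  refine integral_mono (integrable_mollify n hf).norm (integrable_mollify n hf.norm) fun x => ?_
  simp only [mollify_apply]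
  refine (norm_integral_le_integral_norm _).trans_eq (integral_congr_ae ?_)
  refine Eventually.of_forall fun y => ?_
  simp only [norm_mul, Real.norm_of_nonneg (ContDiffBump.nonneg_normed _ _)]

theorem tendsto_integral_norm_mollify_sub {f : Space d → ℝ} (hf : Integrable f) :
    Tendsto (fun n => ∫ x, ‖mollify n f x - f x‖) atTop (𝓝 0) :=
  tendsto_integral_norm_sub (fun n => integrable_mollify n hf) hf
    (tendsto_mollify hf.locallyIntegrable) fun n => integral_norm_mollify_le n hf

theorem contDiff_mollify (n : ℕ) {f : Space d → ℝ} (hf : LocallyIntegrable f) :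
    ContDiff ℝ ∞ (mollify n f) :=
  (ContDiffBump.hasCompactSupport_normed _).contDiff_convolution_left _
    (ContDiffBump.contDiff_normed _) hf

theorem fderiv_mollify (n : ℕ) {f : Space d → ℝ} (hf : LocallyIntegrable f) (x v : Space d) :
    fderiv ℝ (mollify n f) x v
      = ∫ y, fderiv ℝ ((bumpSeq d n).normed volume) (x - y) v * f y := by
  have h := (ContDiffBump.hasCompactSupport_normed (μ := volume) (bumpSeq d n)
    ).hasFDerivAt_convolution_left (ContinuousLinearMap.lsmul ℝ ℝ)
    (ContDiffBump.contDiff_normed (n := 1) (bumpSeq d n)) hf x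
  have h' : fderiv ℝ (mollify n f) x = _ := h.fderiv
  rw [h', convolution_eq_swap, ContinuousLinearMap.integral_apply]
  · rfl
  · have hc : HasCompactSupport (fderiv ℝ ((bumpSeq d n).normed volume)) :=
      (ContDiffBump.hasCompactSupport_normed _).fderiv ℝ
    have := (hc.convolutionExists_left ((ContinuousLinearMap.lsmul ℝ ℝ).precompL (Space d))
      ((ContDiffBump.contDiff_normed (n := 1) (bumpSeq d n)).continuous_fderiv (by norm_num)) hf) x
    exact this.integrable_swap

/-! ### Curl-free fields on a cube are gradients -/

/-- The open cube of half-side `r`. -/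
def box (d : ℕ) (r : ℝ) : Set (Space d) := {x | ∀ i, |x i| < r}

theorem isOpen_box (r : ℝ) : IsOpen (box d r) := by
  simp only [box, Set.ofPred_forall]
  exact isOpen_iInter_of_finite fun i => isOpen_lt (by fun_prop) continuous_const

theorem convex_box (r : ℝ) : Convex ℝ (box d r) := by
  intro x hx y hy s t hs ht hst i
  have h1 := hx i
  have h2 := hy i
  rw [abs_lt] at h1 h2 ⊢
  exact (convex_Ioo (-r) r) h1 h2 hs ht hst

theorem abs_apply_le_norm (x : Space d) (i : Fin d) : |x i| ≤ ‖x‖ := by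
  simpa using PiLp.norm_apply_le x i

theorem norm_le_of_forall_abs_le {x : Space d} {r : ℝ} (h : ∀ i, |x i| ≤ r) :
    ‖x‖ ≤ r * d := by
  have h1 : ‖x‖ ≤ ∑ i, |x i| := by
    conv_lhs => rw [← (EuclideanSpace.basisFun (Fin d) ℝ).sum_repr x]
    refine (norm_sum_le _ _).trans (Finset.sum_le_sum fun i _ => ?_)
    simp [norm_smul]
  refine h1.trans ((Finset.sum_le_sum fun i _ => h i).trans_eq ?_)
  simp [mul_comm]

theorem isBounded_box (r : ℝ) : Bornology.IsBounded (box d r) := by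
  refine (Metric.isBounded_closedBall (x := (0 : Space d)) (r := |r| * d)).subset fun x hx => ?_
  rw [mem_closedBall_zero_iff]
  exact norm_le_of_forall_abs_le (fun i => (hx i).le.trans (le_abs_self r))

theorem box_mono {r s : ℝ} (h : r ≤ s) : box d r ⊆ box d s := fun _ hx i => (hx i).trans_le h

/-- The margin below L leaves room for mollification inside the cube; the bound r > L/2 keeps the
half-size cube of base points inside the box of half-side r. -/
theorem exists_subset_box {K : Set (Space d)} (hK : IsCompact K) {L : ℝ} (hL : 0 < L)
    (h : K ⊆ box d L) : ∃ r, L / 2 < r ∧ r < L ∧ K ⊆ box d r := by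
  have h1 : K ⊆ ⋃ n : ℕ, box d (L - L / (n + 3)) := fun x hx => by
    have h2 : ∀ i : Fin d, ∀ᶠ n : ℕ in atTop, |x i| < L - L / (n + 3) := fun i => by
      have h3 : Tendsto (fun n : ℕ => L - L / ((n : ℝ) + 3)) atTop (𝓝 (L - 0)) :=
        tendsto_const_nhds.sub (tendsto_const_nhds.div_atTop
          (tendsto_atTop_add_const_right _ _ tendsto_natCast_atTop_atTop))
      exact h3.eventually_const_lt (by simpa using h hx i)
    obtain ⟨n, hn⟩ := (eventually_all.2 h2).exists
    exact Set.mem_iUnion.2 ⟨n, hn⟩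
  have hmono : Monotone fun n : ℕ => box d (L - L / ((n : ℝ) + 3)) := fun m n hmn =>
    box_mono (by gcongr)
  obtain ⟨n, hn⟩ := hK.elim_directed_cover _ (fun n => isOpen_box _) h1 hmono.directed_le
  refine ⟨_, ?_, ?_, hn⟩
  · have : L / ((n : ℝ) + 3) ≤ L / 3 := by gcongr; linarith [n.cast_nonneg (α := ℝ)]
    linarith
  · have : 0 < L / ((n : ℝ) + 3) := by positivity
    linarith

theorem clm_apply_eq_sum (ℓ : Space d →L[ℝ] ℝ) (v : Space d) :
    ℓ v = ∑ i, v i * ℓ (EuclideanSpace.single i 1) := by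
  conv_lhs => rw [← (EuclideanSpace.basisFun (Fin d) ℝ).sum_repr v]
  simp [map_sum]

/-! ### Convergence along segments and mollified curl-free fields -/

section CurlFree

variable {L : ℝ} {G : Space d → Fin d → ℝ}

theorem integrable_comp_segPoint {Q B : Set (Space d)} (hQ : Convex ℝ Q) (hQm : MeasurableSet Q)
    (hBm : MeasurableSet B) (hBQ : B ⊆ Q) (hQf : volume Q ≠ ⊤) {g : Space d → ℝ}
    (hg : IntegrableOn g Q) : Integrable (fun z => g (segPoint z)) (tripleMeasure Q B) := by
  obtain ⟨C, hC, hle⟩ := map_segPoint_le hQ hQm hBm hBQ hQf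
  exact ((hg.smul_measure hC).mono_measure hle).comp_measurable continuous_segPoint.measurable

/-- The bounded density from `map_segPoint_le` turns L¹ convergence of the fields into convergence
of their averages over segments. -/
theorem tendsto_integral_comp_segPoint {Q B : Set (Space d)} (hQ : Convex ℝ Q)
    (hQm : MeasurableSet Q) (hBm : MeasurableSet B) (hBQ : B ⊆ Q) (hQf : volume Q ≠ ⊤)
    {g : Space d → ℝ} {f : ℕ → Space d → ℝ} (hg : Integrable g) (hf : ∀ n, Integrable (f n))
    (hlim : Tendsto (fun n => ∫ x, ‖f n x - g x‖) atTop (𝓝 0))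
    {w : Space d × (Space d × ℝ) → ℝ} {M : ℝ} (hw : ∀ᵐ z ∂(tripleMeasure Q B), ‖w z‖ ≤ M)
    (hM : 0 ≤ M)
    (hwm : AEStronglyMeasurable w (tripleMeasure Q B)) :
    Tendsto (fun n => ∫ z, f n (segPoint z) * w z ∂(tripleMeasure Q B)) atTop
      (𝓝 (∫ z, g (segPoint z) * w z ∂(tripleMeasure Q B))) := by
  have hi : ∀ {h : Space d → ℝ}, Integrable h →
      Integrable (fun z => h (segPoint z)) (tripleMeasure Q B) := fun hh =>
    integrable_comp_segPoint hQ hQm hBm hBQ hQf hh.integrableOn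
  have hi' : ∀ {h : Space d → ℝ}, Integrable h →
      Integrable (fun z => h (segPoint z) * w z) (tripleMeasure Q B) := fun hh =>
    (hi hh).mul_bdd hwm hw
  obtain ⟨C, hC, hle⟩ := map_segPoint_le hQ hQm hBm hBQ hQf
  rw [tendsto_iff_norm_sub_tendsto_zero]
  refine squeeze_zero (fun n => norm_nonneg _) (fun n => ?_)
    (by simpa using hlim.const_mul (M * C.toReal))
  rw [← integral_sub (hi' (hf n)) (hi' hg)]
  have hint : Integrable (fun x => ‖f n x - g x‖) := ((hf n).sub hg).norm
  calc ‖∫ z, (f n (segPoint z) * w z - g (segPoint z) * w z) ∂(tripleMeasure Q B)‖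
      ≤ ∫ z, M * ‖f n (segPoint z) - g (segPoint z)‖ ∂(tripleMeasure Q B) := by
        refine norm_integral_le_of_norm_le ((hi hint).const_mul M) ?_
        filter_upwards [hw] with z hz
        rw [← sub_mul, norm_mul, mul_comm]
        gcongr
    _ = M * ∫ x, ‖f n x - g x‖ ∂(Measure.map segPoint (tripleMeasure Q B)) := by
        rw [integral_const_mul, integral_map continuous_segPoint.measurable.aemeasurable]
        exact ((hint.integrableOn (s := Q)).smul_measure hC |>.mono_measure hle).aestronglyMeasurable
    _ ≤ M * ∫ x, ‖f n x - g x‖ ∂(C • volume.restrict Q) := by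
        refine mul_le_mul_of_nonneg_left ?_ hM
        refine integral_mono_measure hle (Eventually.of_forall fun x => norm_nonneg _) ?_
        exact (hint.integrableOn (s := Q)).smul_measure hC
    _ ≤ M * C.toReal * ∫ x, ‖f n x - g x‖ := by
        rw [integral_smul_measure, smul_eq_mul, mul_assoc]
        refine mul_le_mul_of_nonneg_left (mul_le_mul_of_nonneg_left ?_ ENNReal.toReal_nonneg) hM
        exact setIntegral_le_integral hint (Eventually.of_forall fun x => norm_nonneg _)

/-- A derivative of the mollification falls on the kernel, and y ↦ ρ(x - y) is an admissible test
function in the curl-free condition as long as the mollification radius keeps its support inside the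
cube. -/
theorem fderiv_mollify_symm
    (hG : ∀ i, IntegrableOn (fun x => G x i) (box d L))
    (hcurl : ∀ ψ : Space d → ℝ, IsTestFunction (box d L) ψ → ∀ i j,
      ∫ x in box d L, G x i * grad ψ x j = ∫ x in box d L, G x j * grad ψ x i)
    {r : ℝ} {n : ℕ} (hn : r + 1 / ((n : ℝ) + 1) < L) {x : Space d} (hx : x ∈ box d r) (i j : Fin d) :
    fderiv ℝ (mollify n ((box d L).indicator fun x => G x i)) x (EuclideanSpace.single j 1)
      = fderiv ℝ (mollify n ((box d L).indicator fun x => G x j)) x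
        (EuclideanSpace.single i 1) := by
  have hm : MeasurableSet (box d L) := (isOpen_box L).measurableSet
  set ρ := (bumpSeq d n).normed (volume : Measure (Space d)) with hρ
  have hψ : IsTestFunction (box d L) (fun y => ρ (x - y)) := by
    refine ⟨(ContDiffBump.contDiff_normed _).comp (contDiff_const.sub contDiff_id),
      (ContDiffBump.hasCompactSupport_normed _).comp_homeomorph (Homeomorph.subLeft x), ?_⟩
    have h1 : tsupport (fun y => ρ (x - y)) = (fun y => x - y) ⁻¹' tsupport ρ :=
      tsupport_comp_eq_preimage ρ (Homeomorph.subLeft x)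
    rw [h1, hρ, ContDiffBump.tsupport_normed_eq]
    intro y hy k
    have h2 : ‖x - y‖ ≤ 1 / ((n : ℝ) + 1) := by
      have : x - y ∈ Metric.closedBall (0 : Space d) (1 / ((n : ℝ) + 1)) := hy
      simpa using this
    have h3 := (abs_apply_le_norm (x - y) k).trans h2
    have h4 := hx k
    rw [PiLp.sub_apply] at h3
    have h5 : |y k| ≤ |x k| + |x k - y k| := by
      have := abs_sub_abs_le_abs_sub (y k) (x k)
      rw [abs_sub_comm (y k)] at this
      linarith
    linarith
  have hgrad : ∀ y k, grad (fun y => ρ (x - y)) y k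
      = -fderiv ℝ ρ (x - y) (EuclideanSpace.single k 1) := fun y k => by
    simp only [grad]
    have hρd : DifferentiableAt ℝ ρ (x - y) :=
      (ContDiffBump.contDiff_normed (n := 1) (bumpSeq d n)).differentiable (by norm_num) _
    have h2 : HasFDerivAt (fun y : Space d => x - y) (-ContinuousLinearMap.id ℝ (Space d)) y :=
      (hasFDerivAt_id y).const_sub x
    have h1 := HasFDerivAt.comp (g := ρ) y hρd.hasFDerivAt h2
    have h3 : fderiv ℝ (fun y => ρ (x - y)) y = _ := h1.fderiv
    rw [h3]
    simp
  have key : ∀ i j, fderiv ℝ (mollify n ((box d L).indicator fun x => G x i)) x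
      (EuclideanSpace.single j 1) = -∫ y in box d L, G y i * grad (fun y => ρ (x - y)) y j := by
    intro i j
    rw [fderiv_mollify n ((hG i).integrable_indicator hm).locallyIntegrable, ← integral_neg,
      ← integral_indicator hm]
    congr 1
    ext y
    by_cases hy : y ∈ box d L
    · simp only [Set.indicator_of_mem hy, hgrad]; ring
    · simp only [Set.indicator_of_notMem hy, mul_zero]
  rw [key, key, hcurl _ hψ]

/-- A smooth curl-free field on a cube has a primitive. -/
theorem exists_primitive {m : Fin d → Space d → ℝ} (hm : ∀ i, ContDiff ℝ ∞ (m i)) {r : ℝ}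
    (hsymm : ∀ x ∈ box d r, ∀ i j, fderiv ℝ (m i) x (EuclideanSpace.single j 1)
      = fderiv ℝ (m j) x (EuclideanSpace.single i 1)) :
    ∃ f : Space d → ℝ, ∀ x ∈ box d r, ∃ θ : Space d →L[ℝ] ℝ, HasFDerivAt f θ x ∧
      ∀ v, θ v = ∑ i, m i x * v i := by
  set θ : Space d → (Space d →L[ℝ] ℝ) := fun x => ∑ i, m i x • (EuclideanSpace.proj i : _ →L[ℝ] ℝ)
    with hθ
  have hd : ∀ i, Differentiable ℝ (m i) := fun i => (hm i).differentiable (by simp)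
  have happ : ∀ x v, θ x v = ∑ i, m i x * v i := fun x v => by
    simp [hθ]
  have hf : ∀ x v w, fderiv ℝ θ x v w = ∑ i, fderiv ℝ (m i) x v * w i := fun x v w => by
    have h1 : HasFDerivAt θ (∑ i, (fderiv ℝ (m i) x).smulRight
        (EuclideanSpace.proj i : Space d →L[ℝ] ℝ)) x := by
      have := HasFDerivAt.fun_sum (u := Finset.univ) (fun i (_ : i ∈ Finset.univ) =>
        ((hd i x).hasFDerivAt).smul_const (EuclideanSpace.proj i : Space d →L[ℝ] ℝ))
      exact this
    rw [h1.fderiv]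
    simp
  have hdiff : DifferentiableOn ℝ θ (box d r) := fun x _ => (DifferentiableAt.fun_sum fun i _ =>
    (hd i x).smul_const _).differentiableWithinAt
  obtain ⟨f, hf'⟩ := (convex_box r).exists_forall_hasFDerivAt_of_fderiv_symmetric (isOpen_box r)
    hdiff (fun x hx v w => by
      rw [hf, hf]
      simp only [clm_apply_eq_sum (fderiv ℝ (m _) x) v, clm_apply_eq_sum (fderiv ℝ (m _) x) w,
        Finset.sum_mul]
      rw [Finset.sum_comm]
      refine Finset.sum_congr rfl fun i _ => Finset.sum_congr rfl fun j _ => ?_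
      rw [hsymm x hx j i]
      ring)
  exact ⟨f, fun x hx => ⟨θ x, hf' x hx, happ x⟩⟩

end CurlFree

/-! ### Weak primitives from averaged line integrals -/

section CurlFree

variable {L : ℝ}

theorem box_ne_top (r : ℝ) : volume (box d r) ≠ ⊤ := (isBounded_box r).measure_lt_top.ne

theorem segPoint_mem_box {r : ℝ} {x y : Space d} (hx : x ∈ box d r) (hy : y ∈ box d r) {t : ℝ}
    (ht : t ∈ Set.Icc (0 : ℝ) 1) : segPoint (x, (y, t)) ∈ box d r :=
  (convex_box r).add_smul_sub_mem hy hx ht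

/-- The line integral of a field along the segment parametrized by `segPoint`. -/
def segIntegrand (g : Fin d → Space d → ℝ) (z : Space d × (Space d × ℝ)) : ℝ :=
  ∑ j, g j (segPoint z) * (z.1 j - z.2.1 j)

theorem setIntegral_segIntegrand {m : Fin d → Space d → ℝ} (hm : ∀ i, Continuous (m i)) {r : ℝ}
    {f : Space d → ℝ} (hf : ∀ x ∈ box d r, ∃ θ : Space d →L[ℝ] ℝ, HasFDerivAt f θ x ∧
      ∀ v, θ v = ∑ i, m i x * v i) {x y : Space d} (hx : x ∈ box d r) (hy : y ∈ box d r) :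
    ∫ t in Set.Ioc (0 : ℝ) 1, segIntegrand m (x, (y, t)) = f x - f y := by
  rw [← intervalIntegral.integral_of_le zero_le_one]
  have h1 := intervalIntegral.integral_eq_sub_of_hasDerivAt (a := 0) (b := 1)
    (f := fun t : ℝ => f (y + t • (x - y)))
    (f' := fun t => segIntegrand m (x, (y, t))) (fun t ht => ?_) ?_
  · rw [h1]; simp
  · rw [Set.uIcc_of_le zero_le_one] at ht
    obtain ⟨θ, hθ, hv⟩ := hf _ (segPoint_mem_box hx hy ht)
    have h2 : HasDerivAt (fun t : ℝ => y + t • (x - y)) (x - y) t := by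
      simpa using ((hasDerivAt_id t).smul_const (x - y)).const_add y
    have h3 := hθ.comp_hasDerivAt t h2
    rw [hv] at h3
    exact h3
  · refine Continuous.intervalIntegrable ?_ _ _
    unfold segIntegrand
    refine continuous_finsetSum _ fun j _ => ?_
    exact ((hm j).comp (continuous_segPoint.comp (by fun_prop))).mul (by fun_prop)

theorem integrable_segIntegrand_mul {g : Fin d → Space d → ℝ} (hL : 0 < L)
    (hg : ∀ i, IntegrableOn (g i) (box d L)) {η : Space d → ℝ} (hη : Continuous η)
    {C : ℝ} (hC : ∀ x, ‖η x‖ ≤ C) :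
    Integrable (fun z => segIntegrand g z * η z.1) (tripleMeasure (box d L) (box d (L / 2))) ∧
    ∀ j, Integrable (fun z => g j (segPoint z) * ((z.1 j - z.2.1 j) * η z.1))
      (tripleMeasure (box d L) (box d (L / 2))) ∧
      ∀ᵐ z ∂(tripleMeasure (box d L) (box d (L / 2))), ‖(z.1 j - z.2.1 j) * η z.1‖
        ≤ 2 * L * C := by
  have hC0 : 0 ≤ C := (norm_nonneg _).trans (hC 0)
  have hae : ∀ᵐ z ∂(tripleMeasure (box d L) (box d (L / 2))),
      z.1 ∈ box d L ∧ z.2.1 ∈ box d (L / 2) := by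
    rw [tripleMeasure, Measure.prod_restrict, Measure.prod_restrict]
    filter_upwards [ae_restrict_mem ((isOpen_box L).measurableSet.prod
      ((isOpen_box (L / 2)).measurableSet.prod measurableSet_Ioc))] with z hz
    exact ⟨hz.1, hz.2.1⟩
  have hbd : ∀ j : Fin d, ∀ᵐ z ∂(tripleMeasure (box d L) (box d (L / 2))),
      ‖(z.1 j - z.2.1 j) * η z.1‖ ≤ 2 * L * C := by
    intro j
    filter_upwards [hae] with z hz
    rw [norm_mul]
    refine mul_le_mul ?_ (hC _) (norm_nonneg _) (by positivity)
    rw [Real.norm_eq_abs]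
    -- The first point is in the cube of half-side L and the second in that of half-side L/2, so
    -- coordinates differ by less than 3L/2.
    have h1 := abs_sub (z.1 j) (z.2.1 j)
    have h2 := hz.1 j
    have h3 := hz.2 j
    linarith
  have hint : ∀ j, Integrable (fun z => g j (segPoint z) * ((z.1 j - z.2.1 j) * η z.1))
      (tripleMeasure (box d L) (box d (L / 2))) := fun j => by
    refine (integrable_comp_segPoint (convex_box L) (isOpen_box L).measurableSet
      (isOpen_box _).measurableSet (box_mono (by linarith)) (box_ne_top L) (hg j)).mul_bdd ?_
      (hbd j)
    exact Continuous.aestronglyMeasurable (by fun_prop)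
  refine ⟨?_, fun j => ⟨hint j, hbd j⟩⟩
  refine (integrable_finsetSum Finset.univ fun j _ => hint j).congr
    (Eventually.of_forall fun z => ?_)
  simp only [segIntegrand, Finset.sum_mul, mul_assoc]

/-- For a smooth gradient field, the averaged potential has the expected weak gradient. -/
theorem integral_segIntegrand_mul_grad {m : Fin d → Space d → ℝ} (hm : ∀ i, ContDiff ℝ ∞ (m i))
    (hL : 0 < L) {r : ℝ} (hr : L / 2 < r) (hrL : r < L)
    {f : Space d → ℝ} (hf : ∀ x ∈ box d r, ∃ θ : Space d →L[ℝ] ℝ, HasFDerivAt f θ x ∧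
      ∀ v, θ v = ∑ i, m i x * v i)
    {φ : Space d → ℝ} (hφ : IsTestFunction (box d r) φ) (i : Fin d) :
    ∫ z, segIntegrand m z * grad φ z.1 i ∂(tripleMeasure (box d L) (box d (L / 2)))
      = -(volume.real (box d (L / 2)) * ∫ x in box d L, m i x * φ x) := by
  have hmc : ∀ i, Continuous (m i) := fun i => (hm i).continuous
  have hmi : ∀ i, IntegrableOn (m i) (box d L) := fun i =>
    ((hmc i).continuousOn.integrableOn_compact (isBounded_box L).isCompact_closure).mono_set
      subset_closure
  set η : Space d → ℝ := fun x => grad φ x i with hη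
  have hηt : IsTestFunction (box d r) η := hφ.grad i
  obtain ⟨C, hC⟩ := hηt.exists_bound
  have hint := (integrable_segIntegrand_mul hL hmi hηt.continuous hC).1
  -- For a fixed base point y, integrating in t first gives f(x) - f(y) by the fundamental theorem
  -- of calculus; integration by parts in x then moves the derivative off φ. The potential f is
  -- known only on the smaller box, which contains the support of φ.
  have hfix : ∀ y ∈ box d (L / 2), ∫ t in Set.Ioc (0 : ℝ) 1, ∫ x in box d L,
      segIntegrand m (x, (y, t)) * η x = -∫ x in box d L, m i x * φ x := by
    intro y hy
    have hy' : y ∈ box d r := box_mono hr.le hy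
    have hsub : box d r ⊆ box d L := box_mono hrL.le
    rw [integral_integral_swap]
    · have h1 : ∀ x, ∫ t in Set.Ioc (0 : ℝ) 1, segIntegrand m (x, (y, t)) * η x
          = (f x - f y) * η x := fun x => by
        by_cases hx : x ∈ box d r
        · rw [integral_mul_const, setIntegral_segIntegrand hmc hf hx hy']
        · simp [hηt.eq_zero_of_notMem hx]
      simp only [h1]
      have hfd : ∀ x ∈ tsupport φ, HasFDerivAt (fun x => f x - f y) (fderiv ℝ (fun x => f x - f y) x) x ∧
          fderiv ℝ (fun x => f x - f y) x (EuclideanSpace.single i 1) = m i x := fun x hx => by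
        obtain ⟨θ, hθ, hv⟩ := hf x (hφ.2.2 hx)
        have h2 := hθ.sub_const (f y)
        refine ⟨h2.differentiableAt.hasFDerivAt, ?_⟩
        rw [h2.fderiv, hv]
        simp
      have e1 : ∀ x, fderiv ℝ (fun x => f x - f y) x (EuclideanSpace.single i 1) * φ x
          = m i x * φ x := fun x => by
        by_cases hx : x ∈ tsupport φ
        · rw [(hfd x hx).2]
        · rw [image_eq_zero_of_notMem_tsupport hx, mul_zero, mul_zero]
      have hcont : ContinuousOn (fun x => f x - f y) (tsupport φ) := fun x hx =>
        (hfd x hx).1.continuousAt.continuousWithinAt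
      have hcomp : IsCompact (tsupport φ) := hφ.2.1
      have hI : ∀ ψ : Space d → ℝ, Continuous ψ → (∀ x, x ∉ tsupport φ → ψ x = 0) →
          Integrable (fun x => (f x - f y) * ψ x) := fun ψ hψ h0 => by
        refine IntegrableOn.integrable_of_forall_notMem_eq_zero
          ((hcont.mul hψ.continuousOn).integrableOn_compact hcomp) fun x hx => ?_
        rw [h0 x hx, mul_zero]
      have key := integral_mul_fderiv_eq_neg_fderiv_mul_of_integrable (𝕜 := ℝ)
        (μ := (volume : Measure (Space d))) (f := fun x => f x - f y) (g := φ)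
        (v := EuclideanSpace.single i (1 : ℝ)) ?_ ?_ ?_ (fun x hx => (hfd x hx).1.differentiableAt)
        (fun x _ => hφ.differentiable x)
      · rw [setIntegral_eq_integral_of_forall_compl_eq_zero,
          setIntegral_eq_integral_of_forall_compl_eq_zero]
        · simp only [e1] at key
          exact key
        · intro x hx
          rw [hφ.eq_zero_of_notMem fun h => hx (hsub h), mul_zero]
        · intro x hx
          rw [hηt.eq_zero_of_notMem fun h => hx (hsub h), mul_zero]
      · simp only [e1]
        exact ((hmc i).mul hφ.continuous).integrable_of_hasCompactSupport hφ.2.1.mul_left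
      · refine hI _ hηt.continuous fun x hx => ?_
        exact image_eq_zero_of_notMem_tsupport (f := fun x => fderiv ℝ φ x
          (EuclideanSpace.single i (1 : ℝ))) fun h => hx (tsupport_fderiv_apply_subset ℝ _ h)
      · exact hI _ hφ.continuous fun x hx => image_eq_zero_of_notMem_tsupport hx
    · rw [Measure.prod_restrict]
      have hc : Continuous (Function.uncurry fun (t : ℝ) (x : Space d) =>
          segIntegrand m (x, (y, t)) * η x) := by
        unfold segIntegrand Function.uncurry
        refine Continuous.mul (continuous_finsetSum _ fun j _ => ?_)
          (hηt.continuous.comp continuous_snd)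
        exact ((hmc j).comp (continuous_segPoint.comp (by fun_prop))).mul (by fun_prop)
      have hK : IsCompact (Set.Icc (0 : ℝ) 1 ×ˢ closure (box d L)) :=
        isCompact_Icc.prod (isBounded_box L).isCompact_closure
      exact (hc.continuousOn.integrableOn_compact hK).mono_set
        (Set.prod_mono Set.Ioc_subset_Icc_self subset_closure)
  rw [tripleMeasure] at hint ⊢
  rw [integral_prod_symm _ hint, integral_prod _ hint.integral_prod_right]
  rw [setIntegral_congr_fun (isOpen_box _).measurableSet hfix]
  rw [integral_const, smul_eq_mul, measureReal_restrict_apply_univ]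
  ring

/-- A curl-free integrable field on a cube is the weak gradient of an integrable function. -/
theorem exists_weakGrad_of_curlFree {G : Space d → Fin d → ℝ} (hL : 0 < L)
    (hG : ∀ i, IntegrableOn (fun x => G x i) (box d L))
    (hcurl : ∀ ψ : Space d → ℝ, IsTestFunction (box d L) ψ → ∀ i j,
      ∫ x in box d L, G x i * grad ψ x j = ∫ x in box d L, G x j * grad ψ x i) :
    ∃ u : Space d → ℝ, IntegrableOn u (box d L) ∧ HasWeakGrad (box d L) u G := by
  have hm : MeasurableSet (box d L) := (isOpen_box L).measurableSet
  set B := box d (L / 2) with hB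
  set g : Fin d → Space d → ℝ := fun i => (box d L).indicator fun x => G x i with hg
  have hgi : ∀ i, Integrable (g i) := fun i => (hG i).integrable_indicator hm
  have hBpos : 0 < volume.real B := by
    refine ENNReal.toReal_pos ?_ (box_ne_top _)
    refine ((isOpen_box (L / 2)).measure_pos volume ⟨0, fun i => ?_⟩).ne'
    simpa using half_pos hL
  -- The potential at x is the line integral of G from y to x, averaged over y in the half-size
  -- cube. A single line integral is meaningless for an L¹ field.
  set u : Space d → ℝ := fun x => (volume.real B)⁻¹ *
    ∫ yt, segIntegrand g (x, yt) ∂((volume.restrict B).prod (volume.restrict (Set.Ioc (0 : ℝ) 1)))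
    with hu
  have hI1 := (integrable_segIntegrand_mul (η := fun _ => (1 : ℝ)) (C := 1) hL
    (fun i => (hgi i).integrableOn) continuous_const (by simp)).1
  simp only [mul_one] at hI1
  have huI : IntegrableOn u (box d L) := by
    rw [tripleMeasure] at hI1
    exact hI1.integral_prod_left.const_mul _
  refine ⟨u, huI, huI.locallyIntegrableOn, fun i => (hG i).locallyIntegrableOn, fun φ hφ i => ?_⟩
  obtain ⟨r, hr, hrL, hφr⟩ := exists_subset_box hφ.2.1 hL hφ.2.2
  have hφ' : IsTestFunction (box d r) φ := ⟨hφ.1, hφ.2.1, hφr⟩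
  have hηt := hφ.grad i
  obtain ⟨C, hC⟩ := hηt.exists_bound
  have hC0 : 0 ≤ C := (norm_nonneg _).trans (hC 0)
  have hI2 := (integrable_segIntegrand_mul hL (fun i => (hgi i).integrableOn) hηt.continuous hC)
  have e1 : volume.real B * ∫ x in box d L, u x * grad φ x i
      = ∫ z, segIntegrand g z * grad φ z.1 i ∂(tripleMeasure (box d L) B) := by
    rw [tripleMeasure, integral_prod _ (by have := hI2.1; rwa [tripleMeasure] at this),
      ← integral_const_mul]
    refine integral_congr_ae (Eventually.of_forall fun x => ?_)
    simp only [hu]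
    rw [integral_mul_const]
    field_simp
  have e2 : ∫ x in box d L, G x i * φ x = ∫ x in box d L, g i x * φ x :=
    setIntegral_congr_fun hm fun x hx => by simp [hg, Set.indicator_of_mem hx]
  have hdist : ∀ h : Fin d → Space d → ℝ, (∀ j, Integrable (h j)) →
      ∫ z, segIntegrand h z * grad φ z.1 i ∂(tripleMeasure (box d L) B)
        = ∑ j, ∫ z, h j (segPoint z) * ((z.1 j - z.2.1 j) * grad φ z.1 i)
          ∂(tripleMeasure (box d L) B) := fun h hh => by
    rw [← integral_finsetSum _ fun j _ => ((integrable_segIntegrand_mul hL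
      (fun i => (hh i).integrableOn) hηt.continuous hC).2 j).1]
    simp only [segIntegrand, Finset.sum_mul, mul_assoc, hB]
  have l1 : Tendsto (fun n => ∫ z, segIntegrand (fun j => mollify n (g j)) z * grad φ z.1 i
      ∂(tripleMeasure (box d L) B)) atTop
      (𝓝 (∫ z, segIntegrand g z * grad φ z.1 i ∂(tripleMeasure (box d L) B))) := by
    simp only [hdist _ hgi, fun n => hdist (fun j => mollify n (g j))
      fun j => integrable_mollify n (hgi j)]
    refine tendsto_finsetSum _ fun j _ => ?_
    exact tendsto_integral_comp_segPoint (convex_box L) hm (isOpen_box _).measurableSet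
      (box_mono (by linarith)) (box_ne_top L) (hgi j) (fun n => integrable_mollify n (hgi j))
      (tendsto_integral_norm_mollify_sub (hgi j)) (hI2.2 j).2 (by positivity)
      (Continuous.aestronglyMeasurable (by have := hηt.continuous; fun_prop))
  have l2 : Tendsto (fun n => ∫ x in box d L, mollify n (g i) x * φ x) atTop
      (𝓝 (∫ x in box d L, g i x * φ x)) := by
    obtain ⟨D, hD⟩ := hφ.exists_bound
    rw [tendsto_iff_norm_sub_tendsto_zero]
    refine squeeze_zero (fun n => norm_nonneg _) (fun n => ?_)
      (by simpa using (tendsto_integral_norm_mollify_sub (hgi i)).const_mul D)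
    have hi : ∀ {h : Space d → ℝ}, Integrable h → IntegrableOn (fun x => h x * φ x) (box d L) :=
      fun hh => (hh.integrableOn.mul_bdd hφ.continuous.aestronglyMeasurable
        (Eventually.of_forall hD))
    have hn : Integrable fun x => ‖mollify n (g i) x - g i x‖ :=
      ((integrable_mollify n (hgi i)).sub (hgi i)).norm
    rw [← integral_sub (hi (integrable_mollify n (hgi i))) (hi (hgi i)), ← integral_const_mul]
    refine (norm_integral_le_of_norm_le ((hn.const_mul D).integrableOn) ?_).trans
      (setIntegral_le_integral (hn.const_mul D) (Eventually.of_forall fun x => mul_nonneg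
        ((norm_nonneg _).trans (hD 0)) (norm_nonneg _)))
    refine Eventually.of_forall fun x => ?_
    rw [← sub_mul, norm_mul, mul_comm]
    exact mul_le_mul_of_nonneg_right (hD x) (norm_nonneg _)
  -- Once the mollification radius fits between r and L, the mollified field is smooth and curl-free
  -- on the smaller box, hence a gradient there, and the smooth identity applies.
  have hev : ∀ᶠ n : ℕ in atTop, ∫ z, segIntegrand (fun j => mollify n (g j)) z * grad φ z.1 i
      ∂(tripleMeasure (box d L) B)
      = -(volume.real B * ∫ x in box d L, mollify n (g i) x * φ x) := by
    have h0 : Tendsto (fun n : ℕ => r + 1 / ((n : ℝ) + 1)) atTop (𝓝 (r + 0)) :=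
      tendsto_const_nhds.add tendsto_one_div_add_atTop_nhds_zero_nat
    filter_upwards [h0.eventually_lt_const (by simpa using hrL)] with n hn
    have hsm : ∀ j, ContDiff ℝ ∞ (mollify n (g j)) := fun j =>
      contDiff_mollify n (hgi j).locallyIntegrable
    obtain ⟨f, hf⟩ := exists_primitive hsm
      fun x hx i j => fderiv_mollify_symm hG hcurl hn hx i j
    exact integral_segIntegrand_mul_grad hsm hL hr hrL hf hφ' i
  have l3 := tendsto_nhds_unique (l1.congr' hev) ((l2.const_mul (volume.real B)).neg)
  rw [← e1, ← e2, ← mul_neg] at l3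
  exact mul_left_cancel₀ hBpos.ne' l3

end CurlFree

/-! ### Projections in Hilbert space -/

section Projection

variable {H : Type*} [NormedAddCommGroup H] [InnerProductSpace ℝ H] [CompleteSpace H]
  (N : Submodule ℝ H) (ζ : H)

/-- The orthogonal projection onto the orthogonal complement of `N`. -/
def perpProj : H →L[ℝ] H := Nᗮ.starProjection

theorem perpProj_mem : perpProj N ζ ∈ Nᗮ := Submodule.starProjection_apply_mem Nᗮ ζ

/-- For h orthogonal to N the inner product with ζ equals that with its projection onto the
complement of N; completing the square bounds the functional, with equality at the projection
itself. -/
theorem inner_sub_half_sq_le {h : H} (hh : h ∈ Nᗮ) :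
    -(1 / 2) * ‖h‖ ^ 2 + inner ℝ ζ h ≤ 1 / 2 * ‖perpProj N ζ‖ ^ 2 := by
  have h1 := Submodule.starProjection_inner_eq_zero (K := Nᗮ) ζ h hh
  change inner ℝ (ζ - perpProj N ζ) h = 0 at h1
  rw [inner_sub_left, sub_eq_zero] at h1
  have h2 : 0 ≤ ‖perpProj N ζ - h‖ ^ 2 := sq_nonneg _
  rw [norm_sub_sq_real] at h2
  rw [h1]
  linarith

theorem inner_sub_half_sq_eq : -(1 / 2) * ‖perpProj N ζ‖ ^ 2
    + inner ℝ ζ (perpProj N ζ) = 1 / 2 * ‖perpProj N ζ‖ ^ 2 := by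
  have h1 := Submodule.starProjection_inner_eq_zero (K := Nᗮ) ζ _
    (perpProj_mem N ζ)
  change inner ℝ (ζ - perpProj N ζ) (perpProj N ζ) = 0 at h1
  rw [inner_sub_left, sub_eq_zero, real_inner_self_eq_norm_sq] at h1
  rw [h1]
  ring

theorem norm_perpProj_le_of_mem {n : H} (hn : n ∈ N) :
    ‖perpProj N ζ‖ ≤ ‖ζ + n‖ := by
  have h1 : perpProj N n = 0 := by
    rw [perpProj, Submodule.starProjection_apply_eq_zero_iff]
    exact N.le_orthogonal_orthogonal hn
  have h2 : perpProj N ζ = perpProj N (ζ + n) := by rw [map_add, h1, add_zero]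
  rw [h2]
  exact Submodule.norm_starProjection_apply_le _ _

/-- Dual side of the projection: the squared norm is the infimum of ‖ζ + n‖² over n in N. It need
not be attained, since N is not assumed closed, but the optimal correction lies in the closure of N.
-/
theorem exists_norm_add_sq_lt {ε : ℝ} (hε : 0 < ε) :
    ∃ n ∈ N, ‖ζ + n‖ ^ 2 < ‖perpProj N ζ‖ ^ 2 + ε := by
  have h1 : perpProj N ζ - ζ ∈ N.topologicalClosure := by
    rw [← Submodule.orthogonal_orthogonal_eq_closure, ← neg_mem_iff, neg_sub]
    exact Submodule.sub_starProjection_mem_orthogonal ζ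
  have h2 : IsOpen {n : H | ‖ζ + n‖ ^ 2 < ‖perpProj N ζ‖ ^ 2 + ε} :=
    isOpen_lt (by fun_prop) continuous_const
  obtain ⟨n, hn1, hn2⟩ := mem_closure_iff.1 h1 _ h2 (by simpa using hε)
  exact ⟨n, hn2, hn1⟩

end Projection

/-! ### Perturbations by gradients and solenoidal fields -/

theorem grad_grad_comm {ψ : Space d → ℝ} (h : ContDiff ℝ ∞ ψ) (x : Space d) (i j : Fin d) :
    grad (fun y => grad ψ y j) x i = grad (fun y => grad ψ y i) x j := by
  have hd : DifferentiableAt ℝ (fderiv ℝ ψ) x :=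
    ((h.fderiv_right (m := ∞) (by simp)).differentiable (by simp)) x
  have hs : IsSymmSndFDerivAt ℝ ψ x := h.contDiffAt.isSymmSndFDerivAt (by
    simp only [minSmoothness_of_isRCLikeNormedField]; exact WithTop.coe_le_coe.2 le_top)
  have key : ∀ i j, grad (fun y => grad ψ y j) x i = fderiv ℝ (fderiv ℝ ψ) x
      (EuclideanSpace.single i 1) (EuclideanSpace.single j 1) := fun i j => by
    simp only [grad]
    have h1 := hd.hasFDerivAt.clm_apply (hasFDerivAt_const (EuclideanSpace.single j (1 : ℝ)) x)
    rw [h1.fderiv]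
    simp
  rw [key, key, hs]

/-- The divergence of the skew-symmetric matrix field `Ψ - Ψᵗ`. -/
def curl (Ψ : Fin d → Fin d → Space d → ℝ) (x : Space d) (i : Fin d) : ℝ :=
  ∑ j, (grad (Ψ i j) x j - grad (Ψ j i) x j)

/-- `X` is the gradient of a test function and `Y` the curl of a matrix of test functions. -/
def IsPerturbation (U : Set (Space d)) (X Y : Space d → Fin d → ℝ) : Prop :=
  ∃ (φ : Space d → ℝ) (Ψ : Fin d → Fin d → Space d → ℝ), IsTestFunction U φ ∧
    (∀ i j, IsTestFunction U (Ψ i j)) ∧ X = grad φ ∧ Y = curl Ψ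

section Perturbation

variable {U : Set (Space d)} {X Y X' Y' : Space d → Fin d → ℝ}

theorem grad_zero (x : Space d) : grad (fun _ : Space d => (0 : ℝ)) x = 0 := by
  ext i; simp [grad]

theorem IsPerturbation.zero (U : Set (Space d)) : IsPerturbation U 0 0 := by
  refine ⟨fun _ => 0, fun _ _ _ => 0, IsTestFunction.zero U, fun _ _ => IsTestFunction.zero U, ?_, ?_⟩
  · ext x i; simp [grad_zero]
  · ext x i; simp [curl, grad_zero]

theorem IsPerturbation.add (h : IsPerturbation U X Y) (h' : IsPerturbation U X' Y') :
    IsPerturbation U (X + X') (Y + Y') := by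
  obtain ⟨φ, Ψ, hφ, hΨ, rfl, rfl⟩ := h
  obtain ⟨φ', Ψ', hφ', hΨ', rfl, rfl⟩ := h'
  refine ⟨fun x => φ x + φ' x, fun i j x => Ψ i j x + Ψ' i j x, hφ.add hφ',
    fun i j => (hΨ i j).add (hΨ' i j), ?_, ?_⟩
  · ext x i
    rw [hφ.grad_add hφ']
    rfl
  · ext x i
    simp only [curl, Pi.add_apply, (hΨ _ _).grad_add (hΨ' _ _), ← Finset.sum_add_distrib]
    exact Finset.sum_congr rfl fun j _ => by ring

theorem IsPerturbation.smul (h : IsPerturbation U X Y) (c : ℝ) :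
    IsPerturbation U (c • X) (c • Y) := by
  obtain ⟨φ, Ψ, hφ, hΨ, rfl, rfl⟩ := h
  refine ⟨fun x => c * φ x, fun i j x => c * Ψ i j x, hφ.const_mul c,
    fun i j => (hΨ i j).const_mul c, ?_, ?_⟩
  · ext x i
    rw [hφ.grad_const_mul]
    rfl
  · ext x i
    simp only [curl, Pi.smul_apply, (hΨ _ _).grad_const_mul, smul_eq_mul, Finset.mul_sum]
    exact Finset.sum_congr rfl fun j _ => by ring

theorem continuous_curl {Ψ : Fin d → Fin d → Space d → ℝ} (hΨ : ∀ i j, IsTestFunction U (Ψ i j)) :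
    Continuous (curl Ψ) :=
  continuous_pi fun i => continuous_finsetSum _ fun j _ =>
    ((hΨ i j).grad j).continuous.sub ((hΨ j i).grad j).continuous

theorem continuous_grad {φ : Space d → ℝ} (hφ : IsTestFunction U φ) : Continuous (grad φ) :=
  continuous_pi fun i => (hφ.grad i).continuous

theorem IsPerturbation.continuous (h : IsPerturbation U X Y) : Continuous X ∧ Continuous Y := by
  obtain ⟨φ, Ψ, hφ, hΨ, rfl, rfl⟩ := h
  exact ⟨continuous_grad hφ, continuous_curl hΨ⟩

theorem memLp_top_of_continuous {f : Space d → ℝ} (hf : Continuous f)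
    (hU : Bornology.IsBounded U) (hUm : MeasurableSet U) : MemLp f ⊤ (volume.restrict U) := by
  obtain ⟨C, hC⟩ := hU.isCompact_closure.exists_bound_of_continuousOn hf.continuousOn
  refine memLp_top_of_bound hf.aestronglyMeasurable C ?_
  filter_upwards [ae_restrict_mem hUm] with x hx using hC x (subset_closure hx)

/-- `s^{-1/2} (Y - aᵗ X)`. -/
def zetaF (a : Space d → Mat d) (X Y : Space d → Fin d → ℝ) (x : Space d) : Fin d → ℝ :=
  zeta a (X x) (Y x) x

theorem memLp_zetaF {a : Space d → Mat d} (ha : IsAdmissible a) (hU : Bornology.IsBounded U)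
    (hUm : MeasurableSet U) (hX : Continuous X) (hY : Continuous Y) :
    MemLp (fun x => (WithLp.toLp 2 (zetaF a X Y x) : Space d)) 2 (volume.restrict U) := by
  rw [memLp_piLp_iff]
  intro i
  simp only [zetaF, zeta, Pi.sub_apply, mulVec, dotProduct]
  have hX' : ∀ j, Continuous fun x => X x j := fun j => (continuous_apply j).comp hX
  have hY' : ∀ j, Continuous fun x => Y x j := fun j => (continuous_apply j).comp hY
  exact (memLp_finsetSum _ fun j _ => (memLp_top_of_continuous (hY' j) hU hUm).mul
    ((ha.memLpLoc_rho i j).restrict hU)).sub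
    (memLp_finsetSum _ fun j _ => (memLp_top_of_continuous (hX' j) hU hUm).mul
    ((ha.memLpLoc_fluxMat i j).restrict hU))

theorem zeta_add (a : Space d → Mat d) (p q p' q' : Fin d → ℝ) (x : Space d) :
    zeta a (p + p') (q + q') x = zeta a p q x + zeta a p' q' x := by
  simp only [zeta, mulVec_add]; abel

theorem zeta_smul (a : Space d → Mat d) (p q : Fin d → ℝ) (c : ℝ) (x : Space d) :
    zeta a (c • p) (c • q) x = c • zeta a p q x := by
  simp only [zeta, mulVec_smul, smul_sub]

/-- Gradients are orthogonal to curls. -/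
theorem integral_dotProduct_curl {u : Space d → ℝ} {G : Space d → Fin d → ℝ}
    (hw : HasWeakGrad U u G) (hG : ∀ i, IntegrableOn (fun x => G x i) U)
    {Ψ : Fin d → Fin d → Space d → ℝ} (hΨ : ∀ i j, IsTestFunction U (Ψ i j)) :
    ∫ x in U, G x ⬝ᵥ curl Ψ x = 0 := by
  have hI : ∀ i j k l m, IntegrableOn (fun x => G x i * grad (Ψ j k) x l * (m : ℝ)) U :=
    fun i j k l m => ((hG i).mul_of_top_left (((hΨ j k).grad l).memLp_top _)).mul_const m
  have hI' : ∀ i j k l, IntegrableOn (fun x => G x i * grad (Ψ j k) x l) U :=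
    fun i j k l => by simpa using hI i j k l 1
  -- A weak gradient is curl-free: test it with ∂_jψ and ∂_iψ and use equality of mixed second
  -- derivatives.
  have hsymm : ∀ ψ : Space d → ℝ, IsTestFunction U ψ → ∀ i j,
      ∫ x in U, G x i * grad ψ x j = ∫ x in U, G x j * grad ψ x i := fun ψ hψ i j => by
    have h1 := hw.2.2 _ (hψ.grad j) i
    have h2 := hw.2.2 _ (hψ.grad i) j
    simp only [grad_grad_comm hψ.1 _ i j] at h1
    linarith
  have e : ∀ x, G x ⬝ᵥ curl Ψ x
      = ∑ i, ∑ j, (G x i * grad (Ψ i j) x j - G x i * grad (Ψ j i) x j) := fun x => by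
    simp only [dotProduct, curl, Finset.mul_sum, mul_sub]
  simp only [e]
  have hD : ∀ i j, IntegrableOn
      (fun x => G x i * grad (Ψ i j) x j - G x i * grad (Ψ j i) x j) U :=
    fun i j => (hI' i i j j).sub (hI' i j i j)
  rw [integral_finsetSum _ fun i _ => integrable_finsetSum _ fun j _ => hD i j]
  have e2 : ∀ i, ∫ x in U, ∑ j, (G x i * grad (Ψ i j) x j - G x i * grad (Ψ j i) x j)
      = ∑ j, ((∫ x in U, G x i * grad (Ψ i j) x j) - ∫ x in U, G x i * grad (Ψ j i) x j) :=
    fun i => by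
      rw [integral_finsetSum _ fun j _ => hD i j]
      exact Finset.sum_congr rfl fun j _ => integral_sub (hI' i i j j) (hI' i j i j)
  simp only [e2]
  simp only [Finset.sum_sub_distrib]
  rw [sub_eq_zero, Finset.sum_comm]
  exact Finset.sum_congr rfl fun i _ => Finset.sum_congr rfl fun j _ =>
    hsymm _ (hΨ j i) j i

theorem IsTestFunction.hasWeakGrad {φ : Space d → ℝ} (hφ : IsTestFunction U φ) :
    HasWeakGrad U φ (CoarseGraining.grad φ) := by
  refine ⟨hφ.integrable.integrableOn.locallyIntegrableOn,
    fun i => (hφ.grad i).integrable.integrableOn.locallyIntegrableOn, fun ψ hψ i => ?_⟩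
  have key := integral_mul_fderiv_eq_neg_fderiv_mul_of_integrable (𝕜 := ℝ)
    (μ := (volume : Measure (Space d))) (f := φ) (g := ψ) (v := EuclideanSpace.single i (1 : ℝ))
    (((hφ.grad i).continuous.mul hψ.continuous).integrable_of_hasCompactSupport
      hψ.2.1.mul_left) ((hφ.continuous.mul (hψ.grad i).continuous).integrable_of_hasCompactSupport
      hφ.2.1.mul_right) ((hφ.continuous.mul hψ.continuous).integrable_of_hasCompactSupport
      hφ.2.1.mul_right) (fun x _ => hφ.differentiable x) (fun x _ => hψ.differentiable x)
  rw [setIntegral_eq_integral_of_forall_compl_eq_zero,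
    setIntegral_eq_integral_of_forall_compl_eq_zero]
  · exact key
  · intro x hx; rw [hψ.eq_zero_of_notMem hx, mul_zero]
  · intro x hx; rw [hφ.eq_zero_of_notMem hx, zero_mul]

/-- Perturbations do not change the average of `x · y`. -/
theorem integral_dotProduct_perturbation (hU : Bornology.IsBounded U)
    (h : IsPerturbation U X Y) (p q : Fin d → ℝ) :
    ∫ x in U, (p + X x) ⬝ᵥ (q + Y x) = volume.real U * (p ⬝ᵥ q) := by
  have hc := h.continuous
  have hI : ∀ {f : Space d → ℝ}, Continuous f → IntegrableOn f U := fun hf =>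
    (hf.continuousOn.integrableOn_compact hU.isCompact_closure).mono_set subset_closure
  have cX : ∀ j, Continuous fun x => X x j := fun j => (continuous_apply j).comp hc.1
  have cY : ∀ j, Continuous fun x => Y x j := fun j => (continuous_apply j).comp hc.2
  have i1 : IntegrableOn (fun x => p ⬝ᵥ Y x) U := hI (by unfold dotProduct; fun_prop)
  have i2 : IntegrableOn (fun x => X x ⬝ᵥ q) U := hI (by unfold dotProduct; fun_prop)
  have i3 : IntegrableOn (fun x => X x ⬝ᵥ Y x) U := hI (by unfold dotProduct; fun_prop)
  obtain ⟨φ, Ψ, hφ, hΨ, rfl, rfl⟩ := h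
  have e1 : ∫ x in U, p ⬝ᵥ curl Ψ x = 0 := by
    simp only [dotProduct, curl, Finset.mul_sum]
    have hD : ∀ i j, IntegrableOn (fun x => p i * (grad (Ψ i j) x j - grad (Ψ j i) x j)) U :=
      fun i j => (((hΨ i j).grad j).integrable.integrableOn.sub
        ((hΨ j i).grad j).integrable.integrableOn).const_mul _
    rw [integral_finsetSum _ fun i _ => integrable_finsetSum _ fun j _ => hD i j]
    refine Finset.sum_eq_zero fun i _ => ?_
    rw [integral_finsetSum _ fun j _ => hD i j]
    refine Finset.sum_eq_zero fun j _ => ?_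
    rw [integral_const_mul, integral_sub ((hΨ i j).grad j).integrable.integrableOn
      ((hΨ j i).grad j).integrable.integrableOn, (hΨ i j).setIntegral_grad_eq_zero,
      (hΨ j i).setIntegral_grad_eq_zero, sub_zero, mul_zero]
  have e2 : ∫ x in U, grad φ x ⬝ᵥ q = 0 := by
    simp only [dotProduct]
    rw [integral_finsetSum _ fun i _ => ((hφ.grad i).integrable.integrableOn).mul_const _]
    refine Finset.sum_eq_zero fun i _ => ?_
    rw [integral_mul_const, hφ.setIntegral_grad_eq_zero, zero_mul]
  have e3 := integral_dotProduct_curl hφ.hasWeakGrad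
    (fun i => (hφ.grad i).integrable.integrableOn) hΨ
  have hfin : IntegrableOn (fun _ : Space d => p ⬝ᵥ q) U := hI continuous_const
  have e : ∀ x, (p + grad φ x) ⬝ᵥ (q + curl Ψ x)
      = (p ⬝ᵥ q + p ⬝ᵥ curl Ψ x) + (grad φ x ⬝ᵥ q + grad φ x ⬝ᵥ curl Ψ x) := fun x => by
    simp only [add_dotProduct, dotProduct_add]; ring
  simp only [e]
  have j1 : IntegrableOn (fun x => p ⬝ᵥ q + p ⬝ᵥ curl Ψ x) U := hfin.add i1
  have j2 : IntegrableOn (fun x => grad φ x ⬝ᵥ q + grad φ x ⬝ᵥ curl Ψ x) U := i2.add i3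
  rw [integral_add j1 j2, integral_add hfin i1, integral_add i2 i3, e1, e2, e3,
    setIntegral_const, smul_eq_mul]
  ring

/-- The complementary form of the pointwise energy. -/
theorem neg_dotProduct_le_zeta {a : Space d → Mat d} {x : Space d} (hx : (symPart (a x)).PosDef)
    (p q : Fin d → ℝ) : -(4 * (p ⬝ᵥ q)) ≤ zeta a p q x ⬝ᵥ zeta a p q x := by
  set σ := (symPart (a x) * invSqrt (symPart (a x))) *ᵥ p with hσ
  set A := zeta a p q x with hA
  have e0 : A = invSqrt (symPart (a x)) *ᵥ (q - (a x)ᵀ *ᵥ p) := by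
    rw [hA, zeta, fluxMat, rho, mulVec_sub, mulVec_mulVec]
  have h1 : A ⬝ᵥ σ = (q - (a x)ᵀ *ᵥ p) ⬝ᵥ p := by rw [e0, hσ, invSqrt_dotProduct_sqrt hx]
  have h2 : σ ⬝ᵥ σ = p ⬝ᵥ (symPart (a x) *ᵥ p) := sqrt_dotProduct_self hx p
  have h3 : p ⬝ᵥ ((a x)ᵀ *ᵥ p) = p ⬝ᵥ (symPart (a x) *ᵥ p) := by
    have := IsCoarse.quad_half_add_transpose (a x) p
    change p ⬝ᵥ (symPart (a x) *ᵥ p) = _ at this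
    rw [this, mulVec_transpose, dotProduct_comm, ← dotProduct_mulVec]
  -- Here A·σ = p·q - p·sp and σ·σ = p·sp with σ = s^{1/2}p, so the coefficient 2 is the one for
  -- which |A + 2σ|² = |A|² + 4p·q.
  have h4 : 0 ≤ (A + (2 : ℝ) • σ) ⬝ᵥ (A + (2 : ℝ) • σ) :=
    Finset.sum_nonneg fun i _ => mul_self_nonneg _
  simp only [add_dotProduct, dotProduct_add, smul_dotProduct, dotProduct_smul, smul_eq_mul,
    dotProduct_comm σ A, h1, h2, sub_dotProduct, dotProduct_comm ((a x)ᵀ *ᵥ p) p, h3,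
    dotProduct_comm q p] at h4
  linarith

end Perturbation

/-! ### The variational formula on cubes -/

section Cube

variable {a : Space d → Mat d} {L : ℝ}

/-- The fields `s^{-1/2} (Y - aᵗ X)` for perturbations `(X, Y)`, as elements of `L²`. -/
def pertSpace (a : Space d → Mat d) (L : ℝ) :
    Submodule ℝ (Lp (Space d) 2 (volume.restrict (box d L))) where
  carrier := {h | ∃ X Y, IsPerturbation (box d L) X Y ∧
    ∀ᵐ x ∂(volume.restrict (box d L)), h x = WithLp.toLp 2 (zetaF a X Y x)}
  zero_mem' := by
    refine ⟨0, 0, IsPerturbation.zero _, ?_⟩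
    filter_upwards [Lp.coeFn_zero (Space d) 2 (volume.restrict (box d L))] with x hx
    rw [hx]
    simp [zetaF, zeta]
  add_mem' := by
    rintro h h' ⟨X, Y, hP, he⟩ ⟨X', Y', hP', he'⟩
    refine ⟨_, _, hP.add hP', ?_⟩
    filter_upwards [he, he', Lp.coeFn_add h h'] with x hx hx' hx2
    rw [hx2, Pi.add_apply, hx, hx']
    simp only [zetaF, Pi.add_apply, zeta_add]
    rfl
  smul_mem' := by
    rintro c h ⟨X, Y, hP, he⟩
    refine ⟨_, _, hP.smul c, ?_⟩
    filter_upwards [he, Lp.coeFn_smul c h] with x hx hx2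
    rw [hx2, Pi.smul_apply, hx]
    simp only [zetaF, Pi.smul_apply, zeta_smul]
    rfl

/-- The class of `s^{-1/2} (q - aᵗ p)` in `L²`, linear in `(p, q)`. -/
def zetaLp (ha : IsAdmissible a) (L : ℝ) :
    ((Fin d → ℝ) × (Fin d → ℝ)) →ₗ[ℝ] Lp (Space d) 2 (volume.restrict (box d L)) where
  toFun v := (memLp_zetaF ha (isBounded_box L) (isOpen_box L).measurableSet
    (continuous_const (y := v.1)) (continuous_const (y := v.2))).toLp
  map_add' v w := by
    rw [← MemLp.toLp_add]
    congr 1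
    ext x : 1
    simp only [zetaF, Prod.fst_add, Prod.snd_add, zeta_add]
    rfl
  map_smul' c v := by
    rw [RingHom.id_apply, ← MemLp.toLp_const_smul]
    congr 1
    ext x : 1
    simp only [zetaF, Prod.smul_fst, Prod.smul_snd, zeta_smul]
    rfl

theorem zetaLp_coe (ha : IsAdmissible a) (L : ℝ) (p q : Fin d → ℝ) :
    ∀ᵐ x ∂(volume.restrict (box d L)), zetaLp ha L (p, q) x = WithLp.toLp 2 (zeta a p q x) :=
  (memLp_zetaF ha (isBounded_box L) (isOpen_box L).measurableSet
    (continuous_const (y := p)) (continuous_const (y := q))).coeFn_toLp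

theorem inner_eq_integral {f g : Lp (Space d) 2 (volume.restrict (box d L))}
    {v w : Space d → Fin d → ℝ}
    (hf : ∀ᵐ x ∂(volume.restrict (box d L)), f x = WithLp.toLp 2 (v x))
    (hg : ∀ᵐ x ∂(volume.restrict (box d L)), g x = WithLp.toLp 2 (w x)) :
    inner ℝ f g = ∫ x in box d L, v x ⬝ᵥ w x := by
  rw [L2.inner_def]
  refine integral_congr_ae ?_
  filter_upwards [hf, hg] with x hx hx'
  rw [hx, hx', EuclideanSpace.inner_toLp_toLp, star_trivial, dotProduct_comm]

theorem norm_sq_eq_integral {f : Lp (Space d) 2 (volume.restrict (box d L))}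
    {v : Space d → Fin d → ℝ}
    (hf : ∀ᵐ x ∂(volume.restrict (box d L)), f x = WithLp.toLp 2 (v x)) :
    ‖f‖ ^ 2 = ∫ x in box d L, v x ⬝ᵥ v x := by
  rw [← inner_eq_integral hf hf, real_inner_self_eq_norm_sq]

theorem zeta_dotProduct_rootField {x : Space d} (hx : (symPart (a x)).PosDef)
    (p q : Fin d → ℝ) (G : Space d → Fin d → ℝ) :
    zeta a p q x ⬝ᵥ rootField a G x = q ⬝ᵥ G x - p ⬝ᵥ (a x *ᵥ G x) := by
  have := integrand_eq hx p q G
  rw [integrand, rootField, rho, sqrt_dotProduct_self hx] at this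
  rw [rootField, rho]
  linarith

theorem integral_integrand_eq {u : Space d → ℝ} {G : Space d → Fin d → ℝ}
    (ha : IsAdmissible a) {f : Lp (Space d) 2 (volume.restrict (box d L))}
    (hf : ∀ᵐ x ∂(volume.restrict (box d L)), f x = WithLp.toLp 2 (rootField a G x))
    (hs : IsSolution a (box d L) u G) (p q : Fin d → ℝ) :
    ∫ x in box d L, integrand a p q G x = -(1 / 2) * ‖f‖ ^ 2 + inner ℝ (zetaLp ha L (p, q)) f := by
  have hb := isBounded_box (d := d) L
  rw [norm_sq_eq_integral hf, inner_eq_integral (zetaLp_coe ha L p q) hf, ← integral_const_mul,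
    ← integral_add]
  · refine integral_congr_ae ?_
    filter_upwards [ae_restrict_of_ae ha.1] with x hx using integrand_eq hx p q G
  · refine (hs.energy.congr ?_).const_mul _
    filter_upwards [ae_restrict_of_ae ha.1] with x hx
    rw [rootField, rho, sqrt_dotProduct_self hx]
  · refine (ha.integrableOn_zeta_dotProduct hb hs.aemeasurable hs.energy p q).congr ?_
    filter_upwards [ae_restrict_of_ae ha.1] with x hx
    rw [zeta_dotProduct_rootField hx]

/-- Solutions give elements of the orthogonal complement of the perturbations. -/
theorem IsSolution.mem_orthogonal {u : Space d → ℝ} {G : Space d → Fin d → ℝ}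
    (ha : IsAdmissible a) (hs : IsSolution a (box d L) u G) :
    ∃ f ∈ (pertSpace a L)ᗮ,
      ∀ᵐ x ∂(volume.restrict (box d L)), f x = WithLp.toLp 2 (rootField a G x) := by
  have hb := isBounded_box (d := d) L
  have hG := fun i => ha.integrableOn_grad hb hs.aemeasurable hs.energy i
  have hF := fun i => ha.integrableOn_flux hb hs.aemeasurable hs.energy i
  have hmem : MemLp (fun x => (WithLp.toLp 2 (rootField a G x) : Space d)) 2
      (volume.restrict (box d L)) := memLp_piLp_iff.2 fun i =>
    ha.memLp_rootField hs.aemeasurable hs.energy i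
  have hcoe := hmem.coeFn_toLp
  refine ⟨hmem.toLp, ?_, hcoe⟩
  rw [Submodule.mem_orthogonal]
  rintro n ⟨X, Y, ⟨φ, Ψ, hφ, hΨ, rfl, rfl⟩, hn⟩
  rw [inner_eq_integral hn hcoe]
  have e : ∫ x in box d L, zetaF a (grad φ) (curl Ψ) x ⬝ᵥ rootField a G x
      = ∫ x in box d L, (G x ⬝ᵥ curl Ψ x - grad φ x ⬝ᵥ (a x *ᵥ G x)) := by
    refine integral_congr_ae ?_
    filter_upwards [ae_restrict_of_ae ha.1] with x hx
    rw [zetaF, zeta_dotProduct_rootField hx, dotProduct_comm (curl Ψ x)]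
  rw [e, integral_sub, integral_dotProduct_curl hs.weakGrad hG hΨ, hs.equation φ hφ, sub_zero]
  · refine integrable_finsetSum _ fun i _ => (hG i).mul_of_top_left ?_
    exact memLp_top_of_continuous ((continuous_apply i).comp (continuous_curl hΨ)) hb
      (isOpen_box L).measurableSet
  · refine integrable_finsetSum _ fun i _ => (hF i).mul_of_top_right ?_
    exact (hφ.grad i).memLp_top _

/-- Elements of the orthogonal complement of the perturbations come from solutions. -/
theorem exists_solution_of_mem_orthogonal (ha : IsAdmissible a) (hL : 0 < L)
    {f : Lp (Space d) 2 (volume.restrict (box d L))} (hf : f ∈ (pertSpace a L)ᗮ) :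
    ∃ u G, IsSolution a (box d L) u G ∧
      ∀ᵐ x ∂(volume.restrict (box d L)), f x = WithLp.toLp 2 (rootField a G x) := by
  have hb := isBounded_box (d := d) L
  have hm : MeasurableSet (box d L) := (isOpen_box L).measurableSet
  have hfL := memLp_piLp_iff.1 (Lp.memLp f)
  -- The gradient is recovered as s^{-1/2}f.
  set G : Space d → Fin d → ℝ := fun x => rho a x *ᵥ (f x).ofLp with hGdef
  have hroot : ∀ᵐ x ∂(volume.restrict (box d L)), f x = WithLp.toLp 2 (rootField a G x) := by
    filter_upwards [ae_restrict_of_ae ha.1] with x hx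
    rw [rootField, hGdef]
    simp only [rho]
    rw [mulVec_mulVec, sqrt_mul_invSqrt hx, one_mulVec]
  have hGm : ∀ i, AEMeasurable (fun x => G x i) (volume.restrict (box d L)) := fun i => by
    simp only [hGdef, mulVec, dotProduct]
    exact Finset.aemeasurable_fun_sum _ fun j _ =>
      ((ha.memLpLoc_rho i j).aemeasurable.restrict).mul (hfL j).1.aemeasurable
  have hE : IntegrableOn (fun x => G x ⬝ᵥ (symPart (a x) *ᵥ G x)) (box d L) := by
    have h1 : IntegrableOn (fun x => ∑ i, (f x).ofLp i * (f x).ofLp i) (box d L) :=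
      integrable_finsetSum _ fun i _ => (hfL i).integrable_mul (hfL i)
    refine h1.congr ?_
    filter_upwards [ae_restrict_of_ae ha.1, hroot] with x hx hx'
    rw [← sqrt_dotProduct_self hx]
    rw [hx']
    rfl
  have hG := fun i => ha.integrableOn_grad hb hGm hE i
  have hF := fun i => ha.integrableOn_flux hb hGm hE i
  have horth : ∀ φ Ψ, IsTestFunction (box d L) φ → (∀ i j, IsTestFunction (box d L) (Ψ i j)) →
      ∫ x in box d L, (curl Ψ x ⬝ᵥ G x - grad φ x ⬝ᵥ (a x *ᵥ G x)) = 0 := by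
    intro φ Ψ hφ hΨ
    have hmem := memLp_zetaF ha hb hm (continuous_grad hφ) (continuous_curl hΨ)
    have h1 := (Submodule.mem_orthogonal _ _).1 hf hmem.toLp
      ⟨_, _, ⟨φ, Ψ, hφ, hΨ, rfl, rfl⟩, hmem.coeFn_toLp⟩
    rw [inner_eq_integral hmem.coeFn_toLp hroot] at h1
    rw [← h1]
    refine integral_congr_ae ?_
    filter_upwards [ae_restrict_of_ae ha.1] with x hx
    rw [zetaF, zeta_dotProduct_rootField hx]
  have hcurl : ∀ ψ : Space d → ℝ, IsTestFunction (box d L) ψ → ∀ i j,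
      ∫ x in box d L, G x i * grad ψ x j = ∫ x in box d L, G x j * grad ψ x i := by
    intro ψ hψ i j
    have hI : ∀ k l, IntegrableOn (fun x => G x k * grad ψ x l) (box d L) := fun k l =>
      (hG k).mul_of_top_left ((hψ.grad l).memLp_top _)
    -- A matrix of test functions whose only nonzero entry is ψ, in place (i, j), isolates the (i,
    -- j) curl-free condition.
    have h1 := horth (fun _ => 0) (fun k l x => if k = i ∧ l = j then ψ x else 0)
      (IsTestFunction.zero _) (fun k l => by
        by_cases h : k = i ∧ l = j
        · simpa [h] using hψ
        · simpa [h] using IsTestFunction.zero _)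
    have hgr : ∀ k l x, grad (fun x => if k = i ∧ l = j then ψ x else 0) x
        = if k = i ∧ l = j then grad ψ x else 0 := fun k l x => by
      by_cases h : k = i ∧ l = j
      · simp only [h, and_self, if_true]
      · simp only [h, if_false]; exact grad_zero x
    have e : ∀ x, curl (fun k l x => if k = i ∧ l = j then ψ x else 0) x ⬝ᵥ G x
        - grad (fun _ => 0) x ⬝ᵥ (a x *ᵥ G x) = G x i * grad ψ x j - G x j * grad ψ x i := by
      intro x
      rw [grad_zero, zero_dotProduct, sub_zero, dotProduct]
      have e1 : ∀ k, curl (fun k l x => if k = i ∧ l = j then ψ x else 0) x k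
          = (if k = i then grad ψ x j else 0) - (if k = j then grad ψ x i else 0) := fun k => by
        simp only [curl, hgr, Finset.sum_sub_distrib]
        congr 1
        · by_cases hk : k = i
          · simp [hk, ite_apply]
          · simp [hk]
        · by_cases hk : k = j
          · simp [hk, ite_apply]
          · simp [hk]
      simp only [e1, sub_mul, Finset.sum_sub_distrib, ite_mul, zero_mul, Finset.sum_ite_eq',
        Finset.mem_univ, if_true]
      ring
    simp only [e] at h1
    rw [integral_sub (hI i j) (hI j i)] at h1
    linarith
  obtain ⟨u, hu, hw⟩ := exists_weakGrad_of_curlFree hL hG hcurl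
  refine ⟨_, G, IsSolution.of_weakGrad hb hu hw hE fun φ hφ => ?_, hroot⟩
  have h1 := horth φ (fun _ _ _ => 0) hφ fun _ _ => IsTestFunction.zero _
  have e : ∀ x, curl (fun _ _ _ => (0 : ℝ)) x ⬝ᵥ G x = 0 := fun x => by
    simp [curl, grad_zero, dotProduct]
  simp only [e, zero_sub, integral_neg, neg_eq_zero] at h1
  exact h1

/-- Since s^{1/2}∇u ranges over all of the orthogonal complement of `pertSpace`, the supremum is
that of -½‖h‖² + ⟨ζ, h⟩ over this closed subspace, attained at the projection of ζ. -/
theorem energySup_box_eq (ha : IsAdmissible a) (hL : 0 < L) (p q : Fin d → ℝ) :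
    energySup a p q (box d L)
      = 1 / 2 * ‖perpProj (pertSpace a L) (zetaLp ha L (p, q))‖ ^ 2 := by
  refine le_antisymm (energySup_le fun u G hs => ?_) ?_
  · obtain ⟨f, hf, hfG⟩ := hs.mem_orthogonal ha
    rw [integral_integrand_eq ha hfG hs]
    exact inner_sub_half_sq_le _ _ hf
  · obtain ⟨u, G, hs, hfG⟩ := exists_solution_of_mem_orthogonal ha hL
      (perpProj_mem (pertSpace a L) (zetaLp ha L (p, q)))
    rw [← inner_sub_half_sq_eq, ← integral_integrand_eq ha hfG hs]
    exact integral_le_energySup ha (isBounded_box L) hs p q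

/-- `|U| J(U, p, q)` is a quadratic form in `(p, q)`. -/
theorem exists_energySup_box_quadratic (ha : IsAdmissible a) (hL : 0 < L) :
    ∃ Z : ((Fin d → ℝ) × (Fin d → ℝ)) →ₗ[ℝ] Lp (Space d) 2 (volume.restrict (box d L)),
      ∀ p q, energySup a p q (box d L) = 1 / 2 * ‖Z (p, q)‖ ^ 2 :=
  ⟨(perpProj (pertSpace a L)).toLinearMap.comp (zetaLp ha L),
    fun p q => energySup_box_eq ha hL p q⟩

/-- The energy of a perturbation of the affine data `(p, q)`. -/
def pertEnergy (a : Space d → Mat d) (U : Set (Space d)) (p q : Fin d → ℝ)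
    (X Y : Space d → Fin d → ℝ) : ℝ :=
  ∫ x in U, zeta a (p + X x) (q + Y x) x ⬝ᵥ zeta a (p + X x) (q + Y x) x

theorem norm_sq_add_eq_pertEnergy (ha : IsAdmissible a) {p q : Fin d → ℝ}
    {X Y : Space d → Fin d → ℝ} {n : Lp (Space d) 2 (volume.restrict (box d L))}
    (hn : ∀ᵐ x ∂(volume.restrict (box d L)), n x = WithLp.toLp 2 (zetaF a X Y x)) :
    ‖zetaLp ha L (p, q) + n‖ ^ 2 = pertEnergy a (box d L) p q X Y := by
  refine norm_sq_eq_integral ?_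
  filter_upwards [Lp.coeFn_add (zetaLp ha L (p, q)) n, hn, zetaLp_coe ha L p q] with x h1 h2 h3
  rw [h1, Pi.add_apply, h2, h3, zeta_add]
  rfl

/-- Together with `exists_pertEnergy_lt` this is the dual variational principle: |U| J is half the
infimum of `pertEnergy`. In contrast with the set of solutions, the set of perturbations does not
depend on the coefficient field. -/
theorem energySup_box_le_pertEnergy (ha : IsAdmissible a) (hL : 0 < L) (p q : Fin d → ℝ)
    {X Y : Space d → Fin d → ℝ} (h : IsPerturbation (box d L) X Y) :
    energySup a p q (box d L) ≤ 1 / 2 * pertEnergy a (box d L) p q X Y := by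
  have hmem := memLp_zetaF ha (isBounded_box L) (isOpen_box L).measurableSet h.continuous.1
    h.continuous.2
  rw [energySup_box_eq ha hL, ← norm_sq_add_eq_pertEnergy ha hmem.coeFn_toLp]
  have := norm_perpProj_le_of_mem (pertSpace a L) (zetaLp ha L (p, q)) (n := hmem.toLp)
    ⟨_, _, h, hmem.coeFn_toLp⟩
  gcongr

theorem exists_pertEnergy_lt (ha : IsAdmissible a) (hL : 0 < L) (p q : Fin d → ℝ) {ε : ℝ}
    (hε : 0 < ε) : ∃ X Y, IsPerturbation (box d L) X Y ∧
      1 / 2 * pertEnergy a (box d L) p q X Y < energySup a p q (box d L) + ε := by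
  obtain ⟨n, ⟨X, Y, hP, hn⟩, hlt⟩ := exists_norm_add_sq_lt (pertSpace a L) (zetaLp ha L (p, q)) hε
  refine ⟨X, Y, hP, ?_⟩
  rw [norm_sq_add_eq_pertEnergy ha hn] at hlt
  rw [energySup_box_eq ha hL]
  linarith

/-- Every perturbed energy dominates pointwise a multiple of (p+X)·(q+Y), whose integral is that of
p·q for every perturbation. The lower bound thus survives the infimum. -/
theorem neg_le_energySup_box (ha : IsAdmissible a) (hL : 0 < L) (p q : Fin d → ℝ) :
    -(2 * (volume.real (box d L) * (p ⬝ᵥ q))) ≤ energySup a p q (box d L) := by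
  refine le_of_forall_pos_le_add fun ε hε => ?_
  obtain ⟨X, Y, hP, hlt⟩ := exists_pertEnergy_lt ha hL p q hε
  refine le_trans ?_ hlt.le
  have hm : MeasurableSet (box d L) := (isOpen_box L).measurableSet
  have hc := hP.continuous
  rw [← integral_dotProduct_perturbation (isBounded_box L) hP, pertEnergy, ← integral_const_mul,
    ← integral_const_mul, ← integral_neg]
  have cX : ∀ j, Continuous fun x => X x j := fun j => (continuous_apply j).comp hc.1
  have cY : ∀ j, Continuous fun x => Y x j := fun j => (continuous_apply j).comp hc.2
  refine integral_mono_ae ?_ ?_ ?_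
  · refine (((Continuous.continuousOn ?_).integrableOn_compact
      (isBounded_box L).isCompact_closure).mono_set subset_closure)
    unfold dotProduct
    simp only [Pi.add_apply]
    fun_prop
  · have hmem := memLp_piLp_iff.1 (memLp_zetaF ha (isBounded_box L) hm
      (continuous_const.add hc.1 : Continuous fun x => p + X x)
      (continuous_const.add hc.2 : Continuous fun x => q + Y x))
    exact (integrable_finsetSum _ fun i _ => (hmem i).integrable_mul (hmem i)).const_mul _
  · filter_upwards [ae_restrict_of_ae ha.1] with x hx
    have := neg_dotProduct_le_zeta hx (p + X x) (q + Y x)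
    linarith

end Cube

/-! ### Measurability in the coefficient field -/

section Measurability

theorem measurable_generator (e e' : Fin d → ℝ) {φ : Space d → ℝ}
    (hφ : IsTestFunction Set.univ φ) :
    Measurable fun w : Coeff d => ∫ x, (e' ⬝ᵥ (w.field x *ᵥ e)) * φ x := by
  rw [measurable_iff_comap_le]
  exact le_iSup_of_le e (le_iSup_of_le e' (le_iSup_of_le φ (le_iSup_of_le hφ le_rfl)))

theorem measurable_coeff_of_generator {α : Type*} [MeasurableSpace α] {f : α → Coeff d}
    (h : ∀ (e e' : Fin d → ℝ) (φ : Space d → ℝ), IsTestFunction Set.univ φ →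
      Measurable fun x => ∫ y, (e' ⬝ᵥ ((f x).field y *ᵥ e)) * φ y) : Measurable f := by
  rw [measurable_iff_comap_le]
  change MeasurableSpace.comap f (⨆ (e : Fin d → ℝ) (e' : Fin d → ℝ) (φ : Space d → ℝ)
    (_ : IsTestFunction Set.univ φ), MeasurableSpace.comap
      (fun a : Coeff d => ∫ x, (e' ⬝ᵥ (a.field x *ᵥ e)) * φ x) (borel ℝ)) ≤ _
  simp only [MeasurableSpace.comap_iSup, MeasurableSpace.comap_comp]
  refine iSup_le fun e => iSup_le fun e' => iSup_le fun φ => iSup_le fun hφ => ?_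
  exact (h e e' φ hφ).comap_le

/-- A mollified entry at a point is one of the generating random variables, with test function y ↦
ρ(x - y). -/
theorem measurable_mollify_entry (n : ℕ) (i j : Fin d) (x : Space d) :
    Measurable fun w : Coeff d => mollify n (fun y => w.field y i j) x := by
  have hφ : IsTestFunction Set.univ fun y : Space d => (bumpSeq d n).normed volume (x - y) := by
    refine ⟨(ContDiffBump.contDiff_normed (n := ⊤) _).comp (by fun_prop), ?_, Set.subset_univ _⟩
    exact (ContDiffBump.hasCompactSupport_normed (μ := volume) (bumpSeq d n)).comp_homeomorph
      (Homeomorph.subLeft x)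
  convert measurable_generator (Pi.single j 1) (Pi.single i 1) hφ using 2 with w
  rw [mollify_apply]
  refine integral_congr_ae (Eventually.of_forall fun y => ?_)
  simp [mul_comm]

/-- A jointly measurable version of the coefficient field. -/
def fieldVersion (w : Coeff d) (x : Space d) : Mat d :=
  Matrix.of fun i j => limsup (fun n => mollify n (fun y => w.field y i j) x) atTop

/-- Each mollified entry is continuous in x and measurable in the coefficient field, hence jointly
measurable; the upper limit preserves this and is defined everywhere. Point values of the field
itself are not random variables. -/
theorem measurable_fieldVersion (i j : Fin d) :
    Measurable fun v : Coeff d × Space d => fieldVersion v.1 v.2 i j := by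
  refine Measurable.limsup fun n => ?_
  have := measurable_uncurry_of_continuous_of_measurable
    (u := fun (x : Space d) (w : Coeff d) => mollify n (fun y => w.field y i j) x)
    (fun w => (contDiff_mollify n (w.admissible.memLpLoc_entry i j).locallyIntegrable).continuous)
    (fun x => measurable_mollify_entry n i j x)
  exact this.comp measurable_swap

theorem fieldVersion_eq (w : Coeff d) : ∀ᵐ x, fieldVersion w x = w.field x := by
  have h : ∀ i j, ∀ᵐ x, Tendsto (fun n => mollify n (fun y => w.field y i j) x) atTop
      (𝓝 (w.field x i j)) := fun i j =>
    tendsto_mollify (w.admissible.memLpLoc_entry i j).locallyIntegrable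
  filter_upwards [ae_all_iff.2 fun i => ae_all_iff.2 fun j => h i j] with x hx
  ext i j
  exact (hx i j).limsup_eq

/-- `(q - Mᵗ p) · s⁻¹ (q - Mᵗ p)`. -/
def density (M : Mat d) (p q : Fin d → ℝ) : ℝ :=
  (q - Mᵀ *ᵥ p) ⬝ᵥ ((symPart M)⁻¹ *ᵥ (q - Mᵀ *ᵥ p))

theorem zeta_dotProduct_self {a : Space d → Mat d} {x : Space d} (hx : (symPart (a x)).PosDef)
    (p q : Fin d → ℝ) : zeta a p q x ⬝ᵥ zeta a p q x = density (a x) p q := by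
  have e0 : zeta a p q x = invSqrt (symPart (a x)) *ᵥ (q - (a x)ᵀ *ᵥ p) := by
    rw [zeta, fluxMat, rho, mulVec_sub, mulVec_mulVec]
  rw [e0, dotProduct_mulVec, ← mulVec_transpose, (invSqrt_isSymm _).eq, mulVec_mulVec,
    invSqrt_mul_self hx, dotProduct_comm, density]

theorem measurable_density {α : Type*} [MeasurableSpace α] {M : α → Mat d}
    {X Y : α → Fin d → ℝ} (hM : ∀ i j, Measurable fun v => M v i j)
    (hX : ∀ i, Measurable fun v => X v i) (hY : ∀ i, Measurable fun v => Y v i) :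
    Measurable fun v => density (M v) (X v) (Y v) := by
  have h1 : ∀ i, Measurable fun v => (Y v - (M v)ᵀ *ᵥ X v) i := fun i => by
    simp only [Pi.sub_apply, mulVec, dotProduct, transpose_apply]
    exact (hY i).sub (Finset.measurable_sum _ fun j _ => (hM j i).mul (hX j))
  have h2 : ∀ i j, Measurable fun v => (symPart (M v))⁻¹ i j := fun i j => by
    have h3 : Measurable fun v => (fun k l => symPart (M v) k l : Fin d → Fin d → ℝ) := by
      refine measurable_pi_lambda _ fun k => measurable_pi_lambda _ fun l => ?_
      simp only [symPart, Matrix.smul_apply, Matrix.add_apply, transpose_apply]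
      exact ((hM k l).add (hM l k)).const_smul (1 / 2 : ℝ)
    exact (measurable_inv_entry i j).comp h3
  unfold density
  simp only [dotProduct, mulVec]
  exact Finset.measurable_sum _ fun i _ => (h1 i).mul
    (Finset.measurable_sum _ fun j _ => (h2 i j).mul (h1 j))

/-- The energy is unchanged when the field is replaced by its jointly measurable version, and
integrals of jointly measurable functions are measurable in the parameter. -/
theorem measurable_pertEnergy (U : Set (Space d)) (p q : Fin d → ℝ) {X Y : Space d → Fin d → ℝ}
    (hX : Continuous X) (hY : Continuous Y) :
    Measurable fun w : Coeff d => pertEnergy w.field U p q X Y := by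
  have h : Measurable fun v : Coeff d × Space d =>
      density (fieldVersion v.1 v.2) (p + X v.2) (q + Y v.2) :=
    measurable_density measurable_fieldVersion
      (fun i => measurable_const.add (((measurable_pi_apply i).comp hX.measurable).comp
        measurable_snd))
      (fun i => measurable_const.add (((measurable_pi_apply i).comp hY.measurable).comp
        measurable_snd))
  have h2 := (StronglyMeasurable.integral_prod_right (ν := volume.restrict U)
    (f := fun (w : Coeff d) x => density (fieldVersion w x) (p + X x) (q + Y x))
    h.stronglyMeasurable).measurable
  convert h2 using 2 with w
  refine integral_congr_ae ?_
  filter_upwards [ae_restrict_of_ae w.admissible.1, ae_restrict_of_ae (fieldVersion_eq w)]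
    with x hx hx'
  rw [zeta_dotProduct_self hx, hx']

theorem measurable_integral_bulk (U : Set (Space d)) (p q : Fin d → ℝ) :
    Measurable fun w : Coeff d => ∫ x in U, bulk w.field p q x := by
  have h := (measurable_pertEnergy U p q (X := 0) (Y := 0) continuous_const
    continuous_const).const_mul (1 / 2)
  convert h using 2 with w
  rw [pertEnergy, ← integral_const_mul]
  simp [bulk]

theorem abs_zeta_le {a : Space d → Mat d} {p q : Fin d → ℝ} {R : ℝ} (hp : ‖p‖ ≤ R) (hq : ‖q‖ ≤ R)
    (x : Space d) (i : Fin d) :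
    |zeta a p q x i| ≤ R * ∑ j, (|rho a x i j| + |fluxMat a x i j|) := by
  have hp' : ∀ j, |p j| ≤ R := fun j => (norm_le_pi_norm p j).trans hp
  have hq' : ∀ j, |q j| ≤ R := fun j => (norm_le_pi_norm q j).trans hq
  simp only [zeta, Pi.sub_apply, mulVec, dotProduct]
  rw [← Finset.sum_sub_distrib, Finset.mul_sum]
  refine (Finset.abs_sum_le_sum_abs _ _).trans (Finset.sum_le_sum fun j _ => ?_)
  refine (abs_sub _ _).trans ?_
  rw [abs_mul, abs_mul]
  nlinarith [mul_le_mul_of_nonneg_left (hq' j) (abs_nonneg (rho a x i j)),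
    mul_le_mul_of_nonneg_left (hp' j) (abs_nonneg (fluxMat a x i j))]

/-- The energy of a perturbation is continuous for locally uniform convergence. -/
theorem continuous_pertEnergy {a : Space d → Mat d} (ha : IsAdmissible a) {U : Set (Space d)}
    (hU : Bornology.IsBounded U) (hUm : MeasurableSet U) (p q : Fin d → ℝ) :
    Continuous fun f : C(Space d, (Fin d → ℝ) × (Fin d → ℝ)) =>
      pertEnergy a U p q (fun x => (f x).1) (fun x => (f x).2) := by
  rw [continuous_iff_continuousAt]
  intro f
  obtain ⟨R, hR⟩ := hU.isCompact_closure.exists_bound_of_continuousOn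
    (f := fun x => ((p, q) + f x : (Fin d → ℝ) × (Fin d → ℝ))) (by fun_prop)
  have hunif := (ContinuousMap.tendsto_iff_forall_isCompact_tendstoUniformlyOn.1
    (tendsto_id (x := 𝓝 f))) _ hU.isCompact_closure
  -- Nearby functions differ from f by less than 1 on the closure of U; this is the 1 in the
  -- dominating factor R + 1.
  have hev := (Metric.tendstoUniformlyOn_iff.1 hunif) 1 one_pos
  refine tendsto_integral_filter_of_dominated_convergence
    (fun x => ∑ i, ((R + 1) * ∑ j, (|rho a x i j| + |fluxMat a x i j|)) *
      ((R + 1) * ∑ j, (|rho a x i j| + |fluxMat a x i j|))) ?_ ?_ ?_ ?_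
  · refine Eventually.of_forall fun g => ?_
    have hmem := memLp_piLp_iff.1 (memLp_zetaF ha hU hUm
      (X := fun x => p + (g x).1) (Y := fun x => q + (g x).2) (by fun_prop) (by fun_prop))
    exact (integrable_finsetSum (μ := volume.restrict U) _ fun i _ =>
      (hmem i).integrable_mul (hmem i)).aestronglyMeasurable
  · filter_upwards [hev] with g hg
    filter_upwards [ae_restrict_mem hUm] with x hx
    have h1 : ‖((p, q) + g x : (Fin d → ℝ) × (Fin d → ℝ))‖ ≤ R + 1 := by
      have e : ((p, q) + g x : (Fin d → ℝ) × (Fin d → ℝ)) = ((p, q) + f x) - (f x - g x) := by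
        abel
      rw [e]
      have h3 := hg x (subset_closure hx)
      rw [dist_eq_norm] at h3
      exact (norm_sub_le _ _).trans (add_le_add (hR x (subset_closure hx)) h3.le)
    have hp1 : ‖p + (g x).1‖ ≤ R + 1 := (norm_fst_le _).trans h1
    have hq1 : ‖q + (g x).2‖ ≤ R + 1 := (norm_snd_le _).trans h1
    refine (norm_sum_le _ _).trans (Finset.sum_le_sum fun i _ => ?_)
    rw [norm_mul]
    exact mul_self_le_mul_self (norm_nonneg _) (abs_zeta_le hp1 hq1 x i)
  · refine integrable_finsetSum _ fun i _ => ?_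
    have h1 : MemLp (fun x => (R + 1) * ∑ j, (|rho a x i j| + |fluxMat a x i j|)) 2
        (volume.restrict U) := (memLp_finsetSum _ fun j _ =>
      (((ha.memLpLoc_rho i j).restrict hU).abs).add
        (((ha.memLpLoc_fluxMat i j).restrict hU).abs)).const_mul _
    exact h1.integrable_mul h1
  · refine Eventually.of_forall fun x => ?_
    have : Continuous fun g : C(Space d, (Fin d → ℝ) × (Fin d → ℝ)) =>
        zeta a (p + (g x).1) (q + (g x).2) x ⬝ᵥ zeta a (p + (g x).1) (q + (g x).2) x := by
      simp only [zeta]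
      have h1 : Continuous fun g : C(Space d, (Fin d → ℝ) × (Fin d → ℝ)) => (g x).1 :=
        continuous_fst.comp (continuous_eval_const x)
      have h2 : Continuous fun g : C(Space d, (Fin d → ℝ) × (Fin d → ℝ)) => (g x).2 :=
        continuous_snd.comp (continuous_eval_const x)
      have h3 : Continuous fun g : C(Space d, (Fin d → ℝ) × (Fin d → ℝ)) =>
          rho a x *ᵥ (q + (g x).2) - fluxMat a x *ᵥ (p + (g x).1) :=
        ((continuous_const.matrix_mulVec (continuous_const.add h2))).sub
          (continuous_const.matrix_mulVec (continuous_const.add h1))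
      exact h3.dotProduct h3
    exact this.continuousAt

/-- By duality a sublevel set is a union over perturbations of measurable sets. Perturbations form a
separable set of continuous functions and the energy is continuous for locally uniform convergence,
so a countable dense family suffices. -/
theorem measurable_energySup_box {L : ℝ} (hL : 0 < L) (p q : Fin d → ℝ) :
    Measurable fun w : Coeff d => energySup w.field p q (box d L) := by
  let S : Set C(Space d, (Fin d → ℝ) × (Fin d → ℝ)) := {f |
    IsPerturbation (box d L) (fun x => (f x).1) (fun x => (f x).2)}
  have : Nonempty S := ⟨⟨0, IsPerturbation.zero _⟩⟩
  obtain ⟨u, hu⟩ := TopologicalSpace.exists_dense_seq S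
  refine measurable_of_Iio fun c => ?_
  have e : (fun w : Coeff d => energySup w.field p q (box d L)) ⁻¹' Set.Iio c
      = ⋃ n, {w : Coeff d | 1 / 2 * pertEnergy w.field (box d L) p q (fun x => ((u n).1 x).1)
        (fun x => ((u n).1 x).2) < c} := by
    ext w
    simp only [Set.mem_preimage, Set.mem_Iio, Set.mem_iUnion, Set.mem_ofPred_eq]
    constructor
    · intro h
      obtain ⟨X, Y, hP, hlt⟩ := exists_pertEnergy_lt w.admissible hL p q (sub_pos.2 h)
      rw [add_sub_cancel] at hlt
      have hc := hP.continuous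
      have hopen : IsOpen {f : S | 1 / 2 * pertEnergy w.field (box d L) p q
          (fun x => (f.1 x).1) (fun x => (f.1 x).2) < c} :=
        isOpen_lt (((continuous_pertEnergy w.admissible (isBounded_box L)
          (isOpen_box L).measurableSet p q).comp continuous_subtype_val).const_mul _)
          continuous_const
      obtain ⟨n, hn⟩ := hu.exists_mem_open hopen
        ⟨⟨⟨fun x => (X x, Y x), hc.1.prodMk hc.2⟩, hP⟩, hlt⟩
      exact ⟨n, hn⟩
    · rintro ⟨n, hn⟩
      exact (energySup_box_le_pertEnergy w.admissible hL p q (u n).2).trans_lt hn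
  rw [e]
  refine MeasurableSet.iUnion fun n => ?_
  exact measurableSet_lt ((measurable_pertEnergy _ p q (by fun_prop) (by fun_prop)).const_mul _)
    measurable_const

end Measurability

/-! ### Translations -/

section Translate

theorem Coeff.ext' {a b : Coeff d} (h : a.field = b.field) : a = b := by
  cases a; cases b; cases h; rfl

/-- The vector of `ℝ^d` with the given integer coordinates. -/
def intVec (z : Fin d → ℤ) : Space d := WithLp.toLp 2 fun i => (z i : ℝ)

theorem intVec_add (z w : Fin d → ℤ) : intVec (z + w) = intVec z + intVec w := by
  ext i; simp [intVec]

theorem translate_field (z : Fin d → ℤ) (a : Coeff d) (x : Space d) :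
    (translate z a).field x = a.field (x + intVec z) := rfl

theorem translate_translate (z w : Fin d → ℤ) (a : Coeff d) :
    translate z (translate w a) = translate (z + w) a :=
  Coeff.ext' <| funext fun x => by
    rw [translate_field, translate_field, translate_field, intVec_add, add_assoc]

theorem translate_zero (a : Coeff d) : translate 0 a = a :=
  Coeff.ext' <| funext fun x => by
    rw [translate_field]
    congr 1
    ext i; simp [intVec]

theorem measurable_translate (z : Fin d → ℤ) : Measurable (translate z : Coeff d → Coeff d) := by
  refine measurable_coeff_of_generator fun e e' φ hφ => ?_
  convert measurable_generator e e' (hφ.shift (-intVec z)) using 2 with w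
  rw [← integral_add_right_eq_self (fun x => (e' ⬝ᵥ (w.field x *ᵥ e)) * φ (x + -intVec z))
    (intVec z)]
  simp only [translate_field, add_neg_cancel_right]

theorem IsZdStationary.measurePreserving {P : Measure (Coeff d)} (h : IsZdStationary P)
    (z : Fin d → ℤ) : MeasurePreserving (translate z) P P :=
  ⟨measurable_translate z, by
    ext A hA
    rw [Measure.map_apply (measurable_translate z) hA, h z A hA]⟩

/-- Translations are invertible, so invariance under preimages gives invariance under images and the
intersection of all translates is the set itself. -/
theorem IsZdErgodic.of_preimage_eq {P : Measure (Coeff d)} (h : IsZdErgodic P)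
    {A : Set (Coeff d)} (hA : MeasurableSet A) (hinv : ∀ z, translate z ⁻¹' A = A) :
    P A = 0 ∨ P A = 1 := by
  refine h A hA ?_
  have e : ∀ z, translate z '' A = A := fun z => by
    ext a
    constructor
    · rintro ⟨b, hb, rfl⟩
      exact (Set.ext_iff.1 (hinv z) b).2 hb
    · intro ha
      refine ⟨translate (-z) a, (Set.ext_iff.1 (hinv (-z)) a).2 ha, ?_⟩
      rw [translate_translate, add_neg_cancel, translate_zero]
  simp only [e, Set.iInter_const]

theorem energySup_translate (a : Coeff d) (z : Fin d → ℤ) {U : Set (Space d)}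
    (hU : Bornology.IsBounded U) (p q : Fin d → ℝ) :
    energySup (translate z a).field p q ((fun x => x + intVec z) ⁻¹' U)
      = energySup a.field p q U :=
  energySup_comp_add a.admissible hU (intVec z) p q

end Translate

/-! ### First moments -/

section Moments

theorem cube_eq_box (d n : ℕ) : cube d n = box d (3 ^ n / 2) := rfl

theorem volume_box {L : ℝ} (hL : 0 ≤ L) : volume.real (box d L) = (2 * L) ^ d := by
  have e : box d L = (WithLp.ofLp : Space d → Fin d → ℝ) ⁻¹'
      Set.pi Set.univ fun _ => Set.Ioo (-L) L := by
    ext x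
    simp [box, abs_lt]
  rw [e, measureReal_def, (PiLp.volume_preserving_ofLp (Fin d)).measure_preimage
    (MeasurableSet.univ_pi fun _ => measurableSet_Ioo).nullMeasurableSet, Real.volume_pi_Ioo,
    Finset.prod_const, ENNReal.toReal_pow, ENNReal.toReal_ofReal (by linarith), Finset.card_univ,
    Fintype.card_fin]
  ring

theorem volume_cube (n : ℕ) : volume.real (cube d n) = ((3 : ℝ) ^ n) ^ d := by
  rw [cube_eq_box, volume_box (by positivity), mul_div_cancel₀ _ two_ne_zero]

theorem isBounded_cube (n : ℕ) : Bornology.IsBounded (cube d n) := isBounded_box _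

theorem isOpen_cube (n : ℕ) : IsOpen (cube d n) := isOpen_box _

theorem integral_dotProduct_mulVec {α : Type*} [MeasurableSpace α] {μ : Measure α}
    {M : α → Mat d} (hM : ∀ i j, Integrable (fun x => M x i j) μ) (v w : Fin d → ℝ) :
    Integrable (fun x => v ⬝ᵥ (M x *ᵥ w)) μ ∧
    ∫ x, v ⬝ᵥ (M x *ᵥ w) ∂μ = v ⬝ᵥ ((Matrix.of fun i j => ∫ x, M x i j ∂μ) *ᵥ w) := by
  have h1 : ∀ i, Integrable (fun x => ∑ j, M x i j * w j) μ := fun i =>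
    integrable_finsetSum _ fun j _ => (hM i j).mul_const _
  simp only [dotProduct, mulVec, of_apply]
  refine ⟨integrable_finsetSum _ fun i _ => (h1 i).const_mul _, ?_⟩
  rw [integral_finsetSum _ fun i _ => (h1 i).const_mul _]
  refine Finset.sum_congr rfl fun i _ => ?_
  rw [integral_const_mul, integral_finsetSum _ fun j _ => (hM i j).mul_const _]
  simp only [integral_mul_const]

theorem avgMat_cube_zero (M : Space d → Mat d) :
    avgMat (cube d 0) M = Matrix.of fun i j => ∫ x in cube d 0, M x i j := by
  ext i j
  rw [avgMat, of_apply, of_apply, setAverage_eq, volume_cube, pow_zero, one_pow, inv_one, one_smul]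

theorem zeta_zero_left_self {a : Space d → Mat d} {x : Space d} (hx : (symPart (a x)).PosDef)
    (q : Fin d → ℝ) : zeta a 0 q x ⬝ᵥ zeta a 0 q x = q ⬝ᵥ ((symPart (a x))⁻¹ *ᵥ q) := by
  rw [zeta_dotProduct_self hx, density, mulVec_zero, sub_zero]

theorem zeta_zero_right_self {a : Space d → Mat d} {x : Space d} (hx : (symPart (a x)).PosDef)
    (p : Fin d → ℝ) : zeta a p 0 x ⬝ᵥ zeta a p 0 x = p ⬝ᵥ (bMat (a x) *ᵥ p) := by
  rw [zeta, mulVec_zero, zero_sub, neg_dotProduct_neg, IsAdmissible.bMat_eq hx, ← mulVec_mulVec, fluxMat, rho,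
    dotProduct_mulVec p, vecMul_transpose]

theorem integral_bulk_zero_left {a : Space d → Mat d} (ha : IsAdmissible a) (q : Fin d → ℝ) :
    ∫ x in cube d 0, bulk a 0 q x
      = 1 / 2 * (q ⬝ᵥ (avgMat (cube d 0) (fun x => (symPart (a x))⁻¹) *ᵥ q)) := by
  rw [avgMat_cube_zero, ← (integral_dotProduct_mulVec (μ := volume.restrict (cube d 0))
    (fun i j => memLp_one_iff_integrable.1 ((ha.2.2.1 i j).restrict (isBounded_cube 0))) q q).2,
    ← integral_const_mul]
  refine integral_congr_ae ?_
  filter_upwards [ae_restrict_of_ae ha.1] with x hx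
  rw [bulk, zeta_zero_left_self hx]

theorem integral_bulk_zero_right {a : Space d → Mat d} (ha : IsAdmissible a) (p : Fin d → ℝ) :
    ∫ x in cube d 0, bulk a p 0 x
      = 1 / 2 * (p ⬝ᵥ (avgMat (cube d 0) (fun x => bMat (a x)) *ᵥ p)) := by
  rw [avgMat_cube_zero, ← (integral_dotProduct_mulVec (μ := volume.restrict (cube d 0))
    (fun i j => memLp_one_iff_integrable.1 ((ha.memLpLoc_bMat i j).restrict (isBounded_cube 0)))
      p p).2, ← integral_const_mul]
  refine integral_congr_ae ?_
  filter_upwards [ae_restrict_of_ae ha.1] with x hx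
  rw [bulk, zeta_zero_right_self hx]

theorem bulk_le_add (a : Space d → Mat d) (p q : Fin d → ℝ) (x : Space d) :
    bulk a p q x ≤ 2 * bulk a p 0 x + 2 * bulk a 0 q x := by
  have e : zeta a p q x = zeta a p 0 x + zeta a 0 q x := by rw [← zeta_add, add_zero, zero_add]
  have h : 0 ≤ (zeta a p 0 x - zeta a 0 q x) ⬝ᵥ (zeta a p 0 x - zeta a 0 q x) :=
    Finset.sum_nonneg fun i _ => mul_self_nonneg _
  rw [bulk, bulk, bulk, e]
  simp only [add_dotProduct, dotProduct_add, sub_dotProduct, dotProduct_sub] at h ⊢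
  linarith

variable {P : Measure (Coeff d)}

theorem HasFiniteMoments.integrable_bulk_zero_left (h : HasFiniteMoments P) (q : Fin d → ℝ) :
    Integrable (fun w : Coeff d => ∫ x in cube d 0, bulk w.field 0 q x) P := by
  simp only [integral_bulk_zero_left (Coeff.admissible _)]
  exact ((integral_dotProduct_mulVec h.1 q q).1).const_mul _

theorem HasFiniteMoments.integrable_bulk_zero_right (h : HasFiniteMoments P) (p : Fin d → ℝ) :
    Integrable (fun w : Coeff d => ∫ x in cube d 0, bulk w.field p 0 x) P := by
  simp only [integral_bulk_zero_right (Coeff.admissible _)]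
  exact ((integral_dotProduct_mulVec h.2 p p).1).const_mul _

theorem HasFiniteMoments.integrable_bulk (h : HasFiniteMoments P) (p q : Fin d → ℝ) :
    Integrable (fun w : Coeff d => ∫ x in cube d 0, bulk w.field p q x) P := by
  refine Integrable.mono' (((h.integrable_bulk_zero_right p).const_mul 2).add
    ((h.integrable_bulk_zero_left q).const_mul 2))
    (measurable_integral_bulk _ p q).aestronglyMeasurable (Eventually.of_forall fun w => ?_)
  have hb := isBounded_cube (d := d) 0
  rw [Real.norm_of_nonneg (integral_nonneg fun x => bulk_nonneg _ _ _ _), Pi.add_apply,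
    ← integral_const_mul, ← integral_const_mul, ← integral_add]
  · exact integral_mono (w.admissible.integrableOn_bulk p q hb)
      (((w.admissible.integrableOn_bulk p 0 hb).const_mul 2).add
        ((w.admissible.integrableOn_bulk 0 q hb).const_mul 2)) fun x => bulk_le_add _ _ _ _
  · exact (w.admissible.integrableOn_bulk p 0 hb).const_mul 2
  · exact (w.admissible.integrableOn_bulk 0 q hb).const_mul 2

end Moments

/-! ### Boxes of the integer lattice -/

section Boxes

/-- The integer points at sup-distance at most `r` from `z`. -/
def bx (z : Fin d → ℤ) (r : ℤ) : Finset (Fin d → ℤ) :=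
  Finset.Icc (fun i => z i - r) (fun i => z i + r)

theorem mem_bx {z w : Fin d → ℤ} {r : ℤ} : w ∈ bx z r ↔ ∀ i, |w i - z i| ≤ r := by
  simp only [bx, Finset.mem_Icc, Pi.le_def, ← forall_and, abs_le]
  exact forall_congr' fun i => by constructor <;> intro h <;> constructor <;> omega

/-- The radius of the box with `3^k` points on each side. -/
def rad (k : ℕ) : ℤ := (3 ^ k - 1) / 2

theorem two_mul_rad_add_one (k : ℕ) : 2 * rad k + 1 = 3 ^ k := by
  have h : (3 : ℤ) ^ k % 2 = 1 := by
    rw [← Int.odd_iff]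
    exact Odd.pow (by decide)
  unfold rad
  omega

theorem rad_nonneg (k : ℕ) : 0 ≤ rad k := by
  have := two_mul_rad_add_one k
  have h : (1 : ℤ) ≤ 3 ^ k := one_le_pow₀ (by norm_num)
  omega

theorem rad_mono {k l : ℕ} (h : k ≤ l) : rad k ≤ rad l := by
  have h1 := two_mul_rad_add_one k
  have h2 := two_mul_rad_add_one l
  have h3 : (3 : ℤ) ^ k ≤ 3 ^ l := pow_le_pow_right₀ (by norm_num) h
  omega

theorem rad_succ (k : ℕ) : rad (k + 1) = 3 * rad k + 1 := by
  have h1 := two_mul_rad_add_one k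
  have h3 := two_mul_rad_add_one (k + 1)
  rw [pow_succ] at h3
  omega

theorem card_bx (z : Fin d → ℤ) {r : ℤ} (hr : 0 ≤ r) :
    ((bx z r).card : ℝ) = (2 * (r : ℝ) + 1) ^ d := by
  rw [bx, Pi.card_Icc]
  simp only [Int.card_Icc]
  rw [Finset.prod_congr rfl (g := fun _ => (2 * r + 1).toNat) fun i _ => by congr 1; ring,
    Finset.prod_const, Finset.card_univ, Fintype.card_fin, Nat.cast_pow]
  congr 1
  have h : (((2 * r + 1).toNat : ℤ) : ℝ) = ((2 * r + 1 : ℤ) : ℝ) := by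
    rw [Int.toNat_of_nonneg (by omega)]
  push_cast at h
  exact h

theorem card_bx_rad (z : Fin d → ℤ) (k : ℕ) : ((bx z (rad k)).card : ℝ) = ((3 : ℝ) ^ k) ^ d := by
  rw [card_bx z (rad_nonneg k)]
  congr 1
  exact_mod_cast two_mul_rad_add_one k

theorem closedBall_int (z : Fin d → ℤ) {r : ℤ} (hr : 0 ≤ r) :
    Metric.closedBall z (r : ℝ) = (bx z r : Set (Fin d → ℤ)) := by
  ext w
  rw [Metric.mem_closedBall, dist_pi_le_iff (by exact_mod_cast hr), Finset.mem_coe, mem_bx]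
  refine forall_congr' fun i => ?_
  rw [Int.dist_eq]
  exact_mod_cast Iff.rfl

end Boxes

/-! ### Actions of the lattice and the maximal inequality -/

section Maximal

variable {Ω : Type*} {T : (Fin d → ℤ) → Ω → Ω}

/-- `H k (T z x)` is superadditive over disjoint boxes of radius `rad k` around `z`. -/
def IsSuperadditive (T : (Fin d → ℤ) → Ω → Ω) (H : ℕ → Ω → ℝ) : Prop :=
  ∀ (x : Ω) (K : ℕ) (s : Finset (Fin d → ℤ)) (k : (Fin d → ℤ) → ℕ),
    (s : Set (Fin d → ℤ)).PairwiseDisjoint (fun z => bx z (rad (k z))) →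
    (∀ z ∈ s, bx z (rad (k z)) ⊆ bx 0 (rad K)) → ∑ z ∈ s, H (k z) (T z x) ≤ H K x

-- Vitali covering on the lattice, with sup-norm balls. Each bad point carries a box on which H is
-- large; a disjoint subfamily, enlarged five times, covers all bad points, and superadditivity
-- bounds its total by H at scale M + 1. The next scale suffices because 2 rad M ≤ rad (M + 1).
open Classical in
theorem IsSuperadditive.card_le {H : ℕ → Ω → ℝ} (hH : IsSuperadditive T H) {c : ℝ} (hc : 0 ≤ c)
    (M : ℕ) (x : Ω) :
    c * ((bx 0 (rad M)).filter fun z => ∃ k ≤ M, c * ((3 : ℝ) ^ k) ^ d < H k (T z x)).card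
      ≤ 5 ^ d * H (M + 1) x := by
  set s := (bx 0 (rad M)).filter fun z => ∃ k ≤ M, c * ((3 : ℝ) ^ k) ^ d < H k (T z x)
    with hs
  have hk : ∀ z, ∃ k, z ∈ s → k ≤ M ∧ c * ((3 : ℝ) ^ k) ^ d < H k (T z x) := fun z => by
    by_cases hz : z ∈ s
    · obtain ⟨k, hk⟩ := (Finset.mem_filter.1 hz).2
      exact ⟨k, fun _ => hk⟩
    · exact ⟨0, fun h => absurd h hz⟩
  choose k hk using hk
  obtain ⟨u, hus, hdisj, hcov⟩ := Vitali.exists_disjoint_subfamily_covering_enlargement_closedBall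
    (s : Set (Fin d → ℤ)) id (fun z => (rad (k z) : ℝ)) (rad M)
    (fun z hz => by exact_mod_cast rad_mono (hk z hz).1) 5 (by norm_num)
  set v := s.filter (· ∈ u) with hv
  have hmem : ∀ z, z ∈ v → z ∈ u := fun z hz => (Finset.mem_filter.1 hz).2
  have hvs : ∀ z, z ∈ v → z ∈ s := fun z hz => (Finset.mem_filter.1 hz).1
  have hsub : s ⊆ v.biUnion fun b => bx b (5 * rad (k b)) := by
    intro z hz
    obtain ⟨b, hb, hzb⟩ := hcov z hz
    rw [Finset.mem_biUnion]
    refine ⟨b, Finset.mem_filter.2 ⟨hus hb, hb⟩, ?_⟩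
    have h1 : z ∈ Metric.closedBall (id z) (rad (k z) : ℝ) :=
      Metric.mem_closedBall_self (by exact_mod_cast rad_nonneg _)
    have h2 := hzb h1
    have e : (5 * (rad (k b) : ℝ)) = ((5 * rad (k b) : ℤ) : ℝ) := by push_cast; ring
    rw [e, id_eq, closedBall_int b (by have := rad_nonneg (k b); omega)] at h2
    exact h2
  have hcard : (s.card : ℝ) ≤ 5 ^ d * ∑ b ∈ v, ((3 : ℝ) ^ k b) ^ d := by
    have h1 : (s.card : ℝ) ≤ ∑ b ∈ v, ((bx b (5 * rad (k b))).card : ℝ) := by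
      exact_mod_cast (Finset.card_le_card hsub).trans Finset.card_biUnion_le
    refine h1.trans ?_
    rw [Finset.mul_sum]
    refine Finset.sum_le_sum fun b _ => ?_
    have hr := rad_nonneg (k b)
    rw [card_bx b (by omega), ← mul_pow]
    have h3 : (2 * (rad (k b) : ℝ) + 1) = 3 ^ k b := by exact_mod_cast two_mul_rad_add_one (k b)
    have h4 : (0 : ℝ) ≤ rad (k b) := by exact_mod_cast hr
    refine pow_le_pow_left₀ (by push_cast; linarith) ?_ d
    push_cast
    linarith
  have hsum : ∑ b ∈ v, c * ((3 : ℝ) ^ k b) ^ d ≤ H (M + 1) x := by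
    refine (Finset.sum_le_sum fun b hb => (hk b (hvs b hb)).2.le).trans (hH x (M + 1) v k ?_ ?_)
    · intro a ha b hb hab
      have h1 := hdisj (hmem a ha) (hmem b hb) hab
      simp only [Function.onFun, id_eq] at h1
      rw [closedBall_int a (rad_nonneg _), closedBall_int b (rad_nonneg _)] at h1
      exact Finset.disjoint_coe.1 h1
    · intro z hz w hw
      have h1 := (Finset.mem_filter.1 (hvs z hz)).1
      rw [mem_bx] at h1 hw ⊢
      have h2 := rad_mono (hk z (hvs z hz)).1
      have h3 := rad_succ M
      have h4 := rad_nonneg M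
      intro i
      have h5 := h1 i
      have h6 := hw i
      simp only [Pi.zero_apply, sub_zero] at h5 ⊢
      rw [abs_le] at h5 h6 ⊢
      omega
  calc c * (s.card : ℝ) ≤ c * (5 ^ d * ∑ b ∈ v, ((3 : ℝ) ^ k b) ^ d) :=
        mul_le_mul_of_nonneg_left hcard hc
    _ = 5 ^ d * ∑ b ∈ v, c * ((3 : ℝ) ^ k b) ^ d := by rw [← Finset.mul_sum]; ring
    _ ≤ _ := mul_le_mul_of_nonneg_left hsum (by positivity)

variable [MeasurableSpace Ω] {P : Measure Ω}

/-- A measure-preserving action of `ℤ^d`. -/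
structure IsAction (T : (Fin d → ℤ) → Ω → Ω) (P : Measure Ω) : Prop where
  zero : ∀ x, T 0 x = x
  add : ∀ z w x, T z (T w x) = T (z + w) x
  mp : ∀ z, MeasurePreserving (T z) P P

open Classical in
/-- The weak type maximal inequality for superadditive processes. -/
theorem IsSuperadditive.maximal_inequality [IsProbabilityMeasure P] (hT : IsAction T P)
    {H : ℕ → Ω → ℝ} (hH : IsSuperadditive T H) (hm : ∀ k, Measurable (H k))
    (hI : ∀ k, Integrable (H k) P) {γ : ℝ} (hE : ∀ k, ∫ x, H k x ∂P ≤ γ * ((3 : ℝ) ^ k) ^ d)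
    {c : ℝ} (hc : 0 < c) :
    P {x | ∃ k, c * ((3 : ℝ) ^ k) ^ d < H k x} ≤ ENNReal.ofReal (15 ^ d * γ / c) := by
  set A : ℕ → Set Ω := fun M => {x | ∃ k ≤ M, c * ((3 : ℝ) ^ k) ^ d < H k x} with hA
  have hAm : ∀ M, MeasurableSet (A M) := fun M => by
    have : A M = ⋃ k ∈ Set.Iic M, {x | c * ((3 : ℝ) ^ k) ^ d < H k x} := by
      ext x; simp [hA]
    rw [this]
    exact MeasurableSet.biUnion (Set.to_countable _) fun k _ =>
      measurableSet_lt measurable_const (hm k)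
  have hmono : Monotone A := fun M N h x ⟨k, hk, hx⟩ => ⟨k, hk.trans h, hx⟩
  have hU : {x | ∃ k, c * ((3 : ℝ) ^ k) ^ d < H k x} = ⋃ M, A M := by
    ext x
    simp only [hA, Set.mem_ofPred_eq, Set.mem_iUnion]
    exact ⟨fun ⟨k, hk⟩ => ⟨k, k, le_rfl, hk⟩, fun ⟨_, k, _, hk⟩ => ⟨k, hk⟩⟩
  rw [hU]
  refine le_of_tendsto' (tendsto_measure_iUnion_atTop hmono) fun M => ?_
  rw [Function.comp_apply]
  refine (ENNReal.le_ofReal_iff_toReal_le (measure_ne_top _ _) ?_).2 ?_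
  · have h0 := hE 0
    have : 0 ≤ H 0 := fun x => by
      -- Superadditivity for the empty family gives H 0 ≥ 0, hence γ ≥ 0.
      have := hH x 0 ∅ (fun _ => 0) (by simp) (by simp)
      simpa using this
    have h1 : 0 ≤ ∫ x, H 0 x ∂P := integral_nonneg this
    have : 0 ≤ γ := by simpa using h1.trans h0
    positivity
  · change P.real (A M) ≤ _
    -- By invariance of the measure, the expected number of bad points in the box is its cardinality
    -- times the probability of the bad event; this transfers the lattice inequality to Ω.
    have e : ∫ x, ∑ z ∈ bx (0 : Fin d → ℤ) (rad M), (A M).indicator (fun _ => (1 : ℝ)) (T z x) ∂P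
        = ((3 : ℝ) ^ M) ^ d * P.real (A M) := by
      rw [integral_finsetSum]
      · have : ∀ z, ∫ x, (A M).indicator (fun _ => (1 : ℝ)) (T z x) ∂P = P.real (A M) := fun z => by
          rw [← integral_map (φ := T z) (f := (A M).indicator (fun _ => (1 : ℝ)))
            (hT.mp z).measurable.aemeasurable, (hT.mp z).map_eq, integral_indicator (hAm M)]
          · simp
          · rw [(hT.mp z).map_eq]
            exact ((integrable_const (1 : ℝ)).indicator (hAm M)).aestronglyMeasurable
        simp only [this, Finset.sum_const, nsmul_eq_mul, card_bx_rad]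
      · exact fun z _ => (hT.mp z).integrable_comp_of_integrable
          ((integrable_const (1 : ℝ)).indicator (hAm M))
    have h2 : c * (((3 : ℝ) ^ M) ^ d * P.real (A M)) ≤ 5 ^ d * (γ * ((3 : ℝ) ^ (M + 1)) ^ d) := by
      rw [← e, ← integral_const_mul]
      refine le_trans (b := ∫ x, 5 ^ d * H (M + 1) x ∂P) ?_ ?_
      · refine integral_mono (Integrable.const_mul (integrable_finsetSum _ fun z _ =>
          (hT.mp z).integrable_comp_of_integrable
            ((integrable_const (1 : ℝ)).indicator (hAm M))) _) ((hI _).const_mul _) fun x => ?_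
        have h3 := hH.card_le hc.le M x
        rw [Finset.card_filter] at h3
        push_cast at h3
        refine le_of_eq_of_le ?_ h3
        refine congrArg _ (Finset.sum_congr rfl fun z _ => ?_)
        rw [Set.indicator_apply]
        rfl
      · rw [integral_const_mul]
        exact mul_le_mul_of_nonneg_left (hE _) (by positivity)
    rw [le_div_iff₀ hc]
    have h5 : (0 : ℝ) < ((3 : ℝ) ^ M) ^ d := by positivity
    have e2 : ((3 : ℝ) ^ (M + 1)) ^ d = 3 ^ d * ((3 : ℝ) ^ M) ^ d := by
      rw [pow_succ, mul_pow, mul_comm]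
    -- The factor 5^d comes from the Vitali enlargement and 3^d from passing to scale M + 1.
    have e3 : (15 : ℝ) ^ d = 5 ^ d * 3 ^ d := by rw [← mul_pow]; norm_num
    rw [e2] at h2
    rw [e3]
    refine le_of_mul_le_mul_left ?_ h5
    linarith

end Maximal

/-! ### Riemann sums over the lattice -/

section Rounding

/-- The integer point whose unit cell contains `y`. -/
def roundVec (y : Space d) : Fin d → ℤ := fun i => ⌊y i + 1 / 2⌋

theorem measurable_roundVec : Measurable (roundVec : Space d → Fin d → ℤ) :=
  measurable_pi_lambda _ fun i => Measurable.floor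
    (((measurable_pi_apply i).comp (PiLp.volume_preserving_ofLp (Fin d)).measurable).add_const _)

theorem abs_sub_roundVec_le (y : Space d) (i : Fin d) : |y i - roundVec y i| ≤ 1 / 2 := by
  have h1 := Int.floor_le (y i + 1 / 2)
  have h2 := Int.lt_floor_add_one (y i + 1 / 2)
  simp only [roundVec]
  rw [abs_le]
  constructor <;> linarith

theorem volume_roundVec_preimage (w : Fin d → ℤ) :
    (volume : Measure (Space d)).real (roundVec ⁻¹' {w}) = 1 := by
  have e : (roundVec : Space d → Fin d → ℤ) ⁻¹' {w} = (WithLp.ofLp : Space d → Fin d → ℝ) ⁻¹'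
      Set.pi Set.univ fun i => Set.Ico ((w i : ℝ) - 1 / 2) (w i + 1 / 2) := by
    ext y
    simp only [Set.mem_preimage, Set.mem_singleton_iff, funext_iff, roundVec, Int.floor_eq_iff,
      Set.mem_pi, Set.mem_univ, true_imp_iff, Set.mem_Ico]
    refine forall_congr' fun i => ?_
    constructor <;> rintro ⟨h1, h2⟩ <;> constructor <;> linarith
  rw [e, measureReal_def, (PiLp.volume_preserving_ofLp (Fin d)).measure_preimage
    (MeasurableSet.univ_pi fun _ => measurableSet_Ico).nullMeasurableSet, Real.volume_pi_Ico]
  simp only [add_sub_sub_cancel]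
  norm_num

theorem integral_comp_roundVec {g : (Fin d → ℤ) → ℝ} (hg : g.support.Finite) :
    ∫ y : Space d, g (roundVec y) = ∑' w, g w := by
  have hm : Measurable g := Measurable.of_discrete
  have hint : Integrable g ((volume : Measure (Space d)).map roundVec) := by
    rw [← integrableOn_iff_integrable_of_support_subset (s := g.support) subset_rfl,
      ← Set.biUnion_of_singleton g.support, integrableOn_finite_biUnion hg]
    refine fun w _ => integrableOn_singleton (hx := ?_)
    rw [Measure.map_apply measurable_roundVec (measurableSet_singleton w), lt_top_iff_ne_top]
    intro h
    have := volume_roundVec_preimage w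
    rw [measureReal_def, h] at this
    norm_num at this
  rw [← integral_map (f := g) measurable_roundVec.aemeasurable hm.aestronglyMeasurable,
    integral_countable hint]
  refine tsum_congr fun w => ?_
  rw [map_measureReal_apply measurable_roundVec (measurableSet_singleton w),
    volume_roundVec_preimage, one_smul]

end Rounding

/-! ### Weighted averages over the rescaled lattice -/

section LatticeAvg

variable {Ω : Type*} {T : (Fin d → ℤ) → Ω → Ω} {f g : Space d → ℝ} {R t : ℝ}

/-- The weighted average `t^{-d} ∑_w f(w / t) ψ(T_w x)`. -/
def latticeAvg (T : (Fin d → ℤ) → Ω → Ω) (t : ℝ) (f : Space d → ℝ) (ψ : Ω → ℝ) (x : Ω) : ℝ :=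
  (t ^ d)⁻¹ * ∑' w : Fin d → ℤ, f (t⁻¹ • intVec w) * ψ (T w x)

theorem abs_le_norm_intVec (w : Fin d → ℤ) (i : Fin d) : |(w i : ℝ)| ≤ ‖intVec w‖ :=
  abs_apply_le_norm (intVec w) i

theorem lattice_eq_zero (hf : ∀ y, f y ≠ 0 → ‖y‖ ≤ R) (ht : 0 < t) {k : ℕ}
    (hk : t * R < rad k + 1) {w : Fin d → ℤ} (hw : w ∉ bx 0 (rad k)) :
    f (t⁻¹ • intVec w) = 0 := by
  by_contra h
  refine hw (mem_bx.2 fun i => ?_)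
  have h1 := hf _ h
  rw [norm_smul, norm_inv, Real.norm_of_nonneg ht.le, inv_mul_le_iff₀ ht] at h1
  have h2 := ((abs_le_norm_intVec w i).trans h1).trans_lt hk
  rw [Pi.zero_apply, sub_zero]
  have h3 : |w i| < rad k + 1 := by exact_mod_cast h2
  omega

/-- The first triadic box containing the support dilated by t has side at most a constant times t,
so sums over it are comparable with t^d. -/
theorem exists_scale (hR : 0 ≤ R) (ht : 1 ≤ t) :
    ∃ k : ℕ, t * R < rad k + 1 ∧ (3 : ℝ) ^ k ≤ (6 * R + 3) * t := by
  obtain ⟨n, hn1, hn2⟩ := exists_nat_pow_near (x := 2 * (t * R) + 1) (y := 3)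
    (by nlinarith) (by norm_num)
  have h : (2 * (rad (n + 1) : ℝ) + 1) = 3 ^ (n + 1) := by
    exact_mod_cast two_mul_rad_add_one (n + 1)
  refine ⟨n + 1, by linarith, ?_⟩
  rw [pow_succ]
  nlinarith

theorem latticeAvg_eq_sum (hf : ∀ y, f y ≠ 0 → ‖y‖ ≤ R) (ht : 0 < t) {k : ℕ}
    (hk : t * R < rad k + 1) (ψ : Ω → ℝ) (x : Ω) :
    latticeAvg T t f ψ x
      = (t ^ d)⁻¹ * ∑ w ∈ bx 0 (rad k), f (t⁻¹ • intVec w) * ψ (T w x) := by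
  rw [latticeAvg, tsum_eq_sum fun w hw => by rw [lattice_eq_zero hf ht hk hw, zero_mul]]

/-- Maximal control over centred triadic boxes bounds the weighted averages simultaneously for all
real t ≥ 1, since the dilated support fits in a triadic box of comparable volume. -/
theorem abs_latticeAvg_le (hf : ∀ y, f y ≠ 0 → ‖y‖ ≤ R) (hR : 0 ≤ R) (ht : 1 ≤ t) {A c : ℝ}
    (hA : ∀ y, |f y| ≤ A) {ψ : Ω → ℝ} {x : Ω}
    (hψ : ∀ k : ℕ, ∑ w ∈ bx 0 (rad k), |ψ (T w x)| ≤ c * ((3 : ℝ) ^ k) ^ d) :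
    |latticeAvg T t f ψ x| ≤ A * (6 * R + 3) ^ d * c := by
  obtain ⟨k, hk1, hk2⟩ := exists_scale hR ht
  have ht0 : 0 < t := by linarith
  have hA0 : 0 ≤ A := (abs_nonneg _).trans (hA 0)
  have hc : 0 ≤ c := by
    have h0 := hψ 0
    have h1 : 0 ≤ ∑ w ∈ bx (d := d) 0 (rad 0), |ψ (T w x)| :=
      Finset.sum_nonneg fun _ _ => abs_nonneg _
    simpa using h1.trans h0
  rw [latticeAvg_eq_sum hf ht0 hk1, abs_mul, abs_of_pos (by positivity : 0 < (t ^ d)⁻¹),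
    inv_mul_le_iff₀ (by positivity)]
  calc |∑ w ∈ bx 0 (rad k), f (t⁻¹ • intVec w) * ψ (T w x)|
      ≤ ∑ w ∈ bx 0 (rad k), A * |ψ (T w x)| := by
        refine (Finset.abs_sum_le_sum_abs _ _).trans (Finset.sum_le_sum fun w _ => ?_)
        rw [abs_mul]
        exact mul_le_mul_of_nonneg_right (hA _) (abs_nonneg _)
    _ = A * ∑ w ∈ bx 0 (rad k), |ψ (T w x)| := by rw [Finset.mul_sum]
    _ ≤ A * (c * ((6 * R + 3) * t) ^ d) := by
        refine mul_le_mul_of_nonneg_left ((hψ k).trans ?_) hA0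
        gcongr
    _ = t ^ d * (A * (6 * R + 3) ^ d * c) := by rw [mul_pow]; ring

theorem latticeAvg_add (hf : ∀ y, f y ≠ 0 → ‖y‖ ≤ R) (hR : 0 ≤ R) (ht : 1 ≤ t) (ψ φ : Ω → ℝ)
    (x : Ω) : latticeAvg T t f (fun x => ψ x + φ x) x
      = latticeAvg T t f ψ x + latticeAvg T t f φ x := by
  obtain ⟨k, hk, -⟩ := exists_scale hR ht
  have ht0 : 0 < t := by linarith
  simp only [latticeAvg_eq_sum hf ht0 hk, ← mul_add, ← Finset.sum_add_distrib]

theorem latticeAvg_const_mul (c : ℝ) (ψ : Ω → ℝ)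
    (x : Ω) : latticeAvg T t f (fun x => c * ψ x) x = c * latticeAvg T t f ψ x := by
  simp only [latticeAvg, mul_left_comm _ c, tsum_mul_left]

theorem latticeAvg_sub_left (hf : ∀ y, f y ≠ 0 → ‖y‖ ≤ R) (hg : ∀ y, g y ≠ 0 → ‖y‖ ≤ R)
    (hR : 0 ≤ R) (ht : 1 ≤ t) (ψ : Ω → ℝ)
    (x : Ω) : latticeAvg T t (fun y => f y - g y) ψ x
      = latticeAvg T t f ψ x - latticeAvg T t g ψ x := by
  obtain ⟨k, hk, -⟩ := exists_scale hR ht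
  have ht0 : 0 < t := by linarith
  rw [latticeAvg_eq_sum hf ht0 hk, latticeAvg_eq_sum hg ht0 hk, latticeAvg_eq_sum (R := R) _ ht0 hk,
    ← mul_sub, ← Finset.sum_sub_distrib]
  · simp only [sub_mul]
  · intro y hy
    by_cases h : f y = 0
    · exact hg y fun h' => hy (by rw [h, h', sub_zero])
    · exact hf y h

theorem latticeAvg_mono (hf : ∀ y, f y ≠ 0 → ‖y‖ ≤ R) (hg : ∀ y, g y ≠ 0 → ‖y‖ ≤ R)
    (hR : 0 ≤ R) (ht : 1 ≤ t) {ψ : Ω → ℝ} (hψ : ∀ x, 0 ≤ ψ x) (h : ∀ y, f y ≤ g y) (x : Ω) :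
    latticeAvg T t f ψ x ≤ latticeAvg T t g ψ x := by
  obtain ⟨k, hk, -⟩ := exists_scale hR ht
  have ht0 : 0 < t := by linarith
  rw [latticeAvg_eq_sum hf ht0 hk, latticeAvg_eq_sum hg ht0 hk]
  refine mul_le_mul_of_nonneg_left (Finset.sum_le_sum fun w _ => ?_) (by positivity)
  exact mul_le_mul_of_nonneg_right (h _) (hψ _)

/-- Riemann sums over the rescaled lattice converge to the integral. -/
theorem tendsto_riemannSum (hf : Continuous f) (hfs : HasCompactSupport f) :
    Tendsto (fun t : ℝ => (t ^ d)⁻¹ * ∑' w : Fin d → ℤ, f (t⁻¹ • intVec w)) atTop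
      (𝓝 (∫ y, f y)) := by
  obtain ⟨C, hC⟩ := hfs.exists_bound_of_continuous hf
  obtain ⟨R, hR0, hR⟩ := hfs.isCompact.isBounded.subset_ball_lt 0 0
  have hsupp : ∀ y, f y ≠ 0 → ‖y‖ ≤ R := fun y hy => by
    have := hR (subset_tsupport f hy)
    rw [mem_ball_zero_iff] at this
    exact this.le
  have hdist : ∀ t : ℝ, 0 < t → ∀ y : Space d,
      ‖t⁻¹ • intVec (roundVec (t • y)) - y‖ ≤ t⁻¹ * d := fun t ht y => by
    refine norm_le_of_forall_abs_le fun i => ?_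
    have h1 := abs_sub_roundVec_le (t • y) i
    have e : (t⁻¹ • intVec (roundVec (t • y)) - y) i
        = -(t⁻¹ * ((t • y) i - roundVec (t • y) i)) := by
      simp only [intVec, PiLp.sub_apply, PiLp.smul_apply, smul_eq_mul]
      field_simp
      ring
    rw [e, abs_neg, abs_mul, abs_of_pos (inv_pos.2 ht)]
    have := inv_pos.2 ht
    nlinarith
  -- The Riemann sum is the exact integral of f evaluated at the rescaled nearest lattice point;
  -- dominated convergence then applies.
  have e : ∀ t : ℝ, 0 < t → (t ^ d)⁻¹ * ∑' w : Fin d → ℤ, f (t⁻¹ • intVec w)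
      = ∫ y, f (t⁻¹ • intVec (roundVec (t • y))) := fun t ht => by
    rw [Measure.integral_comp_smul volume (fun y => f (t⁻¹ • intVec (roundVec y))) t,
      integral_comp_roundVec (g := fun w => f (t⁻¹ • intVec w))]
    · rw [finrank_euclideanSpace_fin, abs_of_pos (by positivity), smul_eq_mul]
    · obtain ⟨k, hk⟩ := exists_nat_gt (t * R)
      refine (bx 0 (rad k)).finite_toSet.subset fun w hw => ?_
      by_contra h
      refine hw (lattice_eq_zero hsupp ht (k := k) (hk.trans_le ?_) h)
      have h1 : (2 * (rad k : ℝ) + 1) = 3 ^ k := by exact_mod_cast two_mul_rad_add_one k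
      -- Bernoulli's inequality gives rad k ≥ k, a crude but sufficient radius for finiteness of the
      -- support.
      have h2 : (1 + (k : ℝ) * 2) ≤ (1 + 2) ^ k := one_add_mul_le_pow (by norm_num) k |>.trans' (by ring_nf; rfl)
      norm_num at h2
      linarith
  rw [tendsto_congr' ((eventually_gt_atTop 0).mono e)]
  refine tendsto_integral_filter_of_dominated_convergence
    ((Metric.closedBall (0 : Space d) (R + d)).indicator fun _ => C) ?_ ?_ ?_ ?_
  · refine Eventually.of_forall fun t => Measurable.aestronglyMeasurable ?_
    have h1 : Measurable fun w : Fin d → ℤ => f (t⁻¹ • intVec w) := Measurable.of_discrete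
    exact h1.comp (measurable_roundVec.comp (measurable_const_smul t))
  · filter_upwards [eventually_ge_atTop 1] with t ht
    refine Eventually.of_forall fun y => ?_
    by_cases hy : f (t⁻¹ • intVec (roundVec (t • y))) = 0
    · rw [hy, norm_zero]
      exact Set.indicator_nonneg (fun _ _ => (norm_nonneg _).trans (hC 0)) y
    · rw [Set.indicator_of_mem]
      · exact hC _
      · rw [mem_closedBall_zero_iff]
        have h1 := hsupp _ hy
        have h2 := hdist t (by linarith) y
        rw [norm_sub_rev] at h2
        have h3 := norm_le_norm_add_norm_sub' y (t⁻¹ • intVec (roundVec (t • y)))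
        have h4 : t⁻¹ * d ≤ d := mul_le_of_le_one_left (by positivity) (inv_le_one_of_one_le₀ ht)
        linarith
  · exact (integrable_indicator_iff measurableSet_closedBall).2
      (integrableOn_const (isCompact_closedBall _ _).measure_lt_top.ne)
  · refine Eventually.of_forall fun y => (hf.tendsto y).comp ?_
    rw [tendsto_iff_norm_sub_tendsto_zero]
    refine squeeze_zero' (Eventually.of_forall fun _ => norm_nonneg _)
      ((eventually_gt_atTop 0).mono fun t ht => hdist t ht y) ?_
    simpa using (tendsto_inv_atTop_zero (𝕜 := ℝ)).mul_const (d : ℝ)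

end LatticeAvg

/-! ### The multiparameter ergodic theorem -/

section Ergodic

variable {Ω : Type*} [MeasurableSpace Ω] {T : (Fin d → ℤ) → Ω → Ω} {P : Measure Ω}
  [IsProbabilityMeasure P] {f : Space d → ℝ}

/-- Invariant events are trivial. -/
def IsErgodicAction (T : (Fin d → ℤ) → Ω → Ω) (P : Measure Ω) : Prop :=
  ∀ A : Set Ω, MeasurableSet A → (∀ z, T z ⁻¹' A = A) → P A = 0 ∨ P A = 1

theorem exists_supp_bound (hfs : HasCompactSupport f) : ∃ R, 0 ≤ R ∧ ∀ y, f y ≠ 0 → ‖y‖ ≤ R := by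
  obtain ⟨R, hR0, hR⟩ := hfs.isCompact.isBounded.subset_ball_lt 0 0
  refine ⟨R, hR0.le, fun y hy => ?_⟩
  have := hR (subset_tsupport f hy)
  rw [mem_ball_zero_iff] at this
  exact this.le

omit [IsProbabilityMeasure P] in
/-- Almost everywhere invariant events are trivial. -/
theorem IsErgodicAction.of_ae (hT : IsAction T P) (herg : IsErgodicAction T P) {A : Set Ω}
    (hA : MeasurableSet A) (hinv : ∀ z, ∀ᵐ x ∂P, T z x ∈ A ↔ x ∈ A) : P A = 0 ∨ P A = 1 := by
  -- The intersection of all preimages is strictly invariant and differs from A by a null set.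
  set B : Set Ω := ⋂ z, T z ⁻¹' A with hB
  have hBm : MeasurableSet B := MeasurableSet.iInter fun z => (hT.mp z).measurable hA
  have hBi : ∀ z, T z ⁻¹' B = B := fun z => by
    ext x
    simp only [hB, Set.mem_preimage, Set.mem_iInter, hT.add]
    constructor
    · intro h w
      simpa using h (w - z)
    · exact fun h w => h (w + z)
  have hAB : P A = P B := by
    refine measure_congr ?_
    filter_upwards [ae_all_iff.2 hinv] with x hx
    refine propext ?_
    change x ∈ A ↔ x ∈ B
    rw [hB, Set.mem_iInter]
    exact ⟨fun h z => (hx z).2 h, fun h => (hx 0).1 (h 0)⟩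
  rw [hAB]
  exact herg B hBm hBi

/-- Invariant functions with vanishing mean vanish. -/
theorem IsErgodicAction.eq_zero (hT : IsAction T P) (herg : IsErgodicAction T P) {F : Ω → ℝ}
    (hF : Integrable F P) (hinv : ∀ z, (fun x => F (T z x)) =ᵐ[P] F) (h0 : ∫ x, F x ∂P = 0) :
    F =ᵐ[P] 0 := by
  obtain ⟨F', hm, he⟩ := hF.aestronglyMeasurable
  have hF' : Integrable F' P := hF.congr he
  rw [integral_congr_ae he] at h0
  refine he.trans ?_
  have hinv' : ∀ z, ∀ᵐ x ∂P, F' (T z x) = F' x := fun z => by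
    filter_upwards [hinv z, he, (hT.mp z).quasiMeasurePreserving.ae he] with x h1 h2 h3
    rw [← h3, h1, h2]
  have hAm : MeasurableSet {x | 0 < F' x} := measurableSet_lt measurable_const hm.measurable
  -- The event that the function is positive is invariant up to null sets, so the function has a
  -- sign almost surely, and its zero mean makes it vanish.
  rcases herg.of_ae hT hAm fun z => (hinv' z).mono fun x hx => by
    simp only [Set.mem_ofPred_eq, hx] with h | h
  · have h1 : 0 ≤ᵐ[P] fun x => -F' x := by
      have : ∀ᵐ x ∂P, ¬ 0 < F' x := measure_eq_zero_iff_ae_notMem.1 h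
      filter_upwards [this] with x hx
      simpa using hx
    have h2 := (integral_eq_zero_iff_of_nonneg_ae h1 hF'.neg).1 (by rw [integral_neg, h0, neg_zero])
    filter_upwards [h2] with x hx
    simpa using hx
  · have h1 : 0 ≤ᵐ[P] F' := by
      have : ∀ᵐ x ∂P, 0 < F' x := (prob_compl_eq_zero_iff hAm).2 h
      exact this.mono fun x hx => hx.le
    exact (integral_eq_zero_iff_of_nonneg_ae h1 hF').1 h0

/-- Bounded functions whose rescaled averages converge almost surely. -/
structure IsErgodicFun (T : (Fin d → ℤ) → Ω → Ω) (P : Measure Ω) (f : Space d → ℝ)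
    (g : Ω → ℝ) : Prop where
  meas : Measurable g
  bdd : ∃ C, ∀ x, |g x| ≤ C
  tendsto : ∀ᵐ x ∂P, Tendsto (fun t => latticeAvg T t f g x) atTop
    (𝓝 ((∫ y, f y) * ∫ x, g x ∂P))

theorem IsErgodicFun.integrable {g : Ω → ℝ} (hg : IsErgodicFun T P f g) : Integrable g P := by
  obtain ⟨C, hC⟩ := hg.bdd
  exact Integrable.of_bound hg.meas.aestronglyMeasurable C (Eventually.of_forall hC)

theorem IsErgodicFun.memLp {g : Ω → ℝ} (hg : IsErgodicFun T P f g) : MemLp g 2 P := by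
  obtain ⟨C, hC⟩ := hg.bdd
  exact MemLp.of_bound hg.meas.aestronglyMeasurable C (Eventually.of_forall hC)

theorem IsErgodicFun.add (hfs : HasCompactSupport f) {g h : Ω → ℝ} (hg : IsErgodicFun T P f g)
    (hh : IsErgodicFun T P f h) : IsErgodicFun T P f (fun x => g x + h x) where
  meas := hg.meas.add hh.meas
  bdd := by
    obtain ⟨C, hC⟩ := hg.bdd
    obtain ⟨C', hC'⟩ := hh.bdd
    exact ⟨C + C', fun x => (abs_add_le _ _).trans (add_le_add (hC x) (hC' x))⟩
  tendsto := by
    obtain ⟨R, hR, hs⟩ := exists_supp_bound hfs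
    filter_upwards [hg.tendsto, hh.tendsto] with x h1 h2
    rw [integral_add hg.integrable hh.integrable, mul_add]
    refine (h1.add h2).congr' ?_
    filter_upwards [eventually_ge_atTop 1] with t ht
    rw [latticeAvg_add hs hR ht]

omit [IsProbabilityMeasure P] in
theorem IsErgodicFun.const_mul {g : Ω → ℝ} (hg : IsErgodicFun T P f g) (c : ℝ) :
    IsErgodicFun T P f (fun x => c * g x) where
  meas := hg.meas.const_mul c
  bdd := by
    obtain ⟨C, hC⟩ := hg.bdd
    exact ⟨|c| * C, fun x => by rw [abs_mul]; exact mul_le_mul_of_nonneg_left (hC x) (abs_nonneg c)⟩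
  tendsto := by
    filter_upwards [hg.tendsto] with x h1
    simp only [latticeAvg_const_mul, integral_const_mul, mul_left_comm _ c]
    exact h1.const_mul c

theorem IsErgodicFun.one (hf : Continuous f) (hfs : HasCompactSupport f) :
    IsErgodicFun T P f (fun _ => 1) where
  meas := measurable_const
  bdd := ⟨1, fun _ => by simp⟩
  tendsto := by
    refine Eventually.of_forall fun x => ?_
    simpa [latticeAvg] using tendsto_riemannSum hf hfs

/-- Bounded coboundaries average to zero. -/
theorem IsErgodicFun.coboundary (hT : IsAction T P) (hf : Continuous f)
    (hfs : HasCompactSupport f) {χ : Ω → ℝ} (hm : Measurable χ) {C : ℝ} (hC : ∀ x, |χ x| ≤ C)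
    (e : Fin d → ℤ) : IsErgodicFun T P f (fun x => χ x + -1 * χ (T e x)) where
  meas := hm.add ((hm.comp (hT.mp e).measurable).const_mul (-1))
  bdd := ⟨C + C, fun x => (abs_add_le _ _).trans (add_le_add (hC x) (by simpa using hC _))⟩
  tendsto := by
    obtain ⟨R, hR, hs⟩ := exists_supp_bound hfs
    have hi : Integrable χ P :=
      Integrable.of_bound hm.aestronglyMeasurable C (Eventually.of_forall hC)
    have e0 : ∫ x, (χ x + -1 * χ (T e x)) ∂P = 0 := by
      have h1 : ∫ x, χ (T e x) ∂P = ∫ x, χ x ∂P := by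
        rw [← integral_map (φ := T e) (f := χ) (hT.mp e).measurable.aemeasurable
          hm.aestronglyMeasurable, (hT.mp e).map_eq]
      have h2 : Integrable (fun x => χ (T e x)) P := (hT.mp e).integrable_comp_of_integrable hi
      rw [integral_add hi (h2.const_mul _), integral_const_mul, h1]
      ring
    rw [e0, mul_zero]
    refine Eventually.of_forall fun x => ?_
    have hC0 : 0 ≤ C := (abs_nonneg _).trans (hC x)
    -- Summation by parts moves the difference from χ onto the weight, giving f - f(· - e/t), which
    -- is uniformly small for large t by uniform continuity.
    have hshift : ∀ t : ℝ, 1 ≤ t → latticeAvg T t f (fun x => χ x + -1 * χ (T e x)) x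
        = latticeAvg T t (fun y => f y - f (y - t⁻¹ • intVec e)) χ x := fun t ht => by
      have ht0 : 0 < t := by linarith
      have hs2 : ∀ y, f (y - t⁻¹ • intVec e) ≠ 0 → ‖y‖ ≤ R + ‖intVec e‖ := fun y hy => by
        have h1 := hs _ hy
        have h2 := norm_le_norm_add_norm_sub' y (y - t⁻¹ • intVec e)
        rw [sub_sub_cancel, norm_smul, norm_inv, Real.norm_of_nonneg ht0.le] at h2
        have h3 : t⁻¹ * ‖intVec e‖ ≤ ‖intVec e‖ :=
          mul_le_of_le_one_left (norm_nonneg _) (inv_le_one_of_one_le₀ ht)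
        linarith
      have hs1 : ∀ y, f y ≠ 0 → ‖y‖ ≤ R + ‖intVec e‖ := fun y hy =>
        (hs y hy).trans (le_add_of_nonneg_right (norm_nonneg _))
      rw [latticeAvg_add hs hR ht, latticeAvg_const_mul,
        latticeAvg_sub_left hs1 hs2 (by positivity) ht]
      have e1 : latticeAvg T t f (fun x => χ (T e x)) x
          = latticeAvg T t (fun y => f (y - t⁻¹ • intVec e)) χ x := by
        simp only [latticeAvg, hT.add e]
        congr 1
        rw [← (Equiv.addRight e).tsum_eq fun w => f (t⁻¹ • intVec w - t⁻¹ • intVec e) * χ (T w x)]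
        refine tsum_congr fun w => ?_
        simp only [Equiv.coe_addRight, intVec_add, smul_add, add_sub_cancel_right, add_comm e w]
      rw [e1]
      ring
    have hunif := Metric.uniformContinuous_iff.1 (hfs.uniformContinuous_of_continuous hf)
    rw [Metric.tendsto_atTop]
    intro ε hε
    set B := (6 * (R + ‖intVec e‖) + 3) ^ d * C with hB
    have hB0 : 0 ≤ B := by positivity
    obtain ⟨δ, hδ, hδf⟩ := hunif (ε / (B + 1)) (by positivity)
    obtain ⟨t₀, ht₀⟩ := exists_nat_gt ((‖intVec e‖ + 1) / δ)
    refine ⟨max 1 t₀, fun t ht => ?_⟩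
    have ht1 : 1 ≤ t := (le_max_left _ _).trans ht
    have ht0 : 0 < t := by linarith
    have htt : (t₀ : ℝ) ≤ t := (le_max_right _ _).trans ht
    have hsmall : ‖t⁻¹ • intVec e‖ < δ := by
      rw [norm_smul, norm_inv, Real.norm_of_nonneg ht0.le, inv_mul_lt_iff₀ ht0]
      rw [div_lt_iff₀ hδ] at ht₀
      nlinarith [norm_nonneg (intVec e)]
    rw [hshift t ht1, dist_zero_right, Real.norm_eq_abs]
    have hb := abs_latticeAvg_le (T := T) (f := fun y => f y - f (y - t⁻¹ • intVec e)) (x := x)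
      (R := R + ‖intVec e‖) (t := t) (A := ε / (B + 1)) (c := C) (ψ := χ) ?_ (by positivity) ht1 ?_ ?_
    · refine hb.trans_lt ?_
      rw [mul_assoc, ← hB, div_mul_eq_mul_div, div_lt_iff₀ (by positivity)]
      nlinarith
    · intro y hy
      by_cases h : f y = 0
      · rw [h, zero_sub, neg_ne_zero] at hy
        have h1 := hs _ hy
        have h2 := norm_le_norm_add_norm_sub' y (y - t⁻¹ • intVec e)
        rw [sub_sub_cancel, norm_smul, norm_inv, Real.norm_of_nonneg ht0.le] at h2
        have h3 : t⁻¹ * ‖intVec e‖ ≤ ‖intVec e‖ :=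
          mul_le_of_le_one_left (norm_nonneg _) (inv_le_one_of_one_le₀ ht1)
        linarith
      · exact (hs y h).trans (le_add_of_nonneg_right (norm_nonneg _))
    · intro y
      have h1 := @hδf y (y - t⁻¹ • intVec e) (by rw [dist_eq_norm, sub_sub_cancel]; exact hsmall)
      rw [dist_eq_norm, Real.norm_eq_abs] at h1
      exact h1.le
    · intro k
      refine (Finset.sum_le_sum fun w _ => hC _).trans ?_
      rw [Finset.sum_const, nsmul_eq_mul, card_bx_rad, mul_comm]

/-- The classes of well-behaved functions in `L²`. -/
def ergodicSpace (T : (Fin d → ℤ) → Ω → Ω) (P : Measure Ω) [IsProbabilityMeasure P]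
    (hf : Continuous f) (hfs : HasCompactSupport f) : Submodule ℝ (Lp ℝ 2 P) where
  carrier := {F | ∃ g, IsErgodicFun T P f g ∧ F =ᵐ[P] g}
  zero_mem' := ⟨_, (IsErgodicFun.one hf hfs).const_mul 0, by
    filter_upwards [Lp.coeFn_zero ℝ 2 P] with x hx
    rw [hx]; simp⟩
  add_mem' := by
    rintro F G ⟨g, hg, hg'⟩ ⟨h, hh, hh'⟩
    refine ⟨_, hg.add hfs hh, ?_⟩
    filter_upwards [hg', hh', Lp.coeFn_add F G] with x h1 h2 h3
    rw [h3, Pi.add_apply, h1, h2]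
  smul_mem' := by
    rintro c F ⟨g, hg, hg'⟩
    refine ⟨_, hg.const_mul c, ?_⟩
    filter_upwards [hg', Lp.coeFn_smul c F] with x h1 h2
    rw [h2, Pi.smul_apply, h1, smul_eq_mul]

/-- Von Neumann's argument. An L² function orthogonal to all coboundaries of indicators is
invariant; being also orthogonal to constants, it has mean zero and vanishes by ergodicity. -/
theorem ergodicSpace_dense (hT : IsAction T P) (herg : IsErgodicAction T P) (hf : Continuous f)
    (hfs : HasCompactSupport f) : (ergodicSpace T P hf hfs).topologicalClosure = ⊤ := by
  rw [Submodule.topologicalClosure_eq_top_iff, Submodule.eq_bot_iff]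
  intro F hF
  rw [Submodule.mem_orthogonal] at hF
  have hFi : Integrable F P := (Lp.memLp F).integrable one_le_two
  have key : ∀ g, IsErgodicFun T P f g → ∫ x, g x * F x ∂P = 0 := fun g hg => by
    have h1 := hF hg.memLp.toLp ⟨g, hg, hg.memLp.coeFn_toLp⟩
    rw [L2.inner_def] at h1
    rw [← h1]
    refine integral_congr_ae ?_
    filter_upwards [hg.memLp.coeFn_toLp] with x hx
    rw [hx, RCLike.inner_apply, conj_trivial, mul_comm]
  have hinv : ∀ z, (fun x => F (T z x)) =ᵐ[P] F := fun z => by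
    have hFz : Integrable (fun x => F (T z x)) P := (hT.mp z).integrable_comp_of_integrable hFi
    refine Integrable.ae_eq_of_forall_setIntegral_eq _ _ hFz hFi fun B hB _ => ?_
    have hχ : Measurable (B.indicator fun _ => (1 : ℝ)) := measurable_const.indicator hB
    have hb : ∀ x, |B.indicator (fun _ => (1 : ℝ)) x| ≤ 1 := fun x => by
      by_cases hx : x ∈ B <;> simp [hx]
    have h1 := key _ (IsErgodicFun.coboundary hT hf hfs hχ hb (-z))
    have e1 : ∀ x, B.indicator (fun _ => (1 : ℝ)) x * F x = B.indicator (fun x => F x) x := fun x => by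
      by_cases hx : x ∈ B <;> simp [hx]
    have i1 : Integrable (fun x => B.indicator (fun x => F x) x) P := hFi.indicator hB
    have i2 : Integrable (fun x => B.indicator (fun _ => (1 : ℝ)) (T (-z) x) * F x) P := by
      refine Integrable.bdd_mul (c := 1) hFi
        (hχ.comp (hT.mp (-z)).measurable).aestronglyMeasurable (Eventually.of_forall fun x => hb _)
    have e2 : ∫ x, B.indicator (fun _ => (1 : ℝ)) (T (-z) x) * F x ∂P
        = ∫ x, B.indicator (fun x => F (T z x)) x ∂P := by
      have h3 : ∀ᵐ x ∂P, B.indicator (fun _ => (1 : ℝ)) (T (-z) x) * F x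
          = (B.indicator fun x => F (T z x)) (T (-z) x) := Eventually.of_forall fun x => by
        by_cases hx : T (-z) x ∈ B
        · simp [hx, hT.add, hT.zero]
        · simp [hx]
      rw [integral_congr_ae h3, ← integral_map (φ := T (-z)) (f := B.indicator fun x => F (T z x))
        (hT.mp (-z)).measurable.aemeasurable, (hT.mp (-z)).map_eq]
      rw [(hT.mp (-z)).map_eq]
      exact (hFz.indicator hB).aestronglyMeasurable
    have h4 : ∫ x, (B.indicator (fun _ => (1 : ℝ)) x
        + -1 * B.indicator (fun _ => (1 : ℝ)) (T (-z) x)) * F x ∂P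
        = ∫ x, (B.indicator (fun x => F x) x
          - B.indicator (fun _ => (1 : ℝ)) (T (-z) x) * F x) ∂P := by
      refine integral_congr_ae (Eventually.of_forall fun x => ?_)
      simp only [← e1]
      ring
    rw [h4, integral_sub i1 i2, e2, integral_indicator hB, integral_indicator hB] at h1
    linarith
  have h0 : ∫ x, F x ∂P = 0 := by simpa using key _ (IsErgodicFun.one hf hfs)
  have := herg.eq_zero hT hFi hinv h0
  exact Lp.ext (this.trans (Lp.coeFn_zero ℝ 2 P).symm)

/-- Approximation in two steps: a simple function close in L¹, then a good function close to it in
L². On a probability space the L² error controls the L¹ error. -/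
theorem exists_isErgodicFun_near (hT : IsAction T P) (herg : IsErgodicAction T P)
    (hf : Continuous f) (hfs : HasCompactSupport f) {ψ : Ω → ℝ} (hψ : Integrable ψ P) {ε : ℝ}
    (hε : 0 < ε) : ∃ g, IsErgodicFun T P f g ∧ ∫ x, |ψ x - g x| ∂P < ε := by
  obtain ⟨s, hs1, hs2⟩ := (memLp_one_iff_integrable.2 hψ).exists_simpleFunc_eLpNorm_sub_lt
    ENNReal.one_ne_top (ε := ENNReal.ofReal (ε / 2)) (by positivity)
  have hs : MemLp s 2 P := s.memLp_of_isFiniteMeasure 2 P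
  have hcl : hs.toLp ∈ (ergodicSpace T P hf hfs).topologicalClosure := by
    rw [ergodicSpace_dense hT herg]; trivial
  obtain ⟨F, ⟨g, hg, hFg⟩, hF⟩ := Metric.mem_closure_iff.1 hcl (ε / 2) (by positivity)
  refine ⟨g, hg, ?_⟩
  have h2 : eLpNorm (⇑s - g) 1 P < ENNReal.ofReal (ε / 2) := by
    refine (eLpNorm_le_eLpNorm_of_exponent_le one_le_two
      (hs.sub hg.memLp).aestronglyMeasurable).trans_lt ?_
    have e : (⇑s - g : Ω → ℝ) =ᵐ[P] hs.toLp - F := by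
      filter_upwards [hs.coeFn_toLp, hFg] with x h1 h2
      simp only [Pi.sub_apply]
      rw [h1, h2]
    rw [eLpNorm_congr_ae e, ← Lp.edist_def]
    rw [edist_dist]
    exact (ENNReal.ofReal_lt_ofReal_iff (by positivity)).2 hF
  have h3 : eLpNorm (ψ - g) 1 P < ENNReal.ofReal ε := by
    have e : (ψ - g : Ω → ℝ) = (ψ - ⇑s) + (⇑s - g) := by abel
    rw [e]
    refine (eLpNorm_add_le (hψ.aestronglyMeasurable.sub hs.aestronglyMeasurable)
      (hs.aestronglyMeasurable.sub hg.memLp.aestronglyMeasurable) le_rfl).trans_lt ?_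
    have : ENNReal.ofReal ε = ENNReal.ofReal (ε / 2) + ENNReal.ofReal (ε / 2) := by
      rw [← ENNReal.ofReal_add (by positivity) (by positivity), add_halves]
    rw [this]
    exact ENNReal.add_lt_add hs1 h2
  have h4 : Integrable (fun x => ψ x - g x) P := hψ.sub hg.integrable
  have h5 := integral_norm_eq_lintegral_enorm h4.aestronglyMeasurable
  simp only [Real.norm_eq_abs] at h5
  rw [h5]
  rw [eLpNorm_one_eq_lintegral_enorm] at h3
  simp only [Pi.sub_apply] at h3
  exact (ENNReal.ofReal_lt_ofReal_iff hε).1 (by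
    rw [ENNReal.ofReal_toReal (LT.lt.ne_top h3)]
    exact h3)

omit [IsProbabilityMeasure P] in
/-- Additive processes are superadditive. -/
theorem isSuperadditive_abs (hT : IsAction T P) (φ : Ω → ℝ) :
    IsSuperadditive T fun k x => ∑ w ∈ bx 0 (rad k), |φ (T w x)| := by
  classical
  intro x K s k hd hsub
  have e : ∀ z ∈ s, ∑ w ∈ bx 0 (rad (k z)), |φ (T w (T z x))|
      = ∑ w ∈ bx z (rad (k z)), |φ (T w x)| := fun z _ => by
    refine Finset.sum_nbij' (· + z) (· - z) ?_ ?_ ?_ ?_ ?_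
    · intro w hw; rw [mem_bx] at hw ⊢; simpa using hw
    · intro w hw; rw [mem_bx] at hw ⊢; simpa using hw
    · intro w _; simp
    · intro w _; simp
    · intro w _; rw [hT.add]
  rw [Finset.sum_congr rfl e, ← Finset.sum_biUnion hd]
  refine Finset.sum_le_sum_of_subset_of_nonneg (Finset.biUnion_subset.2 hsub)
    fun _ _ _ => abs_nonneg _

/-- Almost surely, lattice maximal functions of functions with small mean are small. -/
theorem ae_exists_maximal_le {T : ℕ → (Fin d → ℤ) → Ω → Ω}
    (hT : ∀ n, IsAction (T n) P) {H : ℕ → ℕ → Ω → ℝ} {γ : ℕ → ℝ}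
    (hH : ∀ n, IsSuperadditive (T n) (H n)) (hm : ∀ n k, Measurable (H n k))
    (hI : ∀ n k, Integrable (H n k) P)
    (hE : ∀ n k, ∫ x, H n k x ∂P ≤ γ n * ((3 : ℝ) ^ k) ^ d) (hγ : Tendsto γ atTop (𝓝 0)) :
    ∀ᵐ x ∂P, ∀ c : ℝ, 0 < c → ∀ n₀ : ℕ, ∃ n ≥ n₀, ∀ k, H n k x ≤ c * ((3 : ℝ) ^ k) ^ d := by
  have h1 : ∀ j n₀ : ℕ, ∀ᵐ x ∂P, ∃ n ≥ n₀, ∀ k, H n k x ≤ 1 / ((j : ℝ) + 1) * ((3 : ℝ) ^ k) ^ d := by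
    intro j n₀
    rw [ae_iff]
    have hlim : Tendsto (fun n => ENNReal.ofReal (15 ^ d * γ n / (1 / ((j : ℝ) + 1)))) atTop (𝓝 0) := by
      rw [← ENNReal.ofReal_zero]
      refine (ENNReal.continuous_ofReal.tendsto 0).comp ?_
      simpa using ((hγ.const_mul ((15 : ℝ) ^ d)).div_const (1 / ((j : ℝ) + 1)))
    -- Failure for all n ≥ n₀ implies failure for each single n, whose probability tends to 0. No
    -- summability is needed, at the price of obtaining only infinitely many good n.
    refine le_antisymm (ge_of_tendsto hlim ((eventually_ge_atTop n₀).mono fun n hn => ?_)) zero_le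
    refine le_trans (measure_mono ?_) ((hH n).maximal_inequality (hT n) (hm n) (hI n) (hE n)
      (by positivity : (0 : ℝ) < 1 / ((j : ℝ) + 1)))
    intro x hx
    simp only [Set.mem_ofPred_eq, not_exists, not_and, not_forall, not_le] at hx ⊢
    exact hx n hn
  filter_upwards [ae_all_iff.2 fun j => ae_all_iff.2 fun n₀ => h1 j n₀] with x hx
  intro c hc n₀
  obtain ⟨j, hj⟩ := exists_nat_one_div_lt hc
  obtain ⟨n, hn, hk⟩ := hx j n₀
  exact ⟨n, hn, fun k => (hk k).trans (mul_le_mul_of_nonneg_right hj.le (by positivity))⟩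

/-- The ergodic theorem for weighted averages over the lattice. -/
theorem ae_tendsto_latticeAvg (hT : IsAction T P) (herg : IsErgodicAction T P)
    (hf : Continuous f) (hfs : HasCompactSupport f) {ψ : Ω → ℝ} (hψm : Measurable ψ)
    (hψ : Integrable ψ P) :
    ∀ᵐ x ∂P, Tendsto (fun t => latticeAvg T t f ψ x) atTop (𝓝 ((∫ y, f y) * ∫ x, ψ x ∂P)) := by
  obtain ⟨R, hR, hs⟩ := exists_supp_bound hfs
  obtain ⟨A, hA⟩ := hfs.exists_bound_of_continuous hf
  simp only [Real.norm_eq_abs] at hA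
  have hA0 : 0 ≤ A := (abs_nonneg _).trans (hA 0)
  choose g hg hgψ using fun n : ℕ => exists_isErgodicFun_near hT herg hf hfs hψ
    (ε := 1 / ((n : ℝ) + 1)) (by positivity)
  have hφm : ∀ n, Measurable fun x => ψ x - g n x := fun n => hψm.sub (hg n).meas
  have hφi : ∀ n, Integrable (fun x => ψ x - g n x) P := fun n => hψ.sub (hg n).integrable
  have hTi : ∀ n (w : Fin d → ℤ), Integrable (fun x => |ψ (T w x) - g n (T w x)|) P := fun n w =>
    ((hT.mp w).integrable_comp_of_integrable (hφi n)).abs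
  have hmax := ae_exists_maximal_le (T := fun _ => T) (fun _ => hT)
    (H := fun n k x => ∑ w ∈ bx 0 (rad k), |ψ (T w x) - g n (T w x)|)
    (γ := fun n => 1 / ((n : ℝ) + 1)) (fun n => isSuperadditive_abs hT fun x => ψ x - g n x)
    (fun n k => Finset.measurable_sum _ fun w _ => ((hφm n).comp (hT.mp w).measurable).abs)
    (fun n k => integrable_finsetSum _ fun w _ => hTi n w)
    (fun n k => by
      rw [integral_finsetSum _ fun w _ => hTi n w]
      have e : ∀ w, ∫ x, |ψ (T w x) - g n (T w x)| ∂P = ∫ x, |ψ x - g n x| ∂P := fun w => by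
        rw [← integral_map (φ := T w) (f := fun x => |ψ x - g n x|) (hT.mp w).measurable.aemeasurable
          (hφm n).abs.aestronglyMeasurable, (hT.mp w).map_eq]
      simp only [e, Finset.sum_const, nsmul_eq_mul, card_bx_rad]
      rw [mul_comm]
      exact mul_le_mul_of_nonneg_right (hgψ n).le (by positivity))
    tendsto_one_div_add_atTop_nhds_zero_nat
  filter_upwards [hmax, ae_all_iff.2 fun n => (hg n).tendsto] with x hx hgx
  rw [Metric.tendsto_atTop]
  intro ε hε
  set B := A * (6 * R + 3) ^ d with hB
  have hB0 : 0 ≤ B := by positivity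
  set I := |∫ y, f y| with hI
  have hI0 : 0 ≤ I := abs_nonneg _
  -- With this c the errors B c and I c together stay below ε/3, the third error being below ε/3;
  -- the added 1 keeps the denominator positive.
  set c := ε / (3 * (B + I + 1)) with hc
  have hc0 : 0 < c := by positivity
  obtain ⟨n₀, hn₀⟩ := exists_nat_one_div_lt hc0
  obtain ⟨n, hn, hk⟩ := hx c hc0 n₀
  obtain ⟨t₀, ht₀⟩ := Metric.tendsto_atTop.1 (hgx n) (ε / 3) (by positivity)
  refine ⟨max 1 t₀, fun t ht => ?_⟩
  have ht1 : 1 ≤ t := (le_max_left _ _).trans ht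
  have h1 := ht₀ t ((le_max_right _ _).trans ht)
  rw [Real.dist_eq] at h1 ⊢
  have h2 := abs_latticeAvg_le (T := T) hs hR ht1 hA (ψ := fun x => ψ x - g n x) (x := x) (c := c) hk
  rw [← hB] at h2
  have h3 : latticeAvg T t f ψ x = latticeAvg T t f (fun x => ψ x - g n x) x
      + latticeAvg T t f (g n) x := by
    rw [← latticeAvg_add hs hR ht1]
    simp only [sub_add_cancel]
  have h4 : |(∫ x, ψ x ∂P) - ∫ x, g n x ∂P| ≤ c := by
    rw [← integral_sub hψ (hg n).integrable]
    refine (abs_integral_le_integral_abs).trans ((hgψ n).le.trans (le_trans ?_ hn₀.le))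
    have : (n₀ : ℝ) ≤ n := by exact_mod_cast hn
    gcongr
  have h5 : |(∫ y, f y) * ((∫ x, ψ x ∂P) - ∫ x, g n x ∂P)| ≤ I * c := by
    rw [abs_mul]
    exact mul_le_mul_of_nonneg_left h4 hI0
  have h6 : B * c + I * c < ε * (2 / 3) := by
    rw [← add_mul, hc, mul_div_assoc', div_lt_iff₀ (by positivity)]
    nlinarith
  rw [h3]
  -- Three errors: the average of ψ - g_n, controlled by the maximal inequality; the convergence for
  -- g_n; and the difference of the means of ψ and g_n.
  have e : latticeAvg T t f (fun x => ψ x - g n x) x + latticeAvg T t f (g n) x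
      - (∫ y, f y) * ∫ x, ψ x ∂P = latticeAvg T t f (fun x => ψ x - g n x) x
      + (latticeAvg T t f (g n) x - (∫ y, f y) * ∫ x, g n x ∂P)
      - (∫ y, f y) * ((∫ x, ψ x ∂P) - ∫ x, g n x ∂P) := by ring
  rw [e]
  refine (abs_sub _ _).trans_lt ?_
  have := abs_add_le (latticeAvg T t f (fun x => ψ x - g n x) x)
    (latticeAvg T t f (g n) x - (∫ y, f y) * ∫ x, g n x ∂P)
  linarith

end Ergodic

/-! ### Triadic cubes centered at integer points -/

section Cubes

/-- The triadic cube of size `3^n` centered at `w`. -/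
def cubeAt (w : Fin d → ℤ) (n : ℕ) : Set (Space d) := {x | ∀ i, |x i - w i| < (3 : ℝ) ^ n / 2}

theorem cubeAt_zero (n : ℕ) : cubeAt (0 : Fin d → ℤ) n = cube d n := by
  ext x; simp [cubeAt, cube]

theorem preimage_cubeAt (w z : Fin d → ℤ) (n : ℕ) :
    (fun x => x + intVec z) ⁻¹' cubeAt (w + z) n = cubeAt w n := by
  ext x
  simp only [cubeAt, Set.mem_preimage, Set.mem_ofPred_eq, intVec, PiLp.add_apply, Pi.add_apply,
    Int.cast_add, add_sub_add_right_eq_sub]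

theorem isOpen_cubeAt (w : Fin d → ℤ) (n : ℕ) : IsOpen (cubeAt w n) := by
  rw [← preimage_cubeAt w (-w) n, add_neg_cancel, cubeAt_zero]
  exact (isOpen_cube n).preimage (by fun_prop)

theorem norm_sub_le_of_mem_cubeAt {w : Fin d → ℤ} {n : ℕ} {x y : Space d} (hx : x ∈ cubeAt w n)
    (hy : y ∈ cubeAt w n) : ‖x - y‖ ≤ 3 ^ n * d := by
  refine norm_le_of_forall_abs_le fun i => ?_
  have h1 := hx i
  have h2 := hy i
  rw [PiLp.sub_apply]
  rw [abs_lt] at h1 h2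
  rw [abs_le]
  constructor <;> linarith

theorem intVec_mem_cubeAt (w : Fin d → ℤ) (n : ℕ) : intVec w ∈ cubeAt w n := fun i => by
  simp only [intVec, sub_self, abs_zero]
  positivity

theorem isBounded_cubeAt (w : Fin d → ℤ) (n : ℕ) : Bornology.IsBounded (cubeAt w n) := by
  refine (Metric.isBounded_iff_subset_closedBall (intVec w)).2 ⟨3 ^ n * d, fun x hx => ?_⟩
  rw [Metric.mem_closedBall, dist_eq_norm]
  exact norm_sub_le_of_mem_cubeAt hx (intVec_mem_cubeAt w n)

theorem energySup_cubeAt (a : Coeff d) (w z : Fin d → ℤ) (n : ℕ) (p q : Fin d → ℝ) :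
    energySup (translate z a).field p q (cubeAt w n) = energySup a.field p q (cubeAt (w + z) n) := by
  rw [← energySup_translate a z (isBounded_cubeAt _ _), preimage_cubeAt]

theorem integral_bulk_cubeAt (a : Coeff d) (w : Fin d → ℤ) (n : ℕ) (p q : Fin d → ℝ) :
    ∫ x in cubeAt w n, bulk a.field p q x
      = ∫ x in cube d n, bulk (translate w a).field p q x := by
  rw [← cubeAt_zero, ← preimage_cubeAt 0 w n, zero_add]
  exact (setIntegral_comp_add _ _ _).symm

/-- The union of the faces of all unit cells. -/
def gridSet (d : ℕ) : Set (Space d) := {x | ∃ (i : Fin d) (n : ℤ), x i = n + 1 / 2}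

theorem volume_gridSet : volume (gridSet d) = 0 := by
  have e : gridSet d = (WithLp.ofLp : Space d → Fin d → ℝ) ⁻¹'
      ⋃ (i : Fin d) (n : ℤ), {f | f i = n + 1 / 2} := by
    ext x
    simp [gridSet]
  have h0 : volume (⋃ (i : Fin d) (n : ℤ), {f : Fin d → ℝ | f i = n + 1 / 2}) = 0 := by
    refine measure_iUnion_null fun i => measure_iUnion_null fun n => ?_
    exact Measure.pi_hyperplane (fun _ => volume) i _
  rw [e, (PiLp.volume_preserving_ofLp (Fin d)).measure_preimage (NullMeasurableSet.of_null h0), h0]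

variable {m k k' : ℕ} {j y z z' : Fin d → ℤ} {x : Space d}

theorem pow_three_eq (m : ℕ) : (3 : ℝ) ^ m = 2 * rad m + 1 := by
  exact_mod_cast (two_mul_rad_add_one m).symm

theorem cast_add_smul (i : Fin d) :
    (((j + (3 ^ m : ℤ) • z) i : ℤ) : ℝ) = j i + 3 ^ m * z i := by
  simp

/-- Rounding to the nearest centre can fail to give a point of the open cube only on a face. Because
3^m is odd and the centres are integers, faces lie on half-integer hyperplanes, that is, in the null
set `gridSet`. -/
theorem exists_mem_cubeAt (m : ℕ) (j : Fin d → ℤ) (hx : x ∉ gridSet d) :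
    ∃ y : Fin d → ℤ, x ∈ cubeAt (j + (3 ^ m : ℤ) • y) m := by
  refine ⟨fun i => round ((x i - j i) / 3 ^ m), fun i => ?_⟩
  rw [cast_add_smul]
  have h1 := abs_sub_round ((x i - j i) / 3 ^ m)
  set y := round ((x i - j i) / 3 ^ m)
  have h3 : (0 : ℝ) < 3 ^ m := by positivity
  have h2 : |x i - (j i + 3 ^ m * (y : ℝ))| ≤ 3 ^ m / 2 := by
    have e : x i - (j i + 3 ^ m * (y : ℝ)) = 3 ^ m * ((x i - j i) / 3 ^ m - y) := by
      field_simp; ring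
    rw [e, abs_mul, abs_of_pos h3]
    nlinarith
  refine lt_of_le_of_ne h2 fun h => hx ?_
  rw [pow_three_eq] at h
  rcases (abs_eq (by rw [← pow_three_eq]; positivity)).1 h with h4 | h4
  · refine ⟨i, j i + 3 ^ m * y + rad m, ?_⟩
    push_cast
    rw [pow_three_eq]
    linarith
  · refine ⟨i, j i + 3 ^ m * y - rad m - 1, ?_⟩
    push_cast
    rw [pow_three_eq]
    linarith

theorem mem_bx_of_mem_cubeAt (h : x ∈ cubeAt (j + (3 ^ m : ℤ) • y) m)
    (h' : x ∈ cubeAt (j + (3 ^ m : ℤ) • z) (m + k)) : y ∈ bx z (rad k) := by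
  rw [mem_bx]
  intro i
  have h1 := h i
  have h2 := h' i
  rw [cast_add_smul, abs_lt] at h1 h2
  have h3 : (0 : ℝ) < 3 ^ m := by positivity
  rw [pow_add, pow_three_eq k] at h2
  have h4 : |(y i - z i : ℝ)| < rad k + 1 := by
    rw [abs_lt]
    constructor
    · refine lt_of_mul_lt_mul_left (a := (3 : ℝ) ^ m) ?_ h3.le
      nlinarith
    · refine lt_of_mul_lt_mul_left (a := (3 : ℝ) ^ m) ?_ h3.le
      nlinarith
  have h5 : |y i - z i| < rad k + 1 := by exact_mod_cast h4
  omega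

theorem cubeAt_subset (h : y ∈ bx z (rad k)) :
    cubeAt (j + (3 ^ m : ℤ) • y) m ⊆ cubeAt (j + (3 ^ m : ℤ) • z) (m + k) := by
  intro x hx i
  have h1 := hx i
  have h2 := mem_bx.1 h i
  have h5 : |(y i - z i : ℝ)| ≤ rad k := by exact_mod_cast h2
  rw [cast_add_smul, abs_lt] at h1 ⊢
  rw [abs_le] at h5
  rw [pow_add, pow_three_eq k]
  have h3 : (0 : ℝ) < 3 ^ m := by positivity
  constructor <;> nlinarith

/-- If the intervals overlapped in every coordinate, the point formed by the larger left endpoints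
would lie in both boxes. -/
theorem exists_lt_abs_of_disjoint_bx {r r' : ℤ} (hr : 0 ≤ r) (hr' : 0 ≤ r')
    (h : Disjoint (bx z r) (bx z' r')) : ∃ i, r + r' < |z i - z' i| := by
  by_contra! hc
  have hu : ∀ u, u ∈ bx z r → u ∉ bx z' r' := fun u h1 h2 => Finset.disjoint_left.1 h h1 h2
  refine hu (fun i => max (z i - r) (z' i - r')) ?_ ?_
  all_goals
    rw [mem_bx]
    intro i
    have := hc i
    rw [abs_le] at this ⊢
    rcases max_cases (z i - r) (z' i - r') with h | h <;> omega

theorem disjoint_cubeAt (h : Disjoint (bx z (rad k)) (bx z' (rad k'))) :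
    Disjoint (cubeAt (j + (3 ^ m : ℤ) • z) (m + k)) (cubeAt (j + (3 ^ m : ℤ) • z') (m + k')) := by
  obtain ⟨i, hi⟩ := exists_lt_abs_of_disjoint_bx (rad_nonneg k) (rad_nonneg k') h
  rw [Set.disjoint_left]
  intro x hx hx'
  have h1 := hx i
  have h2 := hx' i
  rw [cast_add_smul, abs_lt, pow_add, pow_three_eq k] at h1
  rw [cast_add_smul, abs_lt, pow_add, pow_three_eq k'] at h2
  have h3 : (0 : ℝ) < 3 ^ m := by positivity
  have h4 : (rad k + rad k' + 1 : ℝ) ≤ |(z i - z' i : ℝ)| := by exact_mod_cast hi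
  rcases abs_cases (z i - z' i : ℝ) with h5 | h5 <;> rw [h5.1] at h4 <;> nlinarith

theorem disjoint_cubeAt_of_ne (h : y ≠ z) :
    Disjoint (cubeAt (j + (3 ^ m : ℤ) • y) m) (cubeAt (j + (3 ^ m : ℤ) • z) m) := by
  refine disjoint_cubeAt (k := 0) (k' := 0) (Finset.disjoint_left.2 fun w h1 h2 => h ?_)
  have hr : rad 0 = 0 := by simp [rad]
  rw [mem_bx, hr] at h1 h2
  ext i
  have := h1 i
  have := h2 i
  rw [abs_le] at *
  omega

/-- The box `bx 0 (rad m)` is a complete system of residues modulo 3^m: here uniqueness, in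
`exists_add_smul_eq` existence. Summing over the shifts j of the grid of cubes of size 3^m thus
counts each integer centre exactly once. -/
theorem add_smul_injOn : Set.InjOn (fun v : (Fin d → ℤ) × (Fin d → ℤ) => v.1 + (3 ^ m : ℤ) • v.2)
    {v | v.1 ∈ bx 0 (rad m)} := by
  rintro ⟨j, y⟩ hj ⟨j', y'⟩ hj' h
  simp only [Set.mem_ofPred_eq, mem_bx, Pi.zero_apply, sub_zero] at hj hj'
  have h1 : ∀ i, j i = j' i ∧ y i = y' i := fun i => by
    have e : j i + 3 ^ m * y i = j' i + 3 ^ m * y' i := by simpa using congrFun h i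
    have a1 := hj i
    have a2 := hj' i
    have h3 := two_mul_rad_add_one m
    rw [abs_le] at a1 a2
    have hr := rad_nonneg m
    have hy : y i = y' i := by
      by_contra hne
      rcases lt_or_gt_of_ne hne with hlt | hlt
      · have : 3 ^ m * (y i + 1) ≤ 3 ^ m * y' i := mul_le_mul_of_nonneg_left hlt (by positivity)
        linarith
      · have : 3 ^ m * (y' i + 1) ≤ 3 ^ m * y i := mul_le_mul_of_nonneg_left hlt (by positivity)
        linarith
    rw [hy] at e
    exact ⟨by linarith, hy⟩
  ext i
  · exact (h1 i).1
  · exact (h1 i).2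

theorem exists_add_smul_eq (m : ℕ) (w : Fin d → ℤ) :
    ∃ j ∈ bx (0 : Fin d → ℤ) (rad m), ∃ y, j + (3 ^ m : ℤ) • y = w := by
  refine ⟨fun i => (w i + rad m) % 3 ^ m - rad m, ?_, fun i => (w i + rad m) / 3 ^ m, ?_⟩
  · rw [mem_bx]
    intro i
    have h1 := Int.emod_nonneg (w i + rad m) (b := 3 ^ m) (by positivity)
    have h2 := Int.emod_lt_of_pos (w i + rad m) (b := 3 ^ m) (by positivity)
    have h3 := two_mul_rad_add_one m
    simp only [Pi.zero_apply, sub_zero]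
    rw [abs_le]
    constructor <;> linarith
  · ext i
    have := Int.emod_add_mul_ediv (w i + rad m) (3 ^ m)
    simp only [Pi.add_apply, Pi.smul_apply, smul_eq_mul]
    linarith

end Cubes

/-! ### Subadditivity along triadic cubes -/

section Subadditive

variable {a : Space d → Mat d} {p q : Fin d → ℝ}

/-- The pieces need to cover U only off the grid hyperplanes and off a set L, since the hyperplanes
are null and `bulk` is nonnegative. -/
theorem energySup_le_sum_add_layer (ha : IsAdmissible a) {U : Set (Space d)} (hU : IsOpen U)
    (hUb : Bornology.IsBounded U) {κ : Type*} (s : Finset κ) (W : κ → Set (Space d))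
    (hW : ∀ i ∈ s, IsOpen (W i)) (hWU : ∀ i ∈ s, W i ⊆ U)
    (hd : (s : Set κ).PairwiseDisjoint W) {L : Set (Space d)} (hL : Bornology.IsBounded L)
    (hcov : ∀ x ∈ U, x ∉ gridSet d → (∃ i ∈ s, x ∈ W i) ∨ x ∈ L) :
    energySup a p q U ≤ ∑ i ∈ s, energySup a p q (W i) + ∫ x in L, bulk a p q x := by
  refine (energySup_le_sum ha hU hUb s W hW hWU hd p q).trans (add_le_add le_rfl ?_)
  refine setIntegral_mono_set (ha.integrableOn_bulk p q hL)
    (Eventually.of_forall fun x => bulk_nonneg a p q x) ?_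
  have h0 : ∀ᵐ x, x ∉ gridSet d := measure_eq_zero_iff_ae_notMem.1 volume_gridSet
  filter_upwards [h0] with x hx hxU
  rcases hcov x hxU.1 hx with h | h
  · obtain ⟨i, hi, hxi⟩ := h
    exact absurd (Set.mem_biUnion hi hxi) hxU.2
  · exact h

/-- Subadditivity over a partition of a box into boxes. -/
theorem energySup_le_partition (ha : IsAdmissible a) (m : ℕ) (j : Fin d → ℤ) {K : ℕ}
    (s : Finset (Fin d → ℤ)) (k : (Fin d → ℤ) → ℕ)
    (hd : (s : Set (Fin d → ℤ)).PairwiseDisjoint fun z => bx z (rad (k z)))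
    (hs : s.biUnion (fun z => bx z (rad (k z))) = bx 0 (rad K)) :
    energySup a p q (cubeAt j (m + K))
      ≤ ∑ z ∈ s, energySup a p q (cubeAt (j + (3 ^ m : ℤ) • z) (m + k z)) := by
  have e0 : cubeAt j (m + K) = cubeAt (j + (3 ^ m : ℤ) • (0 : Fin d → ℤ)) (m + K) := by
    rw [smul_zero, add_zero]
  have h := energySup_le_sum_add_layer (p := p) (q := q) ha (isOpen_cubeAt j (m + K)) (isBounded_cubeAt _ _) s
    (fun z => cubeAt (j + (3 ^ m : ℤ) • z) (m + k z)) (fun z _ => isOpen_cubeAt _ _)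
    (fun z hz => ?_) (fun z hz z' hz' hzz => disjoint_cubeAt (hd hz hz' hzz))
    (L := ∅) Bornology.isBounded_empty fun x hx hxg => ?_
  · simpa using h
  · have hsub : bx z (rad (k z)) ⊆ bx 0 (rad K) := by
      rw [← hs]; exact Finset.subset_biUnion_of_mem (fun z => bx z (rad (k z))) hz
    intro x hx i
    have h1 := hx i
    have h2 : |z i| + rad (k z) ≤ rad K := by
      have hr := rad_nonneg (k z)
      have a1 := mem_bx.1 (@hsub (fun i => z i + rad (k z)) (mem_bx.2 fun i => by
        rw [add_sub_cancel_left, abs_of_nonneg hr])) i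
      have a2 := mem_bx.1 (@hsub (fun i => z i - rad (k z)) (mem_bx.2 fun i => by
        rw [sub_sub_cancel_left, abs_neg, abs_of_nonneg hr])) i
      simp only [Pi.zero_apply, sub_zero] at a1 a2
      rw [abs_le] at a1 a2
      rcases abs_cases (z i) with h | h <;> omega
    have h3 : |(z i : ℝ)| + rad (k z) ≤ rad K := by exact_mod_cast h2
    rw [cast_add_smul, abs_lt, pow_add, pow_three_eq (k z)] at h1
    rw [abs_lt, pow_add, pow_three_eq K]
    have h4 : (0 : ℝ) < 3 ^ m := by positivity
    have h5 := abs_le.1 (le_refl |(z i : ℝ)|)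
    constructor <;> nlinarith
  · obtain ⟨y, hy⟩ := exists_mem_cubeAt m j hxg
    have h1 : y ∈ bx 0 (rad K) := mem_bx_of_mem_cubeAt hy (e0 ▸ hx)
    rw [← hs, Finset.mem_biUnion] at h1
    obtain ⟨z, hz, hyz⟩ := h1
    exact Or.inl ⟨z, hz, cubeAt_subset hyz hy⟩

theorem bx_rad_zero (z : Fin d → ℤ) : bx z (rad 0) = {z} := by
  ext w
  simp only [rad, pow_zero, sub_self, Int.zero_ediv, mem_bx, Finset.mem_singleton,
    abs_nonpos_iff, sub_eq_zero, funext_iff]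

theorem biUnion_singleton_boxes (K : ℕ) :
    (bx (0 : Fin d → ℤ) (rad K)).biUnion (fun z => bx z (rad 0)) = bx 0 (rad K) := by
  simp only [bx_rad_zero, Finset.biUnion_singleton_eq_self]

end Subadditive

/-! ### The defect of additivity along triadic cubes -/

section Gap

variable {p q : Fin d → ℝ}

/-- The defect of additivity between the scales `3^m` and `3^(m+k)`, summed over shifts. -/
def gap (p q : Fin d → ℝ) (m k : ℕ) (a : Coeff d) : ℝ :=
  ∑ j ∈ bx 0 (rad m), (∑ y ∈ bx 0 (rad k), energySup a.field p q (cubeAt (j + (3 ^ m : ℤ) • y) m)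
    - energySup a.field p q (cubeAt j (m + k)))

theorem gap_translate (m k : ℕ) (z : Fin d → ℤ) (a : Coeff d) :
    gap p q m k (translate ((3 ^ m : ℤ) • z) a) = ∑ j ∈ bx 0 (rad m),
      (∑ y ∈ bx z (rad k), energySup a.field p q (cubeAt (j + (3 ^ m : ℤ) • y) m)
        - energySup a.field p q (cubeAt (j + (3 ^ m : ℤ) • z) (m + k))) := by
  refine Finset.sum_congr rfl fun j _ => ?_
  rw [energySup_cubeAt]
  congr 1
  refine Finset.sum_nbij' (· + z) (· - z) ?_ ?_ ?_ ?_ ?_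
  · intro w hw; rw [mem_bx] at hw ⊢; simpa using hw
  · intro w hw; rw [mem_bx] at hw ⊢; simpa using hw
  · intro w _; simp
  · intro w _; simp
  · intro w _
    rw [energySup_cubeAt, smul_add, add_assoc]

/-- The gap of the large box minus those of the disjoint small boxes equals, for each shift, the
energies of the small boxes and of the uncovered cells minus the energy of the large cube. This is
nonnegative by subadditivity over that partition. -/
theorem isSuperadditive_gap (m : ℕ) :
    IsSuperadditive (fun (z : Fin d → ℤ) (a : Coeff d) => translate ((3 ^ m : ℤ) • z) a)
      (gap p q m) := by
  classical
  intro a K s k hd hsub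
  simp only [gap_translate]
  rw [Finset.sum_comm]
  refine Finset.sum_le_sum fun j _ => ?_
  set f : (Fin d → ℤ) → ℝ := fun y => energySup a.field p q (cubeAt (j + (3 ^ m : ℤ) • y) m) with hf
  set B := s.biUnion fun z => bx z (rad (k z)) with hB
  have hBs : B ⊆ bx 0 (rad K) := Finset.biUnion_subset.2 hsub
  set r := bx 0 (rad K) \ B with hr
  -- Uncovered lattice points become boxes of a single cell, which completes the family to a
  -- partition.
  set k' : (Fin d → ℤ) → ℕ := fun z => if z ∈ s then k z else 0 with hk'
  have hself : ∀ (z : Fin d → ℤ) n, z ∈ bx z (rad n) := fun z n =>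
    mem_bx.2 fun i => by rw [sub_self, abs_zero]; exact rad_nonneg n
  have hrs : ∀ z ∈ r, z ∉ s := fun z hz hzs => (Finset.mem_sdiff.1 hz).2
    (Finset.mem_biUnion.2 ⟨z, hzs, hself z _⟩)
  have hdisj : Disjoint s r := Finset.disjoint_left.2 fun z hz hz' => hrs z hz' hz
  have hk1 : ∀ z ∈ s, k' z = k z := fun z hz => if_pos hz
  have hk2 : ∀ z ∈ r, k' z = 0 := fun z hz => if_neg (hrs z hz)
  have hpart := energySup_le_partition (p := p) (q := q) a.admissible m j (K := K) (s ∪ r) k' ?_ ?_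
  · rw [Finset.sum_union hdisj, Finset.sum_congr rfl fun z hz => by rw [hk1 z hz],
      Finset.sum_congr (s₁ := r) rfl fun z hz => by rw [hk2 z hz, add_zero]] at hpart
    have e1 : ∑ y ∈ bx 0 (rad K), f y = ∑ y ∈ r, f y + ∑ z ∈ s, ∑ y ∈ bx z (rad (k z)), f y := by
      rw [← Finset.sum_sdiff hBs, hB, Finset.sum_biUnion hd]
    rw [Finset.sum_sub_distrib, e1]
    linarith
  · rintro z hz z' hz' hzz
    simp only [Function.onFun]
    rw [Finset.mem_coe, Finset.mem_union] at hz hz'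
    have hcross : ∀ u ∈ s, ∀ v ∈ r, Disjoint (bx u (rad (k' u))) (bx v (rad (k' v))) :=
      fun u hu v hv => by
        rw [hk1 u hu, hk2 v hv, bx_rad_zero, Finset.disjoint_singleton_right]
        exact fun h => (Finset.mem_sdiff.1 hv).2 (Finset.mem_biUnion.2 ⟨u, hu, h⟩)
    rcases hz with hz | hz <;> rcases hz' with hz' | hz'
    · rw [hk1 z hz, hk1 z' hz']
      exact hd hz hz' hzz
    · exact hcross z hz z' hz'
    · exact (hcross z' hz' z hz).symm
    · rw [hk2 z hz, hk2 z' hz', bx_rad_zero, bx_rad_zero, Finset.disjoint_singleton]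
      exact hzz
  · have e1 : s.biUnion (fun z => bx z (rad (k' z))) = B :=
      Finset.biUnion_congr rfl fun z hz => by rw [hk1 z hz]
    have e2 : r.biUnion (fun z => bx z (rad (k' z))) = r :=
      (Finset.biUnion_congr (t₂ := fun z => {z}) rfl fun z hz => by
        rw [hk2 z hz, bx_rad_zero z]).trans Finset.biUnion_singleton_eq_self
    rw [Finset.union_biUnion, e1, e2]
    exact Finset.union_sdiff_of_subset hBs

variable {P : Measure (Coeff d)}

theorem IsZdStationary.isAction (h : IsZdStationary P) (m : ℕ) :
    IsAction (fun (z : Fin d → ℤ) (a : Coeff d) => translate ((3 ^ m : ℤ) • z) a) P where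
  zero a := by rw [smul_zero, translate_zero]
  add z w a := by rw [translate_translate, smul_add]
  mp z := h.measurePreserving _

theorem IsZdStationary.isAction_translate (h : IsZdStationary P) :
    IsAction (translate : (Fin d → ℤ) → Coeff d → Coeff d) P where
  zero := translate_zero
  add := translate_translate
  mp := h.measurePreserving

theorem measurable_energySup_cube (n : ℕ) :
    Measurable fun a : Coeff d => energySup a.field p q (cube d n) :=
  measurable_energySup_box (by positivity) p q

theorem energySup_cubeAt_eq (a : Coeff d) (w : Fin d → ℤ) (n : ℕ) :
    energySup a.field p q (cubeAt w n) = energySup (translate w a).field p q (cube d n) := by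
  rw [← cubeAt_zero, energySup_cubeAt, zero_add]

theorem measurable_energySup_cubeAt (w : Fin d → ℤ) (n : ℕ) :
    Measurable fun a : Coeff d => energySup a.field p q (cubeAt w n) := by
  simp only [energySup_cubeAt_eq]
  exact (measurable_energySup_cube n).comp (measurable_translate w)

theorem energySup_cube_add_le (a : Coeff d) (m K : ℕ) : energySup a.field p q (cube d (m + K))
    ≤ ∑ y ∈ bx 0 (rad K), energySup a.field p q (cubeAt ((3 ^ m : ℤ) • y) m) := by
  have h := energySup_le_partition (p := p) (q := q) a.admissible m 0 (K := K) (bx 0 (rad K))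
    (fun _ => 0) (fun z _ z' _ hzz => ?_) (biUnion_singleton_boxes K)
  · simpa [cubeAt_zero] using h
  · simp only [Function.onFun, bx_rad_zero, Finset.disjoint_singleton]
    exact hzz

theorem IsZdStationary.integral_comp (h : IsZdStationary P) (w : Fin d → ℤ) {f : Coeff d → ℝ}
    (hf : Measurable f) : ∫ a, f (translate w a) ∂P = ∫ a, f a ∂P := by
  rw [← integral_map (φ := translate w) (f := f) (measurable_translate w).aemeasurable
    hf.aestronglyMeasurable, (h.measurePreserving w).map_eq]

theorem integrable_energySup_cube_zero (hmom : HasFiniteMoments P) :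
    Integrable (fun a : Coeff d => energySup a.field p q (cube d 0)) P := by
  refine (hmom.integrable_bulk p q).mono' (measurable_energySup_cube 0).aestronglyMeasurable
    (Eventually.of_forall fun a => ?_)
  rw [Real.norm_of_nonneg (energySup_nonneg _ _ _ _)]
  exact energySup_le_bulk a.admissible (isBounded_cube 0) p q

theorem integrable_energySup_cubeAt_aux (hstat : IsZdStationary P) {n : ℕ}
    (h : Integrable (fun a : Coeff d => energySup a.field p q (cube d n)) P) (w : Fin d → ℤ) :
    Integrable (fun a : Coeff d => energySup a.field p q (cubeAt w n)) P := by
  simp only [energySup_cubeAt_eq]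
  exact (hstat.measurePreserving w).integrable_comp_of_integrable h

theorem integrable_energySup_cube (hstat : IsZdStationary P) (hmom : HasFiniteMoments P) (n : ℕ) :
    Integrable (fun a : Coeff d => energySup a.field p q (cube d n)) P := by
  have h0 := fun w => integrable_energySup_cubeAt_aux (p := p) (q := q) hstat
    (integrable_energySup_cube_zero hmom) w
  refine (integrable_finsetSum (bx 0 (rad n)) fun y _ => h0 ((3 ^ 0 : ℤ) • y)).mono'
    (measurable_energySup_cube n).aestronglyMeasurable (Eventually.of_forall fun a => ?_)
  rw [Real.norm_of_nonneg (energySup_nonneg _ _ _ _)]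
  simpa using energySup_cube_add_le (p := p) (q := q) a 0 n

theorem integrable_energySup_cubeAt (hstat : IsZdStationary P) (hmom : HasFiniteMoments P)
    (w : Fin d → ℤ) (n : ℕ) :
    Integrable (fun a : Coeff d => energySup a.field p q (cubeAt w n)) P :=
  integrable_energySup_cubeAt_aux hstat (integrable_energySup_cube hstat hmom n) w

/-- The expected value of `J` on the cube of size `3^n`. -/
def meanEnergy (P : Measure (Coeff d)) (p q : Fin d → ℝ) (n : ℕ) : ℝ :=
  ∫ a, J a.field (cube d n) p q ∂P

theorem energySup_cube_eq (a : Space d → Mat d) (n : ℕ) :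
    energySup a p q (cube d n) = ((3 : ℝ) ^ n) ^ d * J a (cube d n) p q := by
  rw [energySup, volume_cube]

theorem integral_energySup_cube (n : ℕ) :
    ∫ a : Coeff d, energySup a.field p q (cube d n) ∂P = ((3 : ℝ) ^ n) ^ d * meanEnergy P p q n := by
  simp only [energySup_cube_eq, integral_const_mul, meanEnergy]

theorem integral_energySup_cubeAt (hstat : IsZdStationary P) (w : Fin d → ℤ) (n : ℕ) :
    ∫ a : Coeff d, energySup a.field p q (cubeAt w n) ∂P
      = ((3 : ℝ) ^ n) ^ d * meanEnergy P p q n := by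
  simp only [energySup_cubeAt_eq]
  rw [hstat.integral_comp w (measurable_energySup_cube n), integral_energySup_cube]

/-- Subadditivity over the 3^d subcubes, each having the same mean by stationarity. -/
theorem meanEnergy_antitone (hstat : IsZdStationary P) (hmom : HasFiniteMoments P) :
    Antitone (meanEnergy P p q) := by
  refine antitone_nat_of_succ_le fun m => ?_
  have h := integral_mono (integrable_energySup_cube (p := p) (q := q) hstat hmom (m + 1))
    (integrable_finsetSum _ fun y _ => integrable_energySup_cubeAt hstat hmom _ m)
    fun a => energySup_cube_add_le a m 1
  rw [integral_finsetSum _ fun y _ => integrable_energySup_cubeAt hstat hmom _ m] at h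
  simp only [integral_energySup_cubeAt hstat, integral_energySup_cube, Finset.sum_const,
    nsmul_eq_mul, card_bx_rad] at h
  rw [pow_add, mul_pow, mul_comm (((3 : ℝ) ^ m) ^ d), mul_assoc] at h
  exact le_of_mul_le_mul_left (le_of_mul_le_mul_left h (by positivity)) (by positivity)

theorem meanEnergy_nonneg (n : ℕ) : 0 ≤ meanEnergy P p q n :=
  integral_nonneg fun _ => J_nonneg _ _ _ _

theorem measurable_gap (m k : ℕ) : Measurable (gap (d := d) p q m k) :=
  Finset.measurable_sum _ fun _ _ => (Finset.measurable_sum _ fun _ _ =>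
    measurable_energySup_cubeAt _ _).sub (measurable_energySup_cubeAt _ _)

theorem integrable_gap (hstat : IsZdStationary P) (hmom : HasFiniteMoments P) (m k : ℕ) :
    Integrable (gap p q m k) P :=
  integrable_finsetSum _ fun _ _ => (integrable_finsetSum _ fun _ _ =>
    integrable_energySup_cubeAt hstat hmom _ _).sub (integrable_energySup_cubeAt hstat hmom _ _)

/-- There are 3^{md} shifts, each contributing the volume 3^{(m+k)d} of the large cube times the
drop in mean energy per unit volume. -/
theorem integral_gap (hstat : IsZdStationary P) (hmom : HasFiniteMoments P) (m k : ℕ) :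
    ∫ a, gap p q m k a ∂P = (((3 : ℝ) ^ m) ^ d * ((3 : ℝ) ^ m) ^ d * ((3 : ℝ) ^ k) ^ d)
      * (meanEnergy P p q m - meanEnergy P p q (m + k)) := by
  have i1 : ∀ j : Fin d → ℤ, Integrable (fun a : Coeff d => ∑ y ∈ bx 0 (rad k),
      energySup a.field p q (cubeAt (j + (3 ^ m : ℤ) • y) m)) P := fun j =>
    integrable_finsetSum _ fun _ _ => integrable_energySup_cubeAt hstat hmom _ _
  have i2 : ∀ j : Fin d → ℤ, Integrable (fun a : Coeff d =>
      energySup a.field p q (cubeAt j (m + k))) P := fun j =>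
    integrable_energySup_cubeAt hstat hmom _ _
  have i3 : ∀ j : Fin d → ℤ, Integrable (fun a : Coeff d => ∑ y ∈ bx 0 (rad k),
      energySup a.field p q (cubeAt (j + (3 ^ m : ℤ) • y) m)
        - energySup a.field p q (cubeAt j (m + k))) P := fun j => (i1 j).sub (i2 j)
  unfold gap
  rw [integral_finsetSum _ fun j _ => i3 j]
  have e : ∀ j : Fin d → ℤ, ∫ a : Coeff d, (∑ y ∈ bx 0 (rad k),
      energySup a.field p q (cubeAt (j + (3 ^ m : ℤ) • y) m)
        - energySup a.field p q (cubeAt j (m + k))) ∂P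
      = ((3 : ℝ) ^ k) ^ d * (((3 : ℝ) ^ m) ^ d * meanEnergy P p q m)
        - ((3 : ℝ) ^ (m + k)) ^ d * meanEnergy P p q (m + k) := fun j => by
    rw [integral_sub (i1 j) (i2 j), integral_finsetSum _ fun y _ =>
      integrable_energySup_cubeAt hstat hmom _ _]
    simp only [integral_energySup_cubeAt hstat, Finset.sum_const, nsmul_eq_mul, card_bx_rad]
  simp only [e, Finset.sum_const, nsmul_eq_mul, card_bx_rad]
  rw [pow_add, mul_pow]
  ring

/-- Almost surely, the defect of additivity is small uniformly in the larger scale, for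
infinitely many smaller scales. -/
theorem ae_exists_gap_le [IsProbabilityMeasure P] (hstat : IsZdStationary P)
    (hmom : HasFiniteMoments P) {e : ℝ} (he : Tendsto (meanEnergy P p q) atTop (𝓝 e)) :
    ∀ᵐ a ∂P, ∀ c : ℝ, 0 < c → ∀ m₀ : ℕ, ∃ m ≥ m₀, ∀ k,
      gap p q m k a ≤ c * (((3 : ℝ) ^ m) ^ d * ((3 : ℝ) ^ (m + k)) ^ d) := by
  -- The limit lies below every mean, so the mean density of the gap is at most meanEnergy at m
  -- minus e, uniformly in k. The maximal inequality is used for the action of 3^m ℤ^d and requires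
  -- no ergodicity of that subgroup.
  have hlow := (meanEnergy_antitone (p := p) (q := q) hstat hmom).le_of_tendsto he
  set N : ℕ → ℝ := fun m => ((3 : ℝ) ^ m) ^ d * ((3 : ℝ) ^ m) ^ d with hN
  have hNpos : ∀ m, 0 < N m := fun m => by positivity
  have h := ae_exists_maximal_le (fun m => hstat.isAction m)
    (H := fun m k a => (N m)⁻¹ * gap p q m k a) (γ := fun m => meanEnergy P p q m - e)
    (fun m a K s k hd hsub => by
      have := isSuperadditive_gap (p := p) (q := q) m a K s k hd hsub
      rw [← Finset.mul_sum]
      exact mul_le_mul_of_nonneg_left this (inv_pos.2 (hNpos m)).le)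
    (fun m k => (measurable_gap m k).const_mul _)
    (fun m k => (integrable_gap hstat hmom m k).const_mul _)
    (fun m k => by
      rw [integral_const_mul, integral_gap hstat hmom, ← mul_assoc, ← mul_assoc,
        inv_mul_cancel₀ (hNpos m).ne', one_mul, mul_comm]
      exact mul_le_mul_of_nonneg_right (sub_le_sub_left (hlow _) _) (by positivity))
    (by simpa using he.sub_const e)
  filter_upwards [h] with a ha
  intro c hc m₀
  obtain ⟨m, hm, hk⟩ := ha c hc m₀
  refine ⟨m, hm, fun k => ?_⟩
  have h1 := hk k
  rw [inv_mul_le_iff₀ (hNpos m)] at h1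
  refine h1.trans (le_of_eq ?_)
  rw [hN, pow_add, mul_pow]
  ring

end Gap

/-! ### Comparison of a domain with lattice sums -/

section Compare

variable {p q : Fin d → ℝ} {V : Set (Space d)} {m k : ℕ}

/-- Points at distance at most `ρ` from the boundary. -/
def layer (V : Set (Space d)) (ρ : ℝ) : Set (Space d) := {x | ∃ z ∈ frontier V, dist x z ≤ ρ}

theorem mem_layer {x y : Space d} {ρ : ℝ} (hx : x ∈ V) (hy : y ∉ V) (h : ‖x - y‖ ≤ ρ) :
    x ∈ layer V ρ := by
  obtain ⟨z, hz, he⟩ := exists_mem_frontier_infDist_compl_eq_dist hx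
    (fun h => hy (h ▸ Set.mem_univ y))
  refine ⟨z, hz, ?_⟩
  rw [← he]
  refine (Metric.infDist_le_dist_of_mem (show y ∈ Vᶜ from hy)).trans ?_
  rwa [dist_eq_norm]

theorem mem_layer' {x y : Space d} {ρ : ℝ} (hx : x ∉ V) (hy : y ∈ V) (h : ‖x - y‖ ≤ ρ) :
    x ∈ layer V ρ := by
  have := mem_layer (V := Vᶜ) hx (fun h' => h' hy) h
  rwa [layer, frontier_compl] at this

theorem isBounded_layer (hV : Bornology.IsBounded V) (ρ : ℝ) : Bornology.IsBounded (layer V ρ) := by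
  have h1 : Bornology.IsBounded (frontier V) := hV.closure.subset frontier_subset_closure
  refine (h1.cthickening (δ := ρ)).subset ?_
  rintro x ⟨z, hz, h⟩
  exact Metric.mem_cthickening_of_dist_le x z ρ _ hz h

-- For each shift, V is covered by the grid cells inside it and a boundary layer. Summing over
-- shifts, each cell centre occurs once and lies in V.
open Classical in
theorem energySup_le_sum_cells (a : Coeff d) (hV : IsOpen V) (hVb : Bornology.IsBounded V)
    (hVc : ∀ j ∈ bx (0 : Fin d → ℤ) (rad m), V ⊆ cubeAt j (m + k)) {S : Finset (Fin d → ℤ)}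
    (hS : ∀ w, intVec w ∈ V → w ∈ S) :
    ((3 : ℝ) ^ m) ^ d * energySup a.field p q V
      ≤ ∑ w ∈ S, energySup a.field p q (cubeAt w m)
        + ((3 : ℝ) ^ m) ^ d * ∫ x in layer V (3 ^ m * d), bulk a.field p q x := by
  have h1 : ∀ j ∈ bx (0 : Fin d → ℤ) (rad m), energySup a.field p q V
      ≤ ∑ y ∈ (bx 0 (rad k)).filter (fun y => cubeAt (j + (3 ^ m : ℤ) • y) m ⊆ V),
        energySup a.field p q (cubeAt (j + (3 ^ m : ℤ) • y) m)
        + ∫ x in layer V (3 ^ m * d), bulk a.field p q x := fun j hj => by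
    refine energySup_le_sum_add_layer a.admissible hV hVb _ _ (fun y _ => isOpen_cubeAt _ _)
      (fun y hy => (Finset.mem_filter.1 hy).2) (fun y _ z _ hyz => disjoint_cubeAt_of_ne hyz)
      (isBounded_layer hVb _) fun x hx hxg => ?_
    obtain ⟨y, hy⟩ := exists_mem_cubeAt m j hxg
    have hyk : y ∈ bx 0 (rad k) := mem_bx_of_mem_cubeAt hy (by simpa using hVc j hj hx)
    by_cases hsub : cubeAt (j + (3 ^ m : ℤ) • y) m ⊆ V
    · exact Or.inl ⟨y, Finset.mem_filter.2 ⟨hyk, hsub⟩, hy⟩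
    · obtain ⟨x', hx', hx'V⟩ := Set.not_subset.1 hsub
      exact Or.inr (mem_layer hx hx'V (norm_sub_le_of_mem_cubeAt hy hx'))
  have h2 := Finset.sum_le_sum h1
  rw [Finset.sum_const, nsmul_eq_mul, card_bx_rad, Finset.sum_add_distrib, Finset.sum_const,
    nsmul_eq_mul, card_bx_rad] at h2
  refine h2.trans (add_le_add ?_ le_rfl)
  simp only [Finset.sum_filter]
  rw [← Finset.sum_product', ← Finset.sum_filter]
  set D := (bx (0 : Fin d → ℤ) (rad m) ×ˢ bx 0 (rad k)).filter
    fun v => cubeAt (v.1 + (3 ^ m : ℤ) • v.2) m ⊆ V with hD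
  have hinj : Set.InjOn (fun v : (Fin d → ℤ) × (Fin d → ℤ) => v.1 + (3 ^ m : ℤ) • v.2) D :=
    add_smul_injOn.mono fun v hv => (Finset.mem_product.1 (Finset.mem_filter.1 hv).1).1
  rw [← Finset.sum_image (f := fun w => energySup a.field p q (cubeAt w m)) hinj]
  refine Finset.sum_le_sum_of_subset_of_nonneg ?_ fun _ _ _ => energySup_nonneg _ _ _ _
  intro w hw
  obtain ⟨v, hv, rfl⟩ := Finset.mem_image.1 hw
  exact hS _ ((Finset.mem_filter.1 hv).2 (intVec_mem_cubeAt _ _))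

-- Subadditivity is applied to a large cube containing V, split into V, the cells disjoint from V
-- and a boundary layer. The gap bounds how far the cell energies exceed that of the large cube;
-- cancelling the cells disjoint from V leaves a bound for those that meet V.
open Classical in
theorem sum_cells_le_energySup (a : Coeff d) (hV : IsOpen V) (hVb : Bornology.IsBounded V)
    (hVc : ∀ j ∈ bx (0 : Fin d → ℤ) (rad m), V ⊆ cubeAt j (m + k)) {S : Finset (Fin d → ℤ)}
    (hS : ∀ w ∈ S, intVec w ∈ V) :
    ∑ w ∈ S, energySup a.field p q (cubeAt w m)
      ≤ gap p q m k a + ((3 : ℝ) ^ m) ^ d * energySup a.field p q V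
        + ((3 : ℝ) ^ m) ^ d * ∫ x in layer V (3 ^ m * d), bulk a.field p q x := by
  set f : (Fin d → ℤ) → ℝ := fun w => energySup a.field p q (cubeAt w m) with hf
  have h1 : ∀ j ∈ bx (0 : Fin d → ℤ) (rad m), energySup a.field p q (cubeAt j (m + k))
      ≤ (energySup a.field p q V
        + ∑ y ∈ (bx 0 (rad k)).filter (fun y => Disjoint (cubeAt (j + (3 ^ m : ℤ) • y) m) V),
          f (j + (3 ^ m : ℤ) • y))
        + ∫ x in layer V (3 ^ m * d), bulk a.field p q x := fun j hj => by
    set Y := (bx 0 (rad k)).filter (fun y => Disjoint (cubeAt (j + (3 ^ m : ℤ) • y) m) V) with hY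
    have hYd : ∀ y ∈ Y, Disjoint (cubeAt (j + (3 ^ m : ℤ) • y) m) V := fun y hy =>
      (Finset.mem_filter.1 hy).2
    have key := energySup_le_sum_add_layer (p := p) (q := q) a.admissible (isOpen_cubeAt j (m + k))
      (isBounded_cubeAt _ _) (Finset.insertNone Y)
      (fun o => o.elim V fun y => cubeAt (j + (3 ^ m : ℤ) • y) m)
      (fun o _ => by cases o with
        | none => exact hV
        | some y => exact isOpen_cubeAt _ _)
      (fun o ho => by cases o with
        | none => exact hVc j hj
        | some y =>
          have hy := (Finset.mem_filter.1 (Finset.some_mem_insertNone.1 ho)).1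
          have := cubeAt_subset (m := m) (j := j) hy
          rwa [smul_zero, add_zero] at this)
      (fun o ho o' ho' hoo => by
        cases o with
        | none => cases o' with
          | none => exact absurd rfl hoo
          | some y => exact (hYd y (Finset.some_mem_insertNone.1 ho')).symm
        | some y => cases o' with
          | none => exact hYd y (Finset.some_mem_insertNone.1 ho)
          | some y' => exact disjoint_cubeAt_of_ne fun h => hoo (by rw [h]))
      (isBounded_layer hVb (3 ^ m * d)) fun x hx hxg => ?_
    · rw [Finset.sum_insertNone] at key
      exact key
    · obtain ⟨y, hy⟩ := exists_mem_cubeAt m j hxg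
      have hyk : y ∈ bx 0 (rad k) := mem_bx_of_mem_cubeAt hy (by simpa using hx)
      by_cases hxV : x ∈ V
      · exact Or.inl ⟨none, Finset.none_mem_insertNone, hxV⟩
      by_cases hdis : Disjoint (cubeAt (j + (3 ^ m : ℤ) • y) m) V
      · exact Or.inl ⟨some y, Finset.some_mem_insertNone.2 (Finset.mem_filter.2 ⟨hyk, hdis⟩), hy⟩
      · obtain ⟨x', hx', hx'V⟩ := Set.not_disjoint_iff.1 hdis
        exact Or.inr (mem_layer' hxV hx'V (norm_sub_le_of_mem_cubeAt hy hx'))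
  have h2 := Finset.sum_le_sum h1
  rw [Finset.sum_add_distrib, Finset.sum_add_distrib, Finset.sum_const, nsmul_eq_mul, card_bx_rad,
    Finset.sum_const, nsmul_eq_mul, card_bx_rad] at h2
  -- Each centre in V is j + 3^m y for exactly one admissible shift, and its cell meets V at the
  -- centre.
  have h3 : ∑ w ∈ S, f w ≤ ∑ j ∈ bx (0 : Fin d → ℤ) (rad m), ∑ y ∈ (bx 0 (rad k)).filter
      (fun y => ¬ Disjoint (cubeAt (j + (3 ^ m : ℤ) • y) m) V), f (j + (3 ^ m : ℤ) • y) := by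
    simp only [Finset.sum_filter]
    rw [← Finset.sum_product', ← Finset.sum_filter]
    set D := (bx (0 : Fin d → ℤ) (rad m) ×ˢ bx 0 (rad k)).filter
      fun v => ¬ Disjoint (cubeAt (v.1 + (3 ^ m : ℤ) • v.2) m) V with hD
    have hinj : Set.InjOn (fun v : (Fin d → ℤ) × (Fin d → ℤ) => v.1 + (3 ^ m : ℤ) • v.2) D :=
      add_smul_injOn.mono fun v hv => (Finset.mem_product.1 (Finset.mem_filter.1 hv).1).1
    rw [← Finset.sum_image (f := f) hinj]
    refine Finset.sum_le_sum_of_subset_of_nonneg ?_ fun _ _ _ => energySup_nonneg _ _ _ _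
    intro w hw
    obtain ⟨j, hj, y, rfl⟩ := exists_add_smul_eq m w
    refine Finset.mem_image.2 ⟨(j, y), Finset.mem_filter.2 ⟨Finset.mem_product.2 ⟨hj, ?_⟩, ?_⟩, rfl⟩
    · exact mem_bx_of_mem_cubeAt (intVec_mem_cubeAt _ _) (by simpa using hVc j hj (hS _ hw))
    · exact Set.not_disjoint_iff.2 ⟨_, intVec_mem_cubeAt _ _, hS _ hw⟩
  have h4 : gap p q m k a = ∑ j ∈ bx (0 : Fin d → ℤ) (rad m), ∑ y ∈ (bx 0 (rad k)).filter
      (fun y => Disjoint (cubeAt (j + (3 ^ m : ℤ) • y) m) V), f (j + (3 ^ m : ℤ) • y)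
      + ∑ j ∈ bx (0 : Fin d → ℤ) (rad m), ∑ y ∈ (bx 0 (rad k)).filter
      (fun y => ¬ Disjoint (cubeAt (j + (3 ^ m : ℤ) • y) m) V), f (j + (3 ^ m : ℤ) • y)
      - ∑ j ∈ bx (0 : Fin d → ℤ) (rad m), energySup a.field p q (cubeAt j (m + k)) := by
    rw [gap, Finset.sum_sub_distrib, ← Finset.sum_add_distrib]
    congr 1
    exact Finset.sum_congr rfl fun j _ => (Finset.sum_filter_add_sum_filter_not _ _ _).symm
  linarith

/-- The bulk energy of a bounded set is controlled by the unit cells meeting it. -/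
theorem integral_bulk_le_sum (a : Coeff d) {L : Set (Space d)} {S : Finset (Fin d → ℤ)}
    (hS : ∀ x ∈ L, ∀ w : Fin d → ℤ, x ∈ cubeAt w 0 → w ∈ S) :
    ∫ x in L, bulk a.field p q x
      ≤ ∑ w ∈ S, ∫ x in cube d 0, bulk (translate w a).field p q x := by
  simp only [← integral_bulk_cubeAt]
  rw [← integral_biUnion_finset S (fun w _ => (isOpen_cubeAt w 0).measurableSet)
    (fun w _ w' _ hw => by
      have := disjoint_cubeAt_of_ne (m := 0) (j := 0) hw
      simpa [Function.onFun] using this)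
    (fun w _ => a.admissible.integrableOn_bulk p q (isBounded_cubeAt w 0))]
  refine setIntegral_mono_set ?_ (Eventually.of_forall fun x => bulk_nonneg _ p q x) ?_
  · exact a.admissible.integrableOn_bulk p q
      ((Bornology.isBounded_biUnion_finset S).2 fun w _ => isBounded_cubeAt w 0)
  · have h0 : ∀ᵐ x, x ∉ gridSet d := measure_eq_zero_iff_ae_notMem.1 volume_gridSet
    filter_upwards [h0] with x hx hxL
    obtain ⟨y, hy⟩ := exists_mem_cubeAt 0 0 hx
    have hy' : x ∈ cubeAt y 0 := by simpa using hy
    exact Set.mem_biUnion (hS x hxL y hy') hy'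

end Compare

/-! ### The subadditive ergodic theorem -/

section SubadditiveErgodic

variable {p q : Fin d → ℝ} {U : Set (Space d)}

theorem frontier_smul_of_ne_zero {t : ℝ} (ht : t ≠ 0) (U : Set (Space d)) :
    frontier (t • U) = t • frontier U :=
  ((Homeomorph.smulOfNeZero t ht).image_frontier U).symm

open Classical in
/-- The rescaled energy of `tU` is close to the lattice average of the energies of cubes. -/
theorem abs_energySup_sub_latticeAvg_le (a : Coeff d) (hU : IsOpen U) {R : ℝ} (hR : 0 ≤ R)
    (hUR : ∀ x ∈ U, ‖x‖ ≤ R) {m : ℕ} {t : ℝ} (ht : 1 ≤ t) (htm : rad m + 1 ≤ t) {η : Space d → ℝ}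
    (hη0 : ∀ y, 0 ≤ η y) {R' : ℝ} (hR' : 0 ≤ R') (hηs : ∀ y, η y ≠ 0 → ‖y‖ ≤ R') {δ : ℝ}
    (hη1 : ∀ y, (∃ z ∈ frontier U, dist y z ≤ δ) → 1 ≤ η y) (hδ : (3 ^ m + 1) * d ≤ δ * t) {c : ℝ}
    (hc0 : 0 ≤ c)
    (hc : ∀ k, gap p q m k a ≤ c * (((3 : ℝ) ^ m) ^ d * ((3 : ℝ) ^ (m + k)) ^ d)) :
    |(t ^ d)⁻¹ * energySup a.field p q (t • U)
      - latticeAvg translate t (U.indicator fun _ => 1)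
        (fun a : Coeff d => J a.field (cube d m) p q) a|
      ≤ c * (6 * (R + 1) + 3) ^ d
        + latticeAvg translate t η (fun a : Coeff d => ∫ x in cube d 0, bulk a.field p q x) a := by
  have ht0 : 0 < t := by linarith
  have htd : 0 < t ^ d := by positivity
  -- The radius R + 1 instead of R leaves room for the shifts: since rad m + 1 ≤ t, the shifted
  -- cubes of this scale all contain tU, while their volume stays comparable to t^d.
  obtain ⟨n, hn1, hn2⟩ := exists_scale (R := R + 1) (t := t) (by linarith) ht
  obtain ⟨n', hn', -⟩ := exists_scale hR' ht
  have hmn : m ≤ n := by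
    by_contra! h
    have h1 : (rad n : ℝ) ≤ rad m := by exact_mod_cast rad_mono h.le
    nlinarith
  obtain ⟨k, rfl⟩ := Nat.exists_eq_add_of_le hmn
  have hVopen : IsOpen (t • U) := hU.smul₀ ht0.ne'
  have hVb : Bornology.IsBounded (t • U) := by
    refine (Metric.isBounded_iff_subset_closedBall 0).2 ⟨t * R, ?_⟩
    rintro _ ⟨x, hx, rfl⟩
    rw [mem_closedBall_zero_iff, norm_smul, Real.norm_of_nonneg ht0.le]
    exact mul_le_mul_of_nonneg_left (hUR x hx) ht0.le
  have hVc : ∀ j ∈ bx (0 : Fin d → ℤ) (rad m), t • U ⊆ cubeAt j (m + k) := by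
    rintro j hj _ ⟨x, hx, rfl⟩ i
    have h1 := mem_bx.1 hj i
    rw [Pi.zero_apply, sub_zero] at h1
    have h2 : |(j i : ℝ)| ≤ rad m := by exact_mod_cast h1
    have h3 := (abs_apply_le_norm x i).trans (hUR x hx)
    have h4 : |(t • x) i| ≤ t * R := by
      rw [PiLp.smul_apply, smul_eq_mul, abs_mul, abs_of_pos ht0]
      exact mul_le_mul_of_nonneg_left h3 ht0.le
    have h5 := abs_sub ((t • x) i) (j i : ℝ)
    rw [pow_three_eq]
    simp only at h5 ⊢
    linarith
  have hmemS : ∀ w : Fin d → ℤ, intVec w ∈ t • U ↔ t⁻¹ • intVec w ∈ U := fun w =>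
    Set.mem_smul_set_iff_inv_smul_mem₀ ht0.ne' _ _
  have hUs : ∀ y, U.indicator (fun _ => (1 : ℝ)) y ≠ 0 → ‖y‖ ≤ R + 1 := fun y hy => by
    have := hUR y (Set.mem_of_indicator_ne_zero hy)
    linarith
  set S := (bx (0 : Fin d → ℤ) (rad (m + k))).filter fun w => t⁻¹ • intVec w ∈ U with hS
  have hS1 : ∀ w, intVec w ∈ t • U → w ∈ S := fun w hw => by
    have hw' := (hmemS w).1 hw
    refine Finset.mem_filter.2 ⟨?_, hw'⟩
    by_contra h
    have := lattice_eq_zero hUs ht0 hn1 h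
    rw [Set.indicator_of_mem hw'] at this
    exact one_ne_zero this
  have hS2 : ∀ w ∈ S, intVec w ∈ t • U := fun w hw => (hmemS w).2 (Finset.mem_filter.1 hw).2
  set N : ℝ := ((3 : ℝ) ^ m) ^ d with hN
  have hN0 : 0 < N := by positivity
  have eS : ∑ w ∈ S, energySup a.field p q (cubeAt w m)
      = N * (t ^ d * latticeAvg translate t (U.indicator fun _ => 1)
        (fun a : Coeff d => J a.field (cube d m) p q) a) := by
    rw [latticeAvg_eq_sum hUs ht0 hn1, mul_inv_cancel_left₀ htd.ne', Finset.sum_filter,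
      Finset.mul_sum]
    refine Finset.sum_congr rfl fun w _ => ?_
    rw [energySup_cubeAt_eq, energySup_cube_eq, Set.indicator_apply]
    split_ifs <;> simp [hN]
  have hL : ∫ x in layer (t • U) (3 ^ m * d), bulk a.field p q x
      ≤ t ^ d * latticeAvg translate t η
        (fun a : Coeff d => ∫ x in cube d 0, bulk a.field p q x) a := by
    set S' := (bx (0 : Fin d → ℤ) (rad n')).filter
      fun w => ∃ z ∈ frontier U, dist (t⁻¹ • intVec w) z ≤ δ with hS'
    refine (integral_bulk_le_sum a (S := S') ?_).trans ?_
    · rintro x ⟨_, hz, hxz⟩ w hxw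
      rw [frontier_smul_of_ne_zero ht0.ne'] at hz
      obtain ⟨z, hz, rfl⟩ := hz
      have h1 : dist (t⁻¹ • intVec w) z ≤ δ := by
        have h2 := norm_sub_le_of_mem_cubeAt (intVec_mem_cubeAt w 0) hxw
        -- The layer has width 3^m d, and a point of a unit cell is within d of its centre.
        have h3 : ‖intVec w - t • z‖ ≤ (3 ^ m + 1) * d := by
          rw [dist_eq_norm] at hxz
          have := norm_sub_le_norm_sub_add_norm_sub (intVec w) x (t • z)
          simp only [pow_zero] at h2 hxz
          linarith
        have e : t⁻¹ • intVec w - z = t⁻¹ • (intVec w - t • z) := by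
          rw [smul_sub, inv_smul_smul₀ ht0.ne']
        rw [dist_eq_norm, e, norm_smul, norm_inv, Real.norm_of_nonneg ht0.le, inv_mul_le_iff₀ ht0,
          mul_comm]
        exact h3.trans hδ
      have h4 := hη1 _ ⟨z, hz, h1⟩
      refine Finset.mem_filter.2 ⟨?_, z, hz, h1⟩
      by_contra h
      rw [lattice_eq_zero hηs ht0 hn' h] at h4
      norm_num at h4
    · rw [latticeAvg_eq_sum hηs ht0 hn', mul_inv_cancel_left₀ htd.ne', Finset.sum_filter]
      refine Finset.sum_le_sum fun w _ => ?_
      have h0 : 0 ≤ ∫ x in cube d 0, bulk (translate w a).field p q x :=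
        integral_nonneg fun x => bulk_nonneg _ _ _ _
      split_ifs with h
      · exact le_mul_of_one_le_left h0 (hη1 _ h)
      · exact mul_nonneg (hη0 _) h0
  have hup := energySup_le_sum_cells (p := p) (q := q) a hVopen hVb hVc hS1
  have hlow := sum_cells_le_energySup (p := p) (q := q) a hVopen hVb hVc hS2
  rw [eS] at hup hlow
  set A := latticeAvg translate t (U.indicator fun _ => 1)
    (fun a : Coeff d => J a.field (cube d m) p q) a
  set B := latticeAvg translate t η (fun a : Coeff d => ∫ x in cube d 0, bulk a.field p q x) a
  set F := energySup a.field p q (t • U)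
  set I := ∫ x in layer (t • U) (3 ^ m * d), bulk a.field p q x
  have hgap : gap p q m k a ≤ N * (c * (6 * (R + 1) + 3) ^ d * t ^ d) := by
    refine (hc k).trans ?_
    have h1 : ((3 : ℝ) ^ (m + k)) ^ d ≤ (6 * (R + 1) + 3) ^ d * t ^ d := by
      rw [← mul_pow]
      gcongr
    calc c * (N * ((3 : ℝ) ^ (m + k)) ^ d) ≤ c * (N * ((6 * (R + 1) + 3) ^ d * t ^ d)) := by gcongr
      _ = _ := by ring
  have h1 : F ≤ t ^ d * A + I := by
    refine le_of_mul_le_mul_left ?_ hN0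
    rw [mul_add]; exact hup
  have h2 : t ^ d * A ≤ c * (6 * (R + 1) + 3) ^ d * t ^ d + F + I := by
    refine le_of_mul_le_mul_left ?_ hN0
    rw [mul_add, mul_add]
    linarith
  have h3 : 0 ≤ c * (6 * (R + 1) + 3) ^ d := by positivity
  have e : (t ^ d)⁻¹ * F - A = (t ^ d)⁻¹ * (F - t ^ d * A) := by
    rw [mul_sub, inv_mul_cancel_left₀ htd.ne']
  rw [e, abs_mul, abs_of_pos (inv_pos.2 htd), inv_mul_le_iff₀ htd, abs_le]
  constructor
  · nlinarith
  · nlinarith [mul_nonneg h3 htd.le]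

/-- Outer regularity gives an open neighbourhood of small volume, and Urysohn's lemma a bump in it
equal to 1 on a whole thickening of K, which is what boundary layers of positive width need. -/
theorem exists_bump_of_null {K : Set (Space d)} (hK : IsCompact K) (h0 : volume K = 0) {ε : ℝ}
    (hε : 0 < ε) : ∃ η : Space d → ℝ, Continuous η ∧ HasCompactSupport η ∧
      (∀ y, 0 ≤ η y ∧ η y ≤ 1) ∧ (∃ δ > 0, ∀ y, (∃ z ∈ K, dist y z ≤ δ) → η y = 1) ∧
      ∫ y, η y ≤ ε := by
  obtain ⟨V, hKV, hV, hVε⟩ := hK.exists_isOpen_lt_of_lt (μ := volume) (ENNReal.ofReal ε)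
    (by rw [h0]; exact ENNReal.ofReal_pos.2 hε)
  obtain ⟨δ, hδ, hδV⟩ := hK.exists_cthickening_subset_open hV hKV
  obtain ⟨η, h1, h2, h3, h4⟩ := exists_continuous_one_zero_of_isCompact
    (hK.cthickening (r := δ)) hV.isClosed_compl
    (Set.disjoint_compl_right_iff_subset.2 hδV)
  refine ⟨η, η.continuous, h3, h4, ⟨δ, hδ, fun y ⟨z, hz, hyz⟩ =>
    h1 (Metric.mem_cthickening_of_dist_le y z δ K hz hyz)⟩, ?_⟩
  have h5 : ∀ y, η y ≤ V.indicator (fun _ => (1 : ℝ)) y := fun y => by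
    by_cases hy : y ∈ V
    · rw [Set.indicator_of_mem hy]; exact (h4 y).2
    · rw [Set.indicator_of_notMem hy]; exact (h2 hy).le
  have h6 : volume V ≠ ⊤ := (hVε.trans ENNReal.ofReal_lt_top).ne
  calc ∫ y, η y ≤ ∫ y, V.indicator (fun _ => (1 : ℝ)) y :=
        integral_mono (η.continuous.integrable_of_hasCompactSupport h3)
          ((integrable_indicator_iff hV.measurableSet).2 (integrableOn_const h6)) h5
    _ = volume.real V := by rw [integral_indicator hV.measurableSet]; simp
    _ ≤ ε := ENNReal.toReal_le_of_le_ofReal hε.le hVε.le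

variable {P : Measure (Coeff d)} [IsProbabilityMeasure P]

/-- The almost sure limit of the rescaled energies of dilations of a Jordan measurable set. -/
theorem ae_tendsto_energySup_smul (hstat : IsZdStationary P) (herg : IsZdErgodic P)
    (hmom : HasFiniteMoments P) (hU : IsOpen U) (hUb : Bornology.IsBounded U)
    (hU0 : volume (frontier U) = 0) {e : ℝ} (he : Tendsto (meanEnergy P p q) atTop (𝓝 e)) :
    ∀ᵐ a ∂P, Tendsto (fun t : ℝ => (t ^ d)⁻¹ * energySup a.field p q (t • U)) atTop
      (𝓝 (volume.real U * e)) := by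
  have hT := hstat.isAction_translate
  have hE : IsErgodicAction translate P := fun A hA h => herg.of_preimage_eq hA h
  obtain ⟨R, hR0, hR⟩ := hUb.subset_ball_lt 0 0
  have hUR : ∀ x ∈ U, ‖x‖ ≤ R := fun x hx => by
    have := hR hx
    rw [mem_ball_zero_iff] at this
    exact this.le
  have hKc : IsCompact (frontier U) := Metric.isCompact_of_isClosed_isBounded isClosed_frontier
    (hUb.closure.subset frontier_subset_closure)
  choose η hηc hηs hη01 hη1 hηi using fun l : ℕ => exists_bump_of_null hKc hU0
    (ε := 1 / ((l : ℝ) + 1)) (by positivity)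
  choose δ hδ hη1 using hη1
  choose R' hR' hηR using fun l => exists_supp_bound (hηs l)
  -- The cutoff indicator is continuous because the bump is 1 on the boundary of U; it differs from
  -- the indicator by at most the bump.
  set χ : ℕ → Space d → ℝ := fun l => U.indicator fun y => 1 - η l y with hχ
  have hχc : ∀ l, Continuous (χ l) := fun l => by
    refine continuous_indicator (fun y hy => ?_) (by fun_prop (disch := exact hηc l))
    rw [hη1 l y ⟨y, hy, by rw [dist_self]; exact (hδ l).le⟩, sub_self]
  have hχR : ∀ l y, χ l y ≠ 0 → ‖y‖ ≤ R := fun l y hy => hUR y (Set.mem_of_indicator_ne_zero hy)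
  have hχs : ∀ l, HasCompactSupport (χ l) := fun l =>
    HasCompactSupport.intro (isCompact_closedBall (0 : Space d) R) fun y hy => by
      by_contra h
      exact hy (mem_closedBall_zero_iff.2 (hχR l y h))
  set ψ : ℕ → Coeff d → ℝ := fun m a => J a.field (cube d m) p q with hψ
  have hψe : ∀ m, ψ m = fun a => (((3 : ℝ) ^ m) ^ d)⁻¹ * energySup a.field p q (cube d m) := fun m => by
    ext a
    rw [energySup_cube_eq, inv_mul_cancel_left₀ (by positivity)]
  have hψm : ∀ m, Measurable (ψ m) := fun m => by
    rw [hψe]; exact (measurable_energySup_cube m).const_mul _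
  have hψi : ∀ m, Integrable (ψ m) P := fun m => by
    rw [hψe]; exact (integrable_energySup_cube hstat hmom m).const_mul _
  have hψ0 : ∀ m a, 0 ≤ ψ m a := fun m a => J_nonneg _ _ _ _
  set g : Coeff d → ℝ := fun a => ∫ x in cube d 0, bulk a.field p q x with hg
  have A1 := ae_all_iff.2 fun l => ae_all_iff.2 fun m =>
    ae_tendsto_latticeAvg hT hE (hχc l) (hχs l) (hψm m) (hψi m)
  have A2 := ae_all_iff.2 fun l => ae_all_iff.2 fun m =>
    ae_tendsto_latticeAvg hT hE (hηc l) (hηs l) (hψm m) (hψi m)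
  have A3 := ae_all_iff.2 fun l => ae_tendsto_latticeAvg hT hE (hηc l) (hηs l)
    (measurable_integral_bulk (cube d 0) p q) (hmom.integrable_bulk p q)
  filter_upwards [A1, A2, A3, ae_exists_gap_le hstat hmom he] with a a1 a2 a3 a4
  change ∀ l, Tendsto (fun t => latticeAvg translate t (η l) g a) atTop
    (𝓝 ((∫ y, η l y) * ∫ a, g a ∂P)) at a3
  have hanti := meanEnergy_antitone (p := p) (q := q) hstat hmom
  set E := meanEnergy P p q with hEdef
  have hEm : ∀ m, ∫ a, ψ m a ∂P = E m := fun m => rfl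
  have hE0 : ∀ m, 0 ≤ E m := fun m => meanEnergy_nonneg m
  simp only [hEm] at a1 a2
  have hG : 0 ≤ ∫ a, g a ∂P := integral_nonneg fun a => integral_nonneg fun x => bulk_nonneg _ _ _ _
  set G := ∫ a, g a ∂P with hGdef
  have hvol : ∀ l, |(∫ y, χ l y) - volume.real U| ≤ 1 / ((l : ℝ) + 1) := fun l => by
    have i1 : Integrable (U.indicator fun _ => (1 : ℝ)) :=
      (integrable_indicator_iff hU.measurableSet).2 (integrableOn_const hUb.measure_lt_top.ne)
    have i2 := (hχc l).integrable_of_hasCompactSupport (hχs l) (μ := volume)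
    have i3 := (hηc l).integrable_of_hasCompactSupport (hηs l) (μ := volume)
    have e1 : volume.real U = ∫ y, U.indicator (fun _ => (1 : ℝ)) y := by
      rw [integral_indicator hU.measurableSet]; simp
    have e2 : ∀ y, |χ l y - U.indicator (fun _ => (1 : ℝ)) y| ≤ η l y := fun y => by
      by_cases hy : y ∈ U
      · simp only [hχ, Set.indicator_of_mem hy]
        rw [sub_sub_cancel_left, abs_neg, abs_of_nonneg (hη01 l y).1]
      · simp only [hχ, Set.indicator_of_notMem hy, sub_self, abs_zero]
        exact (hη01 l y).1
    rw [e1, ← integral_sub i2 i1]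
    exact (abs_integral_le_integral_abs).trans
      ((integral_mono (i2.sub i1).abs i3 e2).trans (hηi l))
  rw [Metric.tendsto_atTop']
  intro ε hε
  set C : ℝ := (6 * (R + 1) + 3) ^ d with hC
  have hC0 : 0 < C := by positivity
  -- The bump is fixed before m: its contributions are bounded with E 0, which dominates every E m.
  obtain ⟨l, hl⟩ := exists_nat_one_div_lt (show 0 < ε / (8 * (G + 2 * E 0 + 1)) by
    have := hE0 0; positivity)
  set κ : ℝ := 1 / ((l : ℝ) + 1) with hκ
  have hκ0 : 0 < κ := by positivity
  have hκε : κ * (G + 2 * E 0 + 1) < ε / 8 := by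
    have h1 : 0 < G + 2 * E 0 + 1 := by have := hE0 0; positivity
    rw [lt_div_iff₀ (by positivity)] at hl
    linarith
  have hvE : Tendsto (fun m => volume.real U * E m) atTop (𝓝 (volume.real U * e)) :=
    he.const_mul _
  obtain ⟨m₀, hm₀⟩ := Metric.tendsto_atTop.1 hvE (ε / 8) (by positivity)
  -- The scale m depends on the realization; it only has to make the gap and the distance of E m
  -- from its limit small. Large t is chosen afterwards.
  obtain ⟨m, hm, hgap⟩ := a4 (ε / (8 * C)) (by positivity) m₀
  have hmE := hm₀ m hm
  have hmE0 : E m ≤ E 0 := hanti (Nat.zero_le m)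
  have b1 := Metric.tendsto_atTop.1 (a1 l m) (ε / 8) (by positivity)
  have b2 := Metric.tendsto_atTop.1 (a2 l m) (ε / 8) (by positivity)
  have b3 := Metric.tendsto_atTop.1 (a3 l) (ε / 8) (by positivity)
  obtain ⟨t1, ht1⟩ := b1
  obtain ⟨t2, ht2⟩ := b2
  obtain ⟨t3, ht3⟩ := b3
  refine ⟨max (max (max t1 t2) (max t3 1)) (max (rad m + 1) ((3 ^ m + 1) * d / δ l)),
    fun t ht => ?_⟩
  simp only [gt_iff_lt, max_lt_iff] at ht
  obtain ⟨⟨⟨h1, h2⟩, h3, h4⟩, h5, h6⟩ := ht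
  have c1 := ht1 t h1.le
  have c2 := ht2 t h2.le
  have c3 := ht3 t h3.le
  rw [Real.dist_eq] at c1 c2 c3 hmE ⊢
  have key := abs_energySup_sub_latticeAvg_le (p := p) (q := q) a hU hR0.le hUR h4.le h5.le
    (fun y => (hη01 l y).1) (hR' l) (hηR l) (fun y hy => (hη1 l y hy).ge)
    (by rw [div_lt_iff₀ (hδ l)] at h6; linarith) (by positivity) hgap
  rw [← hC, div_mul_eq_mul_div, mul_comm ε C, mul_comm 8 C, mul_div_mul_left _ _ hC0.ne'] at key
  have hsuppU : ∀ y, U.indicator (fun _ => (1 : ℝ)) y ≠ 0 → ‖y‖ ≤ R + R' l := fun y hy => by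
    have := hUR y (Set.mem_of_indicator_ne_zero hy)
    linarith [hR' l]
  have hsuppχ : ∀ y, χ l y ≠ 0 → ‖y‖ ≤ R + R' l := fun y hy => by
    linarith [hχR l y hy, hR' l]
  have hsuppη : ∀ y, η l y ≠ 0 → ‖y‖ ≤ R + R' l := fun y hy => by
    linarith [hηR l y hy]
  have hRR : 0 ≤ R + R' l := add_nonneg hR0.le (hR' l)
  have d1 := latticeAvg_mono (T := translate) hsuppχ hsuppU hRR h4.le (hψ0 m) (fun y => by
    by_cases hy : y ∈ U
    · simp only [hχ, Set.indicator_of_mem hy]; linarith [(hη01 l y).1]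
    · simp only [hχ, Set.indicator_of_notMem hy]; exact le_rfl) a
  -- Together with `d1`, this sandwiches the average with the discontinuous indicator between
  -- averages with continuous weights: χ ≤ 1_U ≤ χ + η.
  have d2 := latticeAvg_mono (T := translate) (f := fun y => U.indicator (fun _ => (1 : ℝ)) y - χ l y)
    (R := R + R' l) (fun y hy => by
      by_contra h
      have e1 : U.indicator (fun _ => (1 : ℝ)) y = 0 := by_contra fun h' => h (hsuppU y h')
      have e2 : χ l y = 0 := by_contra fun h' => h (hsuppχ y h')
      exact hy (by rw [e1, e2, sub_zero])) hsuppη hRR h4.le (hψ0 m) (fun y => by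
    by_cases hy : y ∈ U
    · simp only [hχ, Set.indicator_of_mem hy]; linarith
    · simp only [hχ, Set.indicator_of_notMem hy, sub_zero]; exact (hη01 l y).1) a
  rw [latticeAvg_sub_left hsuppU hsuppχ hRR h4.le] at d2
  have hηint0 : 0 ≤ ∫ y, η l y := integral_nonneg fun y => (hη01 l y).1
  have e1 : (∫ y, η l y) * G ≤ κ * G := mul_le_mul_of_nonneg_right (hηi l) hG
  have e2 : (∫ y, η l y) * E m ≤ κ * E 0 :=
    mul_le_mul (hηi l) hmE0 (hE0 m) hκ0.le
  have e3 : |(∫ y, χ l y) * E m - volume.real U * E m| ≤ κ * E 0 := by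
    rw [← sub_mul, abs_mul, abs_of_nonneg (hE0 m)]
    exact mul_le_mul (hvol l) hmE0 (hE0 m) hκ0.le
  rw [abs_lt] at c1 c2 c3 hmE ⊢
  rw [abs_le] at key e3
  constructor <;> linarith

end SubadditiveErgodic

/-! ### Bounded Lipschitz domains -/

/-- Translates of a graph by distinct multiples of the vertical vector are disjoint. A set with
infinitely many disjoint translates by a bounded sequence is null. -/
theorem volume_graph_eq_zero {ν : Space d} (hν : ‖ν‖ = 1) {γ : Space d → ℝ} (hγ : Continuous γ) :
    volume {y : Space d | γ (y - inner ℝ ν y • ν) = inner ℝ ν y} = 0 := by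
  have hνν : inner ℝ ν ν = (1 : ℝ) := by rw [real_inner_self_eq_norm_sq, hν]; norm_num
  refine Measure.addHaar_eq_zero_of_disjoint_translates volume
    (fun n : ℕ => ((n : ℝ) + 1)⁻¹ • ν) ?_ ?_ ?_
  · refine isBounded_iff_forall_norm_le.2 ⟨1, ?_⟩
    rintro _ ⟨n, rfl⟩
    have hn : (0 : ℝ) < n + 1 := by positivity
    rw [norm_smul, hν, mul_one, norm_inv, Real.norm_of_nonneg hn.le, inv_le_one₀ hn]
    linarith [n.cast_nonneg (α := ℝ)]
  · intro m n hmn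
    rw [Function.onFun, Set.disjoint_left]
    intro x hx hx'
    simp only [Set.singleton_add, Set.mem_image] at hx hx'
    obtain ⟨y, hy, rfl⟩ := hx
    obtain ⟨z, hz, hyz⟩ := hx'
    rw [Set.mem_ofPred_eq] at hy hz
    have e : z = y + (((m : ℝ) + 1)⁻¹ - ((n : ℝ) + 1)⁻¹) • ν := by
      rw [sub_smul, eq_comm, ← sub_eq_zero]
      rw [← sub_eq_zero] at hyz
      rw [← neg_eq_zero, ← hyz]; abel
    set c := ((m : ℝ) + 1)⁻¹ - ((n : ℝ) + 1)⁻¹ with hc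
    rw [e, inner_add_right, inner_smul_right, hνν, mul_one] at hz
    rw [show y + c • ν - (inner ℝ ν y + c) • ν = y - inner ℝ ν y • ν by module, hy] at hz
    have : c = 0 := by linarith
    rw [hc, sub_eq_zero, _root_.inv_inj, add_left_inj, Nat.cast_inj] at this
    exact hmn this
  · exact (isClosed_eq (by fun_prop) (by fun_prop)).measurableSet

namespace IsBoundedLipschitzDomain

variable {U : Set (Space d)}

/-- Near a boundary point the boundary lies in the graph of γ: points strictly above belong to the
open set U, and points strictly below have a neighbourhood that misses U. -/
theorem volume_frontier (h : IsBoundedLipschitzDomain U) : volume (frontier U) = 0 := by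
  obtain ⟨ho, -, -, hloc⟩ := h
  refine measure_null_of_locally_null _ fun x hx => ?_
  obtain ⟨r, hr, ν, hν, γ, K, hγ, hball⟩ := hloc x hx
  have hγc := hγ.continuous
  refine ⟨frontier U ∩ Metric.ball x r, inter_mem_nhdsWithin _ (Metric.ball_mem_nhds x hr), ?_⟩
  refine measure_mono_null ?_ (volume_graph_eq_zero hν hγc)
  rintro y ⟨hy, hyb⟩
  rw [ho.frontier_eq] at hy
  have h1 := mt (hball y hyb).2 hy.2
  refine le_antisymm ?_ (not_lt.1 h1)
  by_contra! h2
  have hopen : IsOpen {z : Space d | inner ℝ ν z < γ (z - inner ℝ ν z • ν)} :=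
    isOpen_lt (by fun_prop) (by fun_prop)
  obtain ⟨z, ⟨hz1, hz2⟩, hzU⟩ := mem_closure_iff.1 hy.1 _ (hopen.inter Metric.isOpen_ball) ⟨h2, hyb⟩
  exact lt_asymm hz1 ((hball z hz2).1 hzU)

theorem volume_pos (h : IsBoundedLipschitzDomain U) : 0 < volume.real U :=
  ENNReal.toReal_pos (h.1.measure_pos volume h.2.1.nonempty).ne' h.2.2.1.measure_lt_top.ne

end IsBoundedLipschitzDomain

theorem ae_tendsto_J_smul {P : Measure (Coeff d)} [IsProbabilityMeasure P] (hstat : IsZdStationary P)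
    (herg : IsZdErgodic P) (hmom : HasFiniteMoments P) {U : Set (Space d)}
    (hU : IsBoundedLipschitzDomain U) {p q : Fin d → ℝ} {e : ℝ}
    (he : Tendsto (meanEnergy P p q) atTop (𝓝 e)) :
    ∀ᵐ a ∂P, Tendsto (fun t : ℝ => J a.field (t • U) p q) atTop (𝓝 e) := by
  filter_upwards [ae_tendsto_energySup_smul hstat herg hmom hU.1 hU.2.2.1 hU.volume_frontier he]
    with a ha
  have h := ha.const_mul (volume.real U)⁻¹
  rw [inv_mul_cancel_left₀ hU.volume_pos.ne'] at h
  refine h.congr' ?_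
  filter_upwards [eventually_gt_atTop 0] with t ht
  have hv : volume.real (t • U) = t ^ d * volume.real U := by
    rw [Measure.real, Measure.addHaar_smul, finrank_euclideanSpace_fin, ENNReal.toReal_mul,
      ENNReal.toReal_ofReal (abs_nonneg _), abs_of_nonneg (by positivity), Measure.real]
  have hU0 := hU.volume_pos.ne'
  have ht0 : t ^ d ≠ 0 := (pow_pos ht d).ne'
  rw [energySup, hv]
  field_simp

/-! ### Polarization -/

/-- `b`, read off from a quadratic form by polarization. -/
def polB (f : (Fin d → ℝ) → (Fin d → ℝ) → ℝ) : Mat d :=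
  Matrix.of fun i j => f (basisVec i + basisVec j) 0 - f (basisVec i) 0 - f (basisVec j) 0

/-- `s_*⁻¹ k`, read off from a quadratic form by polarization. -/
def polC (f : (Fin d → ℝ) → (Fin d → ℝ) → ℝ) : Mat d :=
  Matrix.of fun i j => f (basisVec j) (basisVec i) - f (basisVec j) 0 - f 0 (basisVec i)
    + basisVec j ⬝ᵥ basisVec i

/-- `s_*⁻¹`, read off from a quadratic form by polarization. -/
def polT (f : (Fin d → ℝ) → (Fin d → ℝ) → ℝ) : Mat d :=
  Matrix.of fun i j => f 0 (basisVec i + basisVec j) - f 0 (basisVec i) - f 0 (basisVec j)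

theorem dotProduct_mulVec_inner {H : Type*} [NormedAddCommGroup H] [InnerProductSpace ℝ H]
    (L L' : (Fin d → ℝ) →ₗ[ℝ] H) (v w : Fin d → ℝ) :
    v ⬝ᵥ ((Matrix.of fun i j => inner ℝ (L (basisVec i)) (L' (basisVec j))) *ᵥ w)
      = inner ℝ (L v) (L' w) := by
  have hexp : ∀ (M : (Fin d → ℝ) →ₗ[ℝ] H) (x : Fin d → ℝ), M x = ∑ i, x i • M (basisVec i) := by
    intro M x
    conv_lhs => rw [← Finset.univ_sum_single x]
    rw [map_sum]
    refine Finset.sum_congr rfl fun i _ => ?_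
    rw [← map_smul, basisVec, ← Pi.single_smul, smul_eq_mul, mul_one]
  rw [hexp L v, hexp L' w, sum_inner]
  simp only [inner_sum, inner_smul_left, inner_smul_right, dotProduct, mulVec, of_apply,
    Finset.mul_sum]
  refine Finset.sum_congr rfl fun i _ => Finset.sum_congr rfl fun j _ => ?_
  simp; ring

/-- Polarization is exact for a multiple of the squared norm of a linear map. The scalar product of
basis vectors in `polC` adds the identity to the cross matrix, which produces the term 2p·q. -/
theorem blockQuad_pol {H : Type*} [NormedAddCommGroup H] [InnerProductSpace ℝ H]
    {f : (Fin d → ℝ) → (Fin d → ℝ) → ℝ} {c : ℝ} (Z : ((Fin d → ℝ) × (Fin d → ℝ)) →ₗ[ℝ] H)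
    (hZ : ∀ p q, f p q = c * ‖Z (p, q)‖ ^ 2) (p q : Fin d → ℝ) :
    blockQuad (polB f) (polC f) (polT f) p q = 2 * f p q + 2 * (p ⬝ᵥ q) := by
  set L := Z ∘ₗ LinearMap.inl ℝ (Fin d → ℝ) (Fin d → ℝ) with hL
  set L' := Z ∘ₗ LinearMap.inr ℝ (Fin d → ℝ) (Fin d → ℝ) with hL'
  have hZ' : ∀ p q, Z (p, q) = L p + L' q := fun p q => by
    rw [hL, hL', LinearMap.comp_apply, LinearMap.comp_apply, ← map_add]; simp
  have hf : ∀ p q, f p q = c * (inner ℝ (L p) (L p) + 2 * inner ℝ (L p) (L' q)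
      + inner ℝ (L' q) (L' q)) := fun p q => by
    rw [hZ, hZ', norm_add_sq_real, real_inner_self_eq_norm_sq, real_inner_self_eq_norm_sq]
  have hB : polB f = (2 * c) • Matrix.of fun i j => inner ℝ (L (basisVec i)) (L (basisVec j)) := by
    ext i j
    simp only [polB, of_apply, hf, map_zero, inner_zero_right, map_add, inner_add_left,
      inner_add_right, Matrix.smul_apply, smul_eq_mul, real_inner_comm (L (basisVec i)) (L (basisVec j))]
    ring
  have hT : polT f = (2 * c) • Matrix.of fun i j => inner ℝ (L' (basisVec i)) (L' (basisVec j)) := by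
    ext i j
    simp only [polT, of_apply, hf, map_zero, inner_zero_left, map_add, inner_add_left,
      inner_add_right, Matrix.smul_apply, smul_eq_mul, real_inner_comm (L' (basisVec i)) (L' (basisVec j))]
    ring
  have hC : polC f = (2 * c) • (Matrix.of fun i j => inner ℝ (L' (basisVec i)) (L (basisVec j)))
      + 1 := by
    ext i j
    simp only [polC, of_apply, hf, map_zero, inner_zero_left, inner_zero_right, Matrix.add_apply,
      Matrix.smul_apply, smul_eq_mul, real_inner_comm (L' (basisVec i)) (L (basisVec j))]
    have : (basisVec j ⬝ᵥ basisVec i : ℝ) = (1 : Mat d) i j := by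
      simp [basisVec, Matrix.one_apply, Pi.single_apply]
    rw [this]; ring
  rw [blockQuad, hB, hT, hC, hf]
  simp only [add_mulVec, smul_mulVec, dotProduct_add, dotProduct_smul, dotProduct_mulVec_inner,
    one_mulVec, smul_eq_mul, real_inner_comm (L' q) (L p), dotProduct_comm q p]
  ring

theorem polB_isSymm (f : (Fin d → ℝ) → (Fin d → ℝ) → ℝ) : (polB f).IsSymm := by
  ext i j
  simp only [polB, transpose_apply, of_apply, add_comm (basisVec j)]
  ring

theorem polT_isSymm (f : (Fin d → ℝ) → (Fin d → ℝ) → ℝ) : (polT f).IsSymm := by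
  ext i j
  simp only [polT, transpose_apply, of_apply, add_comm (basisVec j)]
  ring

/-- The form is 2f + 2p·q: nonnegativity of f gives the bound by 2p·q, and f ≥ -2p·q gives the bound
by -2p·q. -/
theorem isCoarse_pol {f : (Fin d → ℝ) → (Fin d → ℝ) → ℝ}
    (hf : ∀ p q, blockQuad (polB f) (polC f) (polT f) p q = 2 * f p q + 2 * (p ⬝ᵥ q))
    (h0 : ∀ p q, 0 ≤ f p q) (h1 : ∀ p q, -(2 * (p ⬝ᵥ q)) ≤ f p q) :
    IsCoarse (polB f) (polC f) (polT f) where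
  symmB := polB_isSymm f
  symmT := polT_isSymm f
  le_quad p q := by rw [hf]; linarith [h0 p q]
  neg_le_quad p q := by rw [hf]; linarith [h1 p q]

/-! ### Passage to the limit in polarizations and block matrices -/

section Limits

variable {ι : Type*} {l : Filter ι} {f : ι → (Fin d → ℝ) → (Fin d → ℝ) → ℝ}
  {g : (Fin d → ℝ) → (Fin d → ℝ) → ℝ}

theorem tendsto_matrix {m n : Type*} {F : ι → Matrix m n ℝ} {M : Matrix m n ℝ}
    (h : ∀ i j, Tendsto (fun x => F x i j) l (𝓝 (M i j))) : Tendsto F l (𝓝 M) :=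
  tendsto_pi_nhds.2 fun i => tendsto_pi_nhds.2 fun j => h i j

theorem tendsto_polB (h : ∀ i j : Fin d, Tendsto (fun x => f x (basisVec i + basisVec j) 0) l
      (𝓝 (g (basisVec i + basisVec j) 0)))
    (h' : ∀ i : Fin d, Tendsto (fun x => f x (basisVec i) 0) l (𝓝 (g (basisVec i) 0))) :
    Tendsto (fun x => polB (f x)) l (𝓝 (polB g)) :=
  tendsto_matrix fun i j => ((h i j).sub (h' i)).sub (h' j)

theorem tendsto_polT (h : ∀ i j : Fin d, Tendsto (fun x => f x 0 (basisVec i + basisVec j)) l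
      (𝓝 (g 0 (basisVec i + basisVec j))))
    (h' : ∀ i : Fin d, Tendsto (fun x => f x 0 (basisVec i)) l (𝓝 (g 0 (basisVec i)))) :
    Tendsto (fun x => polT (f x)) l (𝓝 (polT g)) :=
  tendsto_matrix fun i j => ((h i j).sub (h' i)).sub (h' j)

theorem tendsto_polC (h : ∀ i j : Fin d, Tendsto (fun x => f x (basisVec j) (basisVec i)) l
      (𝓝 (g (basisVec j) (basisVec i))))
    (h' : ∀ i : Fin d, Tendsto (fun x => f x (basisVec i) 0) l (𝓝 (g (basisVec i) 0)))
    (h'' : ∀ i : Fin d, Tendsto (fun x => f x 0 (basisVec i)) l (𝓝 (g 0 (basisVec i)))) :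
    Tendsto (fun x => polC (f x)) l (𝓝 (polC g)) :=
  tendsto_matrix fun i j => (((h i j).sub (h' j)).sub (h'' i)).add_const _

variable {B C T : ι → Mat d} {B' C' T' : Mat d}

/-- Only the limit has to be invertible; the formula by adjugate and inverse determinant is
continuous there. -/
theorem tendsto_inv_of_posDef (hT : Tendsto T l (𝓝 T')) (h : T'.PosDef) :
    Tendsto (fun x => (T x)⁻¹) l (𝓝 T'⁻¹) := by
  simp only [Matrix.inv_def, Ring.inverse_eq_inv']
  exact Tendsto.smul (((continuous_id.matrix_det.tendsto T').comp hT).inv₀ h.det_pos.ne')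
    ((continuous_id.matrix_adjugate.tendsto T').comp hT)

theorem tendsto_inv_mul (hC : Tendsto C l (𝓝 C')) (hT : Tendsto T l (𝓝 T')) (h : T'.PosDef) :
    Tendsto (fun x => (T x)⁻¹ * C x) l (𝓝 (T'⁻¹ * C')) :=
  (tendsto_inv_of_posDef hT h).mul hC

theorem tendsto_transpose {m n : Type*} {F : ι → Matrix m n ℝ} {M : Matrix m n ℝ}
    (h : Tendsto F l (𝓝 M)) : Tendsto (fun x => (F x)ᵀ) l (𝓝 Mᵀ) :=
  (continuous_id.matrix_transpose.tendsto M).comp h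

theorem tendsto_schur (hB : Tendsto B l (𝓝 B')) (hC : Tendsto C l (𝓝 C')) (hT : Tendsto T l (𝓝 T'))
    (h : T'.PosDef) : Tendsto (fun x => schur (B x) (C x) (T x)) l (𝓝 (schur B' C' T')) :=
  have hK := tendsto_inv_mul hC hT h
  hB.sub (((tendsto_transpose hK).mul hT).mul hK)

theorem tendsto_blockForm {S K : ι → Mat d} {S' K' : Mat d} (hS : Tendsto S l (𝓝 S'))
    (hT : Tendsto T l (𝓝 T')) (hK : Tendsto K l (𝓝 K')) :
    Tendsto (fun x => blockForm (S x) (T x) (K x)) l (𝓝 (blockForm S' T' K')) := by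
  have hc : Continuous fun M : Mat d × Mat d × Mat d => blockForm M.1 M.2.1 M.2.2 := by
    unfold blockForm
    exact Continuous.matrix_fromBlocks (by fun_prop) (by fun_prop) (by fun_prop) (by fun_prop)
  exact (hc.tendsto (S', T', K')).comp (hS.prodMk_nhds (hT.prodMk_nhds hK))

end Limits

/-! ### Coarse-grained matrices on cubes and their expectations -/

variable {p q : Fin d → ℝ}

theorem blockQuad_J_cube (a : Coeff d) (n : ℕ) (p q : Fin d → ℝ) :
    blockQuad (polB (J a.field (cube d n))) (polC (J a.field (cube d n)))
      (polT (J a.field (cube d n))) p q = 2 * J a.field (cube d n) p q + 2 * (p ⬝ᵥ q) := by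
  obtain ⟨Z, hZ⟩ := exists_energySup_box_quadratic a.admissible
    (show (0 : ℝ) < 3 ^ n / 2 by positivity)
  refine blockQuad_pol (c := (((3 : ℝ) ^ n) ^ d)⁻¹ * (1 / 2)) Z (fun p q => ?_) p q
  rw [mul_assoc, ← hZ, ← cube_eq_box, energySup_cube_eq, inv_mul_cancel_left₀ (by positivity)]

theorem neg_le_J_cube (a : Coeff d) (n : ℕ) (p q : Fin d → ℝ) :
    -(2 * (p ⬝ᵥ q)) ≤ J a.field (cube d n) p q := by
  have h := neg_le_energySup_box a.admissible (show (0 : ℝ) < 3 ^ n / 2 by positivity) p q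
  rw [← cube_eq_box, energySup_cube_eq, volume_cube] at h
  have h3 : (0 : ℝ) < (3 ^ n) ^ d := by positivity
  refine le_of_mul_le_mul_left ?_ h3
  linarith

/-- The coarse-grained blocks are by definition the polarizations of J, so the facts on polarized
forms apply directly. -/
theorem isCoarse_cube (a : Coeff d) (n : ℕ) : IsCoarse (cgB a.field (cube d n))
    (cgCross a.field (cube d n)) (cgSstarInv a.field (cube d n)) :=
  isCoarse_pol (blockQuad_J_cube a n) (J_nonneg _ _) (neg_le_J_cube a n)

theorem cgA_cube (a : Coeff d) (n : ℕ) : cgA a.field (cube d n) =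
    blockMat (cgB a.field (cube d n)) (cgCross a.field (cube d n))
      (cgSstarInv a.field (cube d n)) :=
  (isCoarse_cube a n).blockForm_eq

theorem integral_sub_sub {α : Type*} [MeasurableSpace α] {μ : Measure α} {f g h : α → ℝ}
    (hf : Integrable f μ) (hg : Integrable g μ) (hh : Integrable h μ) :
    ∫ x, (f x - g x - h x) ∂μ = ∫ x, f x ∂μ - ∫ x, g x ∂μ - ∫ x, h x ∂μ := by
  rw [← integral_sub hf hg]
  exact integral_sub (hf.sub hg) hh

/-! ### Integrability and means of the coarse-grained matrices -/

section Expectation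

variable {P : Measure (Coeff d)}

theorem integrable_J_cube (hstat : IsZdStationary P) (hmom : HasFiniteMoments P) (n : ℕ)
    (p q : Fin d → ℝ) : Integrable (fun a : Coeff d => J a.field (cube d n) p q) P := by
  have h := (integrable_energySup_cube (p := p) (q := q) hstat hmom n).const_mul
    (((3 : ℝ) ^ n) ^ d)⁻¹
  refine h.congr (Eventually.of_forall fun a => ?_)
  simp only [energySup_cube_eq]
  rw [inv_mul_cancel_left₀ (by positivity)]

variable (hstat : IsZdStationary P) (hmom : HasFiniteMoments P) (n : ℕ)
include hstat hmom

theorem integrableMat_cgB : IntegrableMat P fun a => cgB a.field (cube d n) := fun _ _ =>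
  have h := integrable_J_cube hstat hmom n
  ((h _ _).sub (h _ _)).sub (h _ _)

theorem integrableMat_cgSstarInv : IntegrableMat P fun a => cgSstarInv a.field (cube d n) :=
  fun _ _ =>
  have h := integrable_J_cube hstat hmom n
  ((h _ _).sub (h _ _)).sub (h _ _)

theorem integrableMat_cgCross [IsProbabilityMeasure P] :
    IntegrableMat P fun a => cgCross a.field (cube d n) := fun _ _ =>
  have h := integrable_J_cube hstat hmom n
  (((h _ _).sub (h _ _)).sub (h _ _)).add (integrable_const _)

theorem integrableMat_cgA [IsProbabilityMeasure P] :
    IntegrableMat P fun a => cgA a.field (cube d n) := by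
  simp only [cgA_cube]
  rintro (i | i) (j | j)
  · exact integrableMat_cgB hstat hmom n i j
  · exact (integrableMat_cgCross hstat hmom n j i).neg
  · exact (integrableMat_cgCross hstat hmom n i j).neg
  · exact integrableMat_cgSstarInv hstat hmom n i j

theorem expMat_cgB : expMat P (fun a => cgB a.field (cube d n))
    = polB fun p q => meanEnergy P p q n := by
  have h := integrable_J_cube hstat hmom n
  ext i j
  simp only [expMat, cgB, polB, of_apply, meanEnergy]
  exact integral_sub_sub (h _ _) (h _ _) (h _ _)

theorem expMat_cgSstarInv : expMat P (fun a => cgSstarInv a.field (cube d n))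
    = polT fun p q => meanEnergy P p q n := by
  have h := integrable_J_cube hstat hmom n
  ext i j
  simp only [expMat, cgSstarInv, polT, of_apply, meanEnergy]
  exact integral_sub_sub (h _ _) (h _ _) (h _ _)

theorem expMat_cgCross [IsProbabilityMeasure P] :
    expMat P (fun a => cgCross a.field (cube d n))
    = polC fun p q => meanEnergy P p q n := by
  have h := integrable_J_cube hstat hmom n
  ext i j
  simp only [expMat, cgCross, polC, of_apply, meanEnergy]
  refine (integral_add (((h _ _).sub (h _ _)).sub (h _ _)) (integrable_const _)).trans ?_
  rw [integral_const, probReal_univ, one_smul]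
  exact congrArg (· + _) (integral_sub_sub (h _ _) (h _ _) (h _ _))

theorem expMat_cgA [IsProbabilityMeasure P] :
    expMat P (fun a => cgA a.field (cube d n))
    = blockMat (polB fun p q => meanEnergy P p q n) (polC fun p q => meanEnergy P p q n)
      (polT fun p q => meanEnergy P p q n) := by
  rw [← expMat_cgB hstat hmom, ← expMat_cgCross hstat hmom, ← expMat_cgSstarInv hstat hmom]
  simp only [cgA_cube]
  ext (i | i) (j | j)
  · rfl
  · exact integral_neg _
  · exact integral_neg _
  · rfl

/-- The block form depends linearly on its matrices, so the identity for each realization can be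
averaged. -/
theorem blockQuad_meanEnergy [IsProbabilityMeasure P] (p q : Fin d → ℝ) :
    blockQuad (polB fun p q => meanEnergy P p q n) (polC fun p q => meanEnergy P p q n)
      (polT fun p q => meanEnergy P p q n) p q = 2 * meanEnergy P p q n + 2 * (p ⬝ᵥ q) := by
  rw [← expMat_cgB hstat hmom, ← expMat_cgCross hstat hmom, ← expMat_cgSstarInv hstat hmom]
  obtain ⟨iB, eB⟩ := integral_dotProduct_mulVec (integrableMat_cgB hstat hmom n) p p
  obtain ⟨iC, eC⟩ := integral_dotProduct_mulVec (integrableMat_cgCross hstat hmom n) q p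
  obtain ⟨iT, eT⟩ := integral_dotProduct_mulVec (integrableMat_cgSstarInv hstat hmom n) q q
  have hq : ∀ a : Coeff d, _ = _ := fun a => blockQuad_J_cube a n p q
  have hi : ∫ a : Coeff d, (2 * J a.field (cube d n) p q + 2 * (p ⬝ᵥ q)) ∂P
      = 2 * meanEnergy P p q n + 2 * (p ⬝ᵥ q) := by
    rw [integral_add ((integrable_J_cube hstat hmom n p q).const_mul _) (integrable_const _),
      integral_const_mul, meanEnergy]
    simp
  rw [← hi, ← integral_congr_ae (Eventually.of_forall hq)]
  simp only [blockQuad]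
  refine Eq.symm ((integral_add (iB.add (iC.const_mul 2)) iT).trans (congrArg₂ (· + ·) ?_ eT))
  refine (integral_add iB (iC.const_mul 2)).trans (congrArg₂ (· + ·) eB ?_)
  rw [integral_const_mul]
  exact congrArg (2 * ·) eC

theorem neg_le_meanEnergy [IsProbabilityMeasure P] (p q :
    Fin d → ℝ) : -(2 * (p ⬝ᵥ q)) ≤ meanEnergy P p q n := by
  have h := integral_mono (μ := P) (integrable_const _) (integrable_J_cube hstat hmom n p q)
    fun a => neg_le_J_cube a n p q
  simpa [meanEnergy] using h

theorem isCoarse_meanEnergy [IsProbabilityMeasure P] :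
    IsCoarse (polB fun p q => meanEnergy P p q n)
    (polC fun p q => meanEnergy P p q n) (polT fun p q => meanEnergy P p q n) :=
  isCoarse_pol (blockQuad_meanEnergy hstat hmom n) (fun _ _ => meanEnergy_nonneg n)
    (neg_le_meanEnergy hstat hmom n)

theorem homSstar_cube [IsProbabilityMeasure P] :
    homSstar P (cube d n) = (polT fun p q => meanEnergy P p q n)⁻¹ := by
  rw [homSstar, expMat_cgSstarInv hstat hmom]

theorem homSstar_inv_cube [IsProbabilityMeasure P] :
    (homSstar P (cube d n))⁻¹ = polT fun p q => meanEnergy P p q n := by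
  rw [homSstar_cube hstat hmom, nonsing_inv_nonsing_inv]
  exact (isCoarse_meanEnergy hstat hmom n).posDef.det_pos.ne'.isUnit

/-- On cubes s_*⁻¹(U) is invertible for every realization, so s_*⁻¹(U) k(U) is exactly the cross
matrix, which is linear in J. -/
theorem homK_cube [IsProbabilityMeasure P] :
    homK P (cube d n) = (polT fun p q => meanEnergy P p q n)⁻¹ *
    polC fun p q => meanEnergy P p q n := by
  have h : ∀ a : Coeff d, cgSstarInv a.field (cube d n) * cgK a.field (cube d n)
      = cgCross a.field (cube d n) := fun a => (isCoarse_cube a n).mul_cross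
  rw [homK, homSstar_cube hstat hmom]
  simp only [h]
  rw [expMat_cgCross hstat hmom]

theorem homS_cube [IsProbabilityMeasure P] :
    homS P (cube d n) = schur (polB fun p q => meanEnergy P p q n)
    (polC fun p q => meanEnergy P p q n) (polT fun p q => meanEnergy P p q n) := by
  have h : ∀ a : Coeff d, cgS a.field (cube d n) + (cgK a.field (cube d n))ᵀ *
      cgSstarInv a.field (cube d n) * cgK a.field (cube d n) = cgB a.field (cube d n) :=
    fun a => sub_add_cancel _ _
  rw [homS, homSstar_inv_cube hstat hmom, homK_cube hstat hmom]
  simp only [h]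
  rw [expMat_cgB hstat hmom, schur]

theorem homA_cube [IsProbabilityMeasure P] :
    homA P (cube d n) = blockForm (schur (polB fun p q => meanEnergy P p q n)
    (polC fun p q => meanEnergy P p q n) (polT fun p q => meanEnergy P p q n))
    (polT fun p q => meanEnergy P p q n)
    ((polT fun p q => meanEnergy P p q n)⁻¹ * polC fun p q => meanEnergy P p q n) := by
  rw [homA, homS_cube hstat hmom, homSstar_inv_cube hstat hmom, homK_cube hstat hmom]

/-- Reassembling the deterministic blocks from the Schur complement cancels all nonlinear
operations; what remains is linear in J and commutes with the expectation. -/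
theorem homA_cube_eq_expMat [IsProbabilityMeasure P] :
    homA P (cube d n) = expMat P (fun a => cgA a.field (cube d n)) := by
  rw [homA_cube hstat hmom, (isCoarse_meanEnergy hstat hmom n).blockForm_eq, expMat_cgA hstat hmom]

theorem blockQuad_meanEnergy_anti [IsProbabilityMeasure P] {m n :
    ℕ} (hmn : m ≤ n) (p q : Fin d → ℝ) :
    blockQuad (polB fun p q => meanEnergy P p q n) (polC fun p q => meanEnergy P p q n)
      (polT fun p q => meanEnergy P p q n) p q
    ≤ blockQuad (polB fun p q => meanEnergy P p q m) (polC fun p q => meanEnergy P p q m)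
      (polT fun p q => meanEnergy P p q m) p q := by
  rw [blockQuad_meanEnergy hstat hmom, blockQuad_meanEnergy hstat hmom]
  linarith [meanEnergy_antitone (p := p) (q := q) hstat hmom hmn]

theorem antitone_homA [IsProbabilityMeasure P] :
    Antitone fun n => homA P (cube d n) := fun m n hmn => by
  have hm := isCoarse_meanEnergy hstat hmom m
  have hn := isCoarse_meanEnergy hstat hmom n
  simp only [homA_cube hstat hmom]
  rw [hm.blockForm_eq, hn.blockForm_eq]
  exact hn.blockMat_mono hm (blockQuad_meanEnergy_anti hstat hmom hmn)

theorem antitone_homS [IsProbabilityMeasure P] :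
    Antitone fun n => homS P (cube d n) := fun m n hmn => by
  simp only [homS_cube hstat hmom]
  exact (isCoarse_meanEnergy hstat hmom n).schur_mono (isCoarse_meanEnergy hstat hmom m)
    (blockQuad_meanEnergy_anti hstat hmom hmn)

theorem monotone_homSstar [IsProbabilityMeasure P] :
    Monotone fun n => homSstar P (cube d n) := fun m n hmn => by
  simp only [homSstar_cube hstat hmom]
  exact (isCoarse_meanEnergy hstat hmom n).inv_anti (isCoarse_meanEnergy hstat hmom m)
    (blockQuad_meanEnergy_anti hstat hmom hmn)

end Expectation

/-! ### The homogenized matrices -/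

/-- The limit of the expected value of `J` along triadic cubes. -/
def limEnergy (P : Measure (Coeff d)) (p q : Fin d → ℝ) : ℝ := ⨅ n, meanEnergy P p q n

section Homogenized

variable {P : Measure (Coeff d)}

theorem limEnergy_le (n : ℕ) (p q : Fin d → ℝ) : limEnergy P p q ≤ meanEnergy P p q n :=
  ciInf_le ⟨0, Set.forall_mem_range.2 fun n => meanEnergy_nonneg n⟩ n

theorem isSymm_expMat_avgMat {U : Set (Space d)} {M : Coeff d → Space d → Mat d}
    (h : ∀ a x, (M a x).IsSymm) : (expMat P fun a => avgMat U (M a)).IsSymm := by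
  ext i j
  simp only [transpose_apply, expMat, avgMat, of_apply, (h _ _).apply j i]

theorem inv_symPart_isSymm (M : Mat d) : (symPart M)⁻¹.IsSymm := by
  rw [IsSymm, transpose_nonsing_inv, (symPart_isSymm M).eq]

theorem bMat_isSymm (M : Mat d) : (bMat M).IsSymm := by
  refine (symPart_isSymm M).add ?_
  simp only [IsSymm, transpose_mul, transpose_transpose, (inv_symPart_isSymm M).eq, Matrix.mul_assoc]

theorem tendsto_meanEnergy (hstat : IsZdStationary P) (hmom : HasFiniteMoments P)
    (p q : Fin d → ℝ) :
    Tendsto (meanEnergy P p q) atTop (𝓝 (limEnergy P p q)) :=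
  tendsto_atTop_ciInf (meanEnergy_antitone hstat hmom)
    ⟨0, Set.forall_mem_range.2 fun n => meanEnergy_nonneg n⟩

variable (hstat : IsZdStationary P) (hmom : HasFiniteMoments P)
include hstat hmom

theorem tendsto_polB_meanEnergy :
    Tendsto (fun n => polB fun p q => meanEnergy P p q n) atTop (𝓝 (polB (limEnergy P))) :=
  tendsto_polB (f := fun n p q => meanEnergy P p q n)
    (fun _ _ => tendsto_meanEnergy hstat hmom _ _) (fun _ => tendsto_meanEnergy hstat hmom _ _)

theorem tendsto_polT_meanEnergy :
    Tendsto (fun n => polT fun p q => meanEnergy P p q n) atTop (𝓝 (polT (limEnergy P))) :=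
  tendsto_polT (f := fun n p q => meanEnergy P p q n)
    (fun _ _ => tendsto_meanEnergy hstat hmom _ _) (fun _ => tendsto_meanEnergy hstat hmom _ _)

theorem tendsto_polC_meanEnergy :
    Tendsto (fun n => polC fun p q => meanEnergy P p q n) atTop (𝓝 (polC (limEnergy P))) :=
  tendsto_polC (f := fun n p q => meanEnergy P p q n)
    (fun _ _ => tendsto_meanEnergy hstat hmom _ _) (fun _ => tendsto_meanEnergy hstat hmom _ _)
    (fun _ => tendsto_meanEnergy hstat hmom _ _)

theorem blockQuad_limEnergy [IsProbabilityMeasure P] (p q : Fin d → ℝ) :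
    blockQuad (polB (limEnergy P)) (polC (limEnergy P)) (polT (limEnergy P)) p q
      = 2 * limEnergy P p q + 2 * (p ⬝ᵥ q) := by
  have hc : Continuous fun M : Mat d × Mat d × Mat d => blockQuad M.1 M.2.1 M.2.2 p q := by
    unfold blockQuad
    fun_prop
  have h1 := (hc.tendsto _).comp ((tendsto_polB_meanEnergy hstat hmom).prodMk_nhds
    ((tendsto_polC_meanEnergy hstat hmom).prodMk_nhds (tendsto_polT_meanEnergy hstat hmom)))
  have h2 := ((tendsto_meanEnergy hstat hmom p q).const_mul 2).add_const (2 * (p ⬝ᵥ q))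
  refine tendsto_nhds_unique h1 (h2.congr fun n => ?_)
  exact (blockQuad_meanEnergy hstat hmom n p q).symm

theorem isCoarse_limEnergy [IsProbabilityMeasure P] :
    IsCoarse (polB (limEnergy P)) (polC (limEnergy P)) (polT (limEnergy P)) :=
  isCoarse_pol (blockQuad_limEnergy hstat hmom) (fun _ _ => le_ciInf fun n => meanEnergy_nonneg n)
    (fun _ _ => le_ciInf fun n => neg_le_meanEnergy hstat hmom n _ _)

theorem tendsto_homSstar [IsProbabilityMeasure P] :
    Tendsto (fun n => homSstar P (cube d n)) atTop (𝓝 (polT (limEnergy P))⁻¹) := by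
  simp only [homSstar_cube hstat hmom]
  exact tendsto_inv_of_posDef (tendsto_polT_meanEnergy hstat hmom)
    (isCoarse_limEnergy hstat hmom).posDef

theorem tendsto_homS [IsProbabilityMeasure P] :
    Tendsto (fun n => homS P (cube d n)) atTop
    (𝓝 (schur (polB (limEnergy P)) (polC (limEnergy P)) (polT (limEnergy P)))) := by
  simp only [homS_cube hstat hmom]
  exact tendsto_schur (tendsto_polB_meanEnergy hstat hmom) (tendsto_polC_meanEnergy hstat hmom)
    (tendsto_polT_meanEnergy hstat hmom) (isCoarse_limEnergy hstat hmom).posDef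

theorem tendsto_homA [IsProbabilityMeasure P] :
    Tendsto (fun n => homA P (cube d n)) atTop
    (𝓝 (blockForm (schur (polB (limEnergy P)) (polC (limEnergy P)) (polT (limEnergy P)))
      (polT (limEnergy P)) ((polT (limEnergy P))⁻¹ * polC (limEnergy P)))) := by
  have hT := tendsto_polT_meanEnergy hstat hmom
  have hC := tendsto_polC_meanEnergy hstat hmom
  have hpos := (isCoarse_limEnergy hstat hmom).posDef
  simp only [homA_cube hstat hmom]
  exact tendsto_blockForm (tendsto_schur (tendsto_polB_meanEnergy hstat hmom) hC hT hpos) hT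
    (tendsto_inv_mul hC hT hpos)

/-- The block matrix is an explicit function of finitely many values of J, continuous at the limit.
No quadratic structure of J on tU itself is needed, only that of the limit, obtained from cubes. -/
theorem ae_tendsto_cgA_smul [IsProbabilityMeasure P] (herg :
    IsZdErgodic P) {U : Set (Space d)}
    (hU : IsBoundedLipschitzDomain U) :
    ∀ᵐ a ∂P, Tendsto (fun t : ℝ => cgA a.field (t • U)) atTop
    (𝓝 (blockForm (schur (polB (limEnergy P)) (polC (limEnergy P)) (polT (limEnergy P)))
      (polT (limEnergy P)) ((polT (limEnergy P))⁻¹ * polC (limEnergy P)))) := by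
  have hJ : ∀ p q : Fin d → ℝ, ∀ᵐ a ∂P,
      Tendsto (fun t : ℝ => J a.field (t • U) p q) atTop (𝓝 (limEnergy P p q)) := fun p q =>
    ae_tendsto_J_smul hstat herg hmom hU (tendsto_meanEnergy hstat hmom p q)
  have hpos := (isCoarse_limEnergy hstat hmom).posDef
  filter_upwards [ae_all_iff.2 fun i => ae_all_iff.2 fun j => hJ (basisVec i + basisVec j) 0,
    ae_all_iff.2 fun i => hJ (basisVec i) 0,
    ae_all_iff.2 fun i => ae_all_iff.2 fun j => hJ 0 (basisVec i + basisVec j),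
    ae_all_iff.2 fun i => hJ 0 (basisVec i),
    ae_all_iff.2 fun i => ae_all_iff.2 fun j => hJ (basisVec j) (basisVec i)] with a h1 h2 h3 h4 h5
  have hB := tendsto_polB (f := fun t : ℝ => J a.field (t • U)) h1 h2
  have hT := tendsto_polT (f := fun t : ℝ => J a.field (t • U)) h3 h4
  have hC := tendsto_polC (f := fun t : ℝ => J a.field (t • U)) h5 h2 h4
  exact tendsto_blockForm (tendsto_schur hB hC hT hpos) hT (tendsto_inv_mul hC hT hpos)

theorem meanEnergy_zero_left_le (q : Fin d → ℝ) :
    meanEnergy P 0 q 0 ≤ 1 / 2 * (q ⬝ᵥ ((expMat P fun a => avgMat (cube d 0) fun x =>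
      (symPart (a.field x))⁻¹) *ᵥ q)) := by
  refine (integral_mono (integrable_J_cube hstat hmom 0 0 q) (hmom.integrable_bulk_zero_left q)
    fun a => ?_).trans_eq ?_
  · have h := energySup_le_bulk a.admissible (isBounded_cube 0) 0 q
    simpa [energySup_cube_eq] using h
  · simp only [integral_bulk_zero_left (Coeff.admissible _)]
    rw [integral_const_mul, (integral_dotProduct_mulVec hmom.1 q q).2]
    rfl

theorem meanEnergy_zero_right_le (p : Fin d → ℝ) :
    meanEnergy P p 0 0 ≤ 1 / 2 * (p ⬝ᵥ ((expMat P fun a => avgMat (cube d 0) fun x =>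
      bMat (a.field x)) *ᵥ p)) := by
  refine (integral_mono (integrable_J_cube hstat hmom 0 p 0) (hmom.integrable_bulk_zero_right p)
    fun a => ?_).trans_eq ?_
  · have h := energySup_le_bulk a.admissible (isBounded_cube 0) p 0
    simpa [energySup_cube_eq] using h
  · simp only [integral_bulk_zero_right (Coeff.admissible _)]
    rw [integral_const_mul, (integral_dotProduct_mulVec hmom.2 p p).2]
    rfl

theorem polT_limEnergy_quad_le [IsProbabilityMeasure P] (q :
    Fin d → ℝ) : q ⬝ᵥ (polT (limEnergy P) *ᵥ q) ≤
    q ⬝ᵥ ((expMat P fun a => avgMat (cube d 0) fun x => (symPart (a.field x))⁻¹) *ᵥ q) := by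
  have h := blockQuad_limEnergy hstat hmom 0 q
  simp only [blockQuad, zero_dotProduct, mulVec_zero, dotProduct_zero, mul_zero, zero_add,
    add_zero] at h
  linarith [limEnergy_le (P := P) 0 0 q, meanEnergy_zero_left_le hstat hmom q]

theorem polB_limEnergy_quad_le [IsProbabilityMeasure P] (p :
    Fin d → ℝ) : p ⬝ᵥ (polB (limEnergy P) *ᵥ p) ≤
    p ⬝ᵥ ((expMat P fun a => avgMat (cube d 0) fun x => bMat (a.field x)) *ᵥ p) := by
  have h := blockQuad_limEnergy hstat hmom p 0
  simp only [blockQuad, zero_dotProduct, mulVec_zero, dotProduct_zero, mul_zero, add_zero] at h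
  linarith [limEnergy_le (P := P) 0 p 0, meanEnergy_zero_right_le hstat hmom p]

end Homogenized

end CoarseGraining

end

theorem proposition3p2 (d : ℕ) (hd : 2 ≤ d) (P : Measure (Coeff d)) [IsProbabilityMeasure P]
    (hstat : IsZdStationary P) (herg : IsZdErgodic P) (hmom : HasFiniteMoments P) :
    ∃ (Abar : Mat2 d) (sbar sstarbar kbar : Mat d),
      -- almost sure convergence of `A(tU)` to a deterministic limit
      (∀ U : Set (Space d), IsBoundedLipschitzDomain U →
        ∀ᵐ a ∂P, Tendsto (fun t : ℝ => cgA a.field (t • U)) atTop (𝓝 Abar)) ∧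
      -- the block form of the limit
      sbar.PosDef ∧ sstarbar.PosDef ∧ Abar = blockForm sbar sstarbar⁻¹ kbar ∧
      -- the expectations at finite scale are finite, and the limits along cubes are monotone
      (∀ n : ℕ, IntegrableMat P (fun a => cgA a.field (cube d n)) ∧
        homA P (cube d n) = expMat P (fun a => cgA a.field (cube d n))) ∧
      Antitone (fun n : ℕ => homA P (cube d n)) ∧
      Tendsto (fun n : ℕ => homA P (cube d n)) atTop (𝓝 Abar) ∧
      Antitone (fun n : ℕ => homS P (cube d n)) ∧
      Tendsto (fun n : ℕ => homS P (cube d n)) atTop (𝓝 sbar) ∧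
      Monotone (fun n : ℕ => homSstar P (cube d n)) ∧
      Tendsto (fun n : ℕ => homSstar P (cube d n)) atTop (𝓝 sstarbar) ∧
      -- ellipticity bounds
      (expMat P fun a => avgMat (cube d 0) fun x => (symPart (a.field x))⁻¹)⁻¹ ≤ sstarbar ∧
      sstarbar ≤ sbar ∧
      sbar ≤ sbar + kbarᵀ * sstarbar⁻¹ * kbar ∧
      sbar + kbarᵀ * sstarbar⁻¹ * kbar ≤
        (expMat P fun a => avgMat (cube d 0) fun x => bMat (a.field x)) ∧
      -- the symmetric part of `k̄`
      -(sbar - sstarbar) ≤ (1 / 2 : ℝ) • (kbar + kbarᵀ) ∧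
      (1 / 2 : ℝ) • (kbar + kbarᵀ) ≤ sbar - sstarbar := by
  have hco := isCoarse_limEnergy hstat hmom
  have hTT : (polT (limEnergy P))⁻¹⁻¹ = polT (limEnergy P) :=
    nonsing_inv_nonsing_inv _ hco.posDef.det_pos.ne'.isUnit
  have hb : schur (polB (limEnergy P)) (polC (limEnergy P)) (polT (limEnergy P))
      + ((polT (limEnergy P))⁻¹ * polC (limEnergy P))ᵀ * polT (limEnergy P)
        * ((polT (limEnergy P))⁻¹ * polC (limEnergy P)) = polB (limEnergy P) := sub_add_cancel _ _
  have hsT := isSymm_expMat_avgMat (P := P) (U := cube d 0)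
    (M := fun a x => (symPart (a.field x))⁻¹) fun a x => inv_symPart_isSymm _
  have hsB := isSymm_expMat_avgMat (P := P) (U := cube d 0)
    (M := fun a x => bMat (a.field x)) fun a x => bMat_isSymm _
  have hTle := polT_limEnergy_quad_le hstat hmom
  refine ⟨_, schur (polB (limEnergy P)) (polC (limEnergy P)) (polT (limEnergy P)),
    (polT (limEnergy P))⁻¹, (polT (limEnergy P))⁻¹ * polC (limEnergy P),
    fun U hU => ae_tendsto_cgA_smul hstat hmom herg hU, hco.schur_posDef, hco.posDef.inv,
    by rw [hTT], fun n => ⟨integrableMat_cgA hstat hmom n, homA_cube_eq_expMat hstat hmom n⟩,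
    antitone_homA hstat hmom, tendsto_homA hstat hmom, antitone_homS hstat hmom,
    tendsto_homS hstat hmom, monotone_homSstar hstat hmom, tendsto_homSstar hstat hmom,
    -- The mean of s⁻¹ is positive definite because its form dominates that of the limiting s_*⁻¹;
    -- inverting reverses the inequality.
    hco.posDef.inv_anti (posDef_of_quad hsT fun q hq =>
      (hco.posDef.quad_pos hq).trans_le (hTle q)) hTle,
    hco.inv_le_schur, ?_, ?_, hco.neg_le_symm_cross, hco.symm_cross_le⟩
  · rw [hTT]
    exact hco.le_schur_add
  · rw [hTT, hb]
    exact le_of_quad hco.symmB hsB (polB_limEnergy_quad_le hstat hmom)
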